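/- **Setting.** Let $(X_n)_{n\ge1}$ be the first-order random coefficient bifurcating autoregressive process $$X_{2n}=a_nX_n+\varepsilon_{2n},\qquad X_{2n+1}=b_nX_n+\varepsilon_{2n+1}\qquad(n\ge1),$$ where $\mathbb E[X_1^2]<\infty$, the pairs $(a_n,b_n)_{n\ge1}$ are i.i.d., the pairs $(\varepsilon_{2n},\varepsilon_{2n+1})_{n\ge1}$ are i.i.d., and these two sequences are independent of each other. Let $\mathbb G_n=\{2^n,\dots,2^{n+1}-1\}$, $\mathbb T_n=\bigcup_{k=0}^n\mathbb G_k$ and $\mathcal F_n=\sigma\{X_k:k\in\mathbb T_n\}$. Assume that there are real numbers $a,b,c,d$ such that for all $n\ge0$ and $k\in\mathbb G_n$, almost surely, $$\mathbb E[a_k|\mathcal F_n]=a,\quad \mathbb E[b_k|\mathcal F_n]=b,\quad \mathbb E[\varepsilon_{2k}|\mathcal F_n]=c,\quad \mathbb E[\varepsilon_{2k+1}|\mathcal F_n]=d .$$ **Hypotheses.** (H.1) $\mathbb E[a_k^2]<1$ and $\mathbb E[b_k^2]<1$ for all $k\ge1$. (H.2) For all $n\ge0$, $k\in\mathbb G_n$,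 a.s. $\mathrm{Var}[a_k|\mathcal F_n]=\sigma_a^2\ge0$, $\mathrm{Var}[b_k|\mathcal F_n]=\sigma_b^2\ge0$, $\mathrm{Var}[\varepsilon_{2k}|\mathcal F_n]=\sigma_c^2>0$, $\mathrm{Var}[\varepsilon_{2k+1}|\mathcal F_n]=\sigma_d^2>0$. (H.3) For all $n\ge0$: for $k,l\in\mathbb G_{n+1}$ with $\lfloor k/2\rfloor\ne\lfloor l/2\rfloor$, $\varepsilon_k$ and $\varepsilon_l$ are conditionally independent given $\mathcal F_n$; for $k\ne l$ in $\mathbb G_n$, $(a_k,b_k)$ and $(a_l,b_l)$ are conditionally independent given $\mathcal F_n$; and there are $\rho_{cd},\rho_{ab}$ (not depending on $n,k$) with $\rho_{cd}^2<\sigma_c^2\sigma_d^2$, $\rho_{ab}^2\le\sigma_a^2\sigma_b^2$ and, for all $k\in\mathbb G_n$, a.s. $\mathbb E[(\varepsilon_{2k}-c)(\varepsilon_{2k+1}-d)|\mathcal F_n]=\rho_{cd}$, $\mathbb E[(a_k-a)(b_k-b)|\mathcal F_n]=\rho_{ab}$. (H.4) The fourth moments of $a_k,b_k,\varepsilon_{2k},\varepsilon_{2k+1}$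 are finite, and there are constants $\mu_a^4\ge\sigma_a^4$, $\mu_b^4\ge\sigma_b^4$, $\mu_c^4>\sigma_c^4$, $\mu_d^4>\sigma_d^4$, $\nu_{ab}^2\ge\rho_{ab}^2$, $\nu_{cd}^2>\rho_{cd}^2$ such that for all $n\ge0$, $k\in\mathbb G_n$, a.s. $$\mathbb E[(a_k-a)^4|\mathcal F_n]=\mu_a^4,\quad \mathbb E[(b_k-b)^4|\mathcal F_n]=\mu_b^4,\quad \mathbb E[(\varepsilon_{2k}-c)^4|\mathcal F_n]=\mu_c^4,\quad \mathbb E[(\varepsilon_{2k+1}-d)^4|\mathcal F_n]=\mu_d^4,$$ $$\mathbb E[(a_k-a)^2(b_k-b)^2|\mathcal F_n]=\nu_{ab}^2,\quad \mathbb E[(\varepsilon_{2k}-c)^2(\varepsilon_{2k+1}-d)^2|\mathcal F_n]=\nu_{cd}^2,$$ and $\mathbb E[\varepsilon_{2k}^4]>\mathbb E[\varepsilon_{2k}^2]^2$, $\mathbb E[\varepsilon_{2k+1}^4]>\mathbb E[\varepsilon_{2k+1}^2]^2$. (H.5) There is $\alpha>4$ such that, almost surely, $\sup_{n\ge0}\sup_{k\in\mathbb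 G_n}\mathbb E[|\zeta_k|^\alpha|\mathcal F_n]<\infty$ for each of the four choices $\zeta_k=a_k-a$, $b_k-b$, $\varepsilon_{2k}-c$, $\varepsilon_{2k+1}-d$. **Estimator.** Put $c_k=1+X_k^2$, $\Phi_k=(X_k,1)^t$, $\chi_k=(X_{2k},X_{2k+1})^t$ and $S_n=\sum_{k\in\mathbb T_n}c_k^{-1}\Phi_k\Phi_k^t$, where $S_n$ is replaced by $S_n+I_2$ whenever it is not invertible. For $n\ge1$ the weighted least squares estimator is $$\hat\theta_n=S_{n-1}^{-1}\sum_{k\in\mathbb T_{n-1}}c_k^{-1}\Phi_k\chi_k^t ,$$ an estimator of $\theta=\begin{pmatrix}a&b\\c&d\end{pmatrix}$. Both matrices are identified with the vectors in $\mathbb R^4$ obtained by stacking their columns, so that $\theta=(a,c,b,d)^t$. **Limit law.** Let $(\kappa_n)_{n\ge1}$ be i.i.d. fair Bernoulli variables with values in $\{0,1\}$, independent of all the above (on an enlarged probability space), let $k_1=1$, $k_{n+1}=2k_n+\kappa_n$, and $Y_n=X_{k_n}$. **Theorem.** Assume (H.1)–(H.5). Then $\hat\theta_n\to\theta$ almost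 surely, and $$\|\hat\theta_n-\theta\|^2=O\!\left(\frac n{|\mathbb T_{n-1}|}\right)\quad\text{a.s.}$$ Moreover $Y_n$ converges in distribution to a real random variable $T$, the matrix $$C=\mathbb E\left[\frac1{1+T^2}\begin{pmatrix}T^2&T\\T&1\end{pmatrix}\right]$$ is positive definite, and with $\Lambda=I_2\otimes C$ and $$L=\mathbb E\left[\frac1{(1+T^2)^2}\begin{pmatrix}\sigma_a^2T^2+\sigma_c^2&\rho_{ab}T^2+\rho_{cd}\\ \rho_{ab}T^2+\rho_{cd}&\sigma_b^2T^2+\sigma_d^2\end{pmatrix}\otimes\begin{pmatrix}T^2&T\\T&1\end{pmatrix}\right]$$ the quadratic strong law holds: $$\lim_{n\to\infty}\frac1n\sum_{k=1}^n|\mathbb T_{k-1}|(\hat\theta_k-\theta)^t\Lambda(\hat\theta_k-\theta)=\mathrm{tr}\big(\Lambda^{-1/2}L\Lambda^{-1/2}\big)\quad\text{a.s.}$$ -/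

import Mathlib

open MeasureTheory ProbabilityTheory Filter Topology Matrix
open scoped ENNReal Kronecker MatrixOrder

noncomputable section

namespace RCBAR

/-! ### The binary tree -/

/-- The `n`-th generation `{2^n, …, 2^(n+1) - 1}` of the binary tree rooted at `1`. -/
def gen (n : ℕ) : Finset ℕ := Finset.Ico (2 ^ n) (2 ^ (n + 1))

/-- The sub-tree of all individuals up to generation `n`. -/
def tree (n : ℕ) : Finset ℕ := (Finset.range (n + 1)).biUnion gen

/-! ### The process -/

section Model

variable {Ω : Type*} [MeasurableSpace Ω]

/-- The natural filtration: the σ-algebra generated by `X k`, for `k` up to generation `n`. -/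
abbrev natFiltration (X : ℕ → Ω → ℝ) (n : ℕ) : MeasurableSpace Ω :=
  ⨆ k ∈ tree n, MeasurableSpace.comap (X k) inferInstance

/-- Conditional independence of `f` and `g` given the sub-σ-algebra `m`. -/
def CondIndepGiven {β γ : Type*} [MeasurableSpace β] [MeasurableSpace γ]
    (P : Measure Ω) (m : MeasurableSpace Ω) (f : Ω → β) (g : Ω → γ) : Prop :=
  ∀ (s : Set β) (t : Set γ), MeasurableSet s → MeasurableSet t →
    P[(f ⁻¹' s ∩ g ⁻¹' t).indicator (fun _ => (1 : ℝ)) | m] =ᵐ[P]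
      P[(f ⁻¹' s).indicator (fun _ => (1 : ℝ)) | m] *
        P[(g ⁻¹' t).indicator (fun _ => (1 : ℝ)) | m]

/-- The first-order random coefficient bifurcating autoregressive process
`X (2n) = A n * X n + ε (2n)`, `X (2n+1) = B n * X n + ε (2n+1)` for `n ≥ 1`, with its standing
assumptions. The values `X 0`, `A 0`, `B 0`, `ε 0`, `ε 1` play no role. -/
structure IsProcess (P : Measure Ω) (X A B ε : ℕ → Ω → ℝ) (a b c d : ℝ) : Prop where
  measurable_init : Measurable (X 1)
  measurable_coef : ∀ n, 1 ≤ n → Measurable (A n) ∧ Measurable (B n)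
  measurable_noise : ∀ n, 1 ≤ n → Measurable (ε (2 * n)) ∧ Measurable (ε (2 * n + 1))
  even_eq : ∀ n, 1 ≤ n → ∀ ω, X (2 * n) ω = A n ω * X n ω + ε (2 * n) ω
  odd_eq : ∀ n, 1 ≤ n → ∀ ω, X (2 * n + 1) ω = B n ω * X n ω + ε (2 * n + 1) ω
  init_sq : MemLp (X 1) 2 P
  /- The pairs `(A n, B n)`, `n ≥ 1`, are i.i.d. -/
  coef_indep : iIndepFun (fun (n : ℕ) ω => (A (n + 1) ω, B (n + 1) ω)) P
  coef_ident : ∀ n, 1 ≤ n →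
    IdentDistrib (fun ω => (A n ω, B n ω)) (fun ω => (A 1 ω, B 1 ω)) P P
  /- The pairs `(ε (2n), ε (2n+1))`, `n ≥ 1`, are i.i.d. -/
  noise_indep : iIndepFun (fun (n : ℕ) ω => (ε (2 * (n + 1)) ω, ε (2 * (n + 1) + 1) ω)) P
  noise_ident : ∀ n, 1 ≤ n →
    IdentDistrib (fun ω => (ε (2 * n) ω, ε (2 * n + 1) ω)) (fun ω => (ε 2 ω, ε 3 ω)) P P
  /- The two sequences are independent of each other. -/
  coef_indep_noise : IndepFun (fun ω (n : ℕ) => (A (n + 1) ω, B (n + 1) ω))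
    (fun ω (n : ℕ) => (ε (2 * (n + 1)) ω, ε (2 * (n + 1) + 1) ω)) P
  /- Conditional means. -/
  integrable_coef : ∀ k, 1 ≤ k → Integrable (A k) P ∧ Integrable (B k) P
  integrable_noise : ∀ k, 1 ≤ k → Integrable (ε (2 * k)) P ∧ Integrable (ε (2 * k + 1)) P
  mean_A : ∀ n, ∀ k ∈ gen n, P[A k | natFiltration X n] =ᵐ[P] fun _ => a
  mean_B : ∀ n, ∀ k ∈ gen n, P[B k | natFiltration X n] =ᵐ[P] fun _ => b
  mean_even : ∀ n, ∀ k ∈ gen n, P[ε (2 * k) | natFiltration X n] =ᵐ[P] fun _ => c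
  mean_odd : ∀ n, ∀ k ∈ gen n, P[ε (2 * k + 1) | natFiltration X n] =ᵐ[P] fun _ => d

/-- Hypothesis (H.1): second moments smaller than one. -/
structure H1 (P : Measure Ω) (A B : ℕ → Ω → ℝ) : Prop where
  memLp : ∀ k, 1 ≤ k → MemLp (A k) 2 P ∧ MemLp (B k) 2 P
  sq_A : ∀ k, 1 ≤ k → ∫ ω, A k ω ^ 2 ∂P < 1
  sq_B : ∀ k, 1 ≤ k → ∫ ω, B k ω ^ 2 ∂P < 1

/-- Hypothesis (H.2): conditional variances `σa ^ 2`, `σb ^ 2`, `σc ^ 2`, `σd ^ 2`. -/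
structure H2 (P : Measure Ω) (X A B ε : ℕ → Ω → ℝ) (σa σb σc σd : ℝ) : Prop where
  memLp_coef : ∀ k, 1 ≤ k → MemLp (A k) 2 P ∧ MemLp (B k) 2 P
  memLp_noise : ∀ k, 1 ≤ k → MemLp (ε (2 * k)) 2 P ∧ MemLp (ε (2 * k + 1)) 2 P
  pos_c : 0 < σc ^ 2
  pos_d : 0 < σd ^ 2
  var_A : ∀ n, ∀ k ∈ gen n, Var[A k; P | natFiltration X n] =ᵐ[P] fun _ => σa ^ 2
  var_B : ∀ n, ∀ k ∈ gen n, Var[B k; P | natFiltration X n] =ᵐ[P] fun _ => σb ^ 2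
  var_even : ∀ n, ∀ k ∈ gen n, Var[ε (2 * k); P | natFiltration X n] =ᵐ[P] fun _ => σc ^ 2
  var_odd : ∀ n, ∀ k ∈ gen n, Var[ε (2 * k + 1); P | natFiltration X n] =ᵐ[P] fun _ => σd ^ 2

/-- Hypothesis (H.3): conditional independence between different sisterhoods, and conditional covariances
`ρab`, `ρcd` inside a sisterhood. -/
structure H3 (P : Measure Ω) (X A B ε : ℕ → Ω → ℝ) (a b c d σa σb σc σd ρab ρcd : ℝ) :
    Prop where
  noise_condIndep : ∀ n, ∀ k ∈ gen (n + 1), ∀ l ∈ gen (n + 1), k / 2 ≠ l / 2 →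
    CondIndepGiven P (natFiltration X n) (ε k) (ε l)
  coef_condIndep : ∀ n, ∀ k ∈ gen n, ∀ l ∈ gen n, k ≠ l →
    CondIndepGiven P (natFiltration X n) (fun ω => (A k ω, B k ω)) (fun ω => (A l ω, B l ω))
  cov_lt : ρcd ^ 2 < σc ^ 2 * σd ^ 2
  cov_le : ρab ^ 2 ≤ σa ^ 2 * σb ^ 2
  cov_noise : ∀ n, ∀ k ∈ gen n,
    P[fun ω => (ε (2 * k) ω - c) * (ε (2 * k + 1) ω - d) | natFiltration X n] =ᵐ[P] fun _ => ρcd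
  cov_coef : ∀ n, ∀ k ∈ gen n,
    P[fun ω => (A k ω - a) * (B k ω - b) | natFiltration X n] =ᵐ[P] fun _ => ρab

/-- Hypothesis (H.4), for given values `μa ^ 4`, …, `νcd ^ 2` of the conditional moments of order four. -/
structure H4With (P : Measure Ω) (X A B ε : ℕ → Ω → ℝ)
    (a b c d σa σb σc σd ρab ρcd μa μb μc μd νab νcd : ℝ) : Prop where
  memLp_coef : ∀ k, 1 ≤ k → MemLp (A k) 4 P ∧ MemLp (B k) 4 P
  memLp_noise : ∀ k, 1 ≤ k → MemLp (ε (2 * k)) 4 P ∧ MemLp (ε (2 * k + 1)) 4 P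
  le_a : σa ^ 4 ≤ μa ^ 4
  le_b : σb ^ 4 ≤ μb ^ 4
  lt_c : σc ^ 4 < μc ^ 4
  lt_d : σd ^ 4 < μd ^ 4
  fourth_A : ∀ n, ∀ k ∈ gen n,
    P[fun ω => (A k ω - a) ^ 4 | natFiltration X n] =ᵐ[P] fun _ => μa ^ 4
  fourth_B : ∀ n, ∀ k ∈ gen n,
    P[fun ω => (B k ω - b) ^ 4 | natFiltration X n] =ᵐ[P] fun _ => μb ^ 4
  fourth_even : ∀ n, ∀ k ∈ gen n,
    P[fun ω => (ε (2 * k) ω - c) ^ 4 | natFiltration X n] =ᵐ[P] fun _ => μc ^ 4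
  fourth_odd : ∀ n, ∀ k ∈ gen n,
    P[fun ω => (ε (2 * k + 1) ω - d) ^ 4 | natFiltration X n] =ᵐ[P] fun _ => μd ^ 4
  noncentral_even : ∀ k, 1 ≤ k → (∫ ω, ε (2 * k) ω ^ 2 ∂P) ^ 2 < ∫ ω, ε (2 * k) ω ^ 4 ∂P
  noncentral_odd : ∀ k, 1 ≤ k →
    (∫ ω, ε (2 * k + 1) ω ^ 2 ∂P) ^ 2 < ∫ ω, ε (2 * k + 1) ω ^ 4 ∂P
  le_ab : ρab ^ 2 ≤ νab ^ 2
  lt_cd : ρcd ^ 2 < νcd ^ 2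
  mixed_coef : ∀ n, ∀ k ∈ gen n,
    P[fun ω => (A k ω - a) ^ 2 * (B k ω - b) ^ 2 | natFiltration X n] =ᵐ[P] fun _ => νab ^ 2
  mixed_noise : ∀ n, ∀ k ∈ gen n,
    P[fun ω => (ε (2 * k) ω - c) ^ 2 * (ε (2 * k + 1) ω - d) ^ 2 | natFiltration X n]
      =ᵐ[P] fun _ => νcd ^ 2

/-- Hypothesis (H.4): conditional moments of order four. -/
def H4 (P : Measure Ω) (X A B ε : ℕ → Ω → ℝ) (a b c d σa σb σc σd ρab ρcd : ℝ) : Prop :=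
  ∃ μa μb μc μd νab νcd : ℝ,
    H4With P X A B ε a b c d σa σb σc σd ρab ρcd μa μb μc μd νab νcd

/-- Hypothesis (H.5): conditional moments of some order `α > 4`. The conditional expectations of the nonnegative variables are taken with values in
`[0, ∞]`. -/
def H5 (P : Measure Ω) (X A B ε : ℕ → Ω → ℝ) (a b c d : ℝ) : Prop :=
  ∃ α : ℝ, 4 < α ∧
    (∀ᵐ ω ∂P, ⨆ n, ⨆ k ∈ gen n,
      P⁻[fun ω' => ENNReal.ofReal (|A k ω' - a| ^ α) | natFiltration X n] ω < ∞) ∧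
    (∀ᵐ ω ∂P, ⨆ n, ⨆ k ∈ gen n,
      P⁻[fun ω' => ENNReal.ofReal (|B k ω' - b| ^ α) | natFiltration X n] ω < ∞) ∧
    (∀ᵐ ω ∂P, ⨆ n, ⨆ k ∈ gen n,
      P⁻[fun ω' => ENNReal.ofReal (|ε (2 * k) ω' - c| ^ α) | natFiltration X n] ω < ∞) ∧
    (∀ᵐ ω ∂P, ⨆ n, ⨆ k ∈ gen n,
      P⁻[fun ω' => ENNReal.ofReal (|ε (2 * k + 1) ω' - d| ^ α) | natFiltration X n] ω < ∞)

end Model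

/-! ### The weighted least squares estimator, as a function of a trajectory `x` -/

/-- The weight `c_k = 1 + x_k ^ 2`. -/
def weight (x : ℕ → ℝ) (k : ℕ) : ℝ := 1 + x k ^ 2

/-- `Φ_k = (x_k, 1)`. -/
def regressor (x : ℕ → ℝ) (k : ℕ) : Fin 2 → ℝ := ![x k, 1]

/-- `χ_k = (x_{2k}, x_{2k+1})`. -/
def response (x : ℕ → ℝ) (k : ℕ) : Fin 2 → ℝ := ![x (2 * k), x (2 * k + 1)]

/-- `S_n = ∑_{k ∈ T_n} c_k⁻¹ Φ_k Φ_kᵗ`. -/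
def S (x : ℕ → ℝ) (n : ℕ) : Matrix (Fin 2) (Fin 2) ℝ :=
  ∑ k ∈ tree n, (weight x k)⁻¹ • vecMulVec (regressor x k) (regressor x k)

/-- `S_n`, to which the identity matrix is added when it is not invertible
(as is always the case for `n = 0`). -/
def SReg (x : ℕ → ℝ) (n : ℕ) : Matrix (Fin 2) (Fin 2) ℝ :=
  if (S x n).det = 0 then S x n + 1 else S x n

/-- The estimator `S_{n-1}⁻¹ ∑_{k ∈ T_{n-1}} c_k⁻¹ Φ_k χ_kᵗ` as a `2 × 2` matrix, for `n ≥ 1`. -/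
def thetaHatMat (x : ℕ → ℝ) (n : ℕ) : Matrix (Fin 2) (Fin 2) ℝ :=
  (SReg x (n - 1))⁻¹ *
    ∑ k ∈ tree (n - 1), (weight x k)⁻¹ • vecMulVec (regressor x k) (response x k)

/-- The estimator in vector form: `Matrix.vec` stacks the columns, so that the coordinates
`(0,0)`, `(0,1)`, `(1,0)`, `(1,1)` are the estimators of `a`, `c`, `b`, `d`. -/
def thetaHat (x : ℕ → ℝ) (n : ℕ) : Fin 2 × Fin 2 → ℝ := (thetaHatMat x n).vec

/-- The parameter `(a, c, b, d)`. -/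
def theta (a b c d : ℝ) : Fin 2 × Fin 2 → ℝ := (!![a, b; c, d]).vec

/-! ### The limit law -/

/-- The individual of generation `n` on the branch which starts at `1` and goes from `k` to
`2k + κ`. -/
def branch (κ : ℕ → Fin 2) : ℕ → ℕ
  | 0 => 1
  | n + 1 => 2 * branch κ n + (κ n : ℕ)

/-- The law of a sequence of independent fair coin tosses. -/
def coins : Measure (ℕ → Fin 2) :=
  Measure.infinitePi fun _ => (PMF.uniformOfFintype (Fin 2)).toMeasure

instance : IsProbabilityMeasure coins := by
  unfold coins; infer_instance

/-- The process along the random branch, on the product of the original space with the coin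
tosses. -/
def branchProcess {Ω : Type*} (X : ℕ → Ω → ℝ) (n : ℕ) (p : Ω × (ℕ → Fin 2)) : ℝ :=
  X (branch p.2 n) p.1

/-- `C = E[(1 + T²)⁻¹ (T², T; T, 1)]` when `T` has law `τ`. -/
def C (τ : Measure ℝ) : Matrix (Fin 2) (Fin 2) ℝ :=
  Matrix.of fun i j => ∫ t, ((1 + t ^ 2)⁻¹ • !![t ^ 2, t; t, 1]) i j ∂τ

/-- `Λ = I₂ ⊗ C`. -/
def Lam (τ : Measure ℝ) : Matrix (Fin 2 × Fin 2) (Fin 2 × Fin 2) ℝ :=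
  (1 : Matrix (Fin 2) (Fin 2) ℝ) ⊗ₖ C τ

/-- The matrix `(P(t), Q(t); Q(t), R(t))`. -/
def noiseCov (σa σb σc σd ρab ρcd t : ℝ) : Matrix (Fin 2) (Fin 2) ℝ :=
  !![σa ^ 2 * t ^ 2 + σc ^ 2, ρab * t ^ 2 + ρcd; ρab * t ^ 2 + ρcd, σb ^ 2 * t ^ 2 + σd ^ 2]

/-- `L = E[(1 + T²)⁻² (P(T), Q(T); Q(T), R(T)) ⊗ (T², T; T, 1)]` when `T` has law `τ`. -/
def L (σa σb σc σd ρab ρcd : ℝ) (τ : Measure ℝ) :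
    Matrix (Fin 2 × Fin 2) (Fin 2 × Fin 2) ℝ :=
  Matrix.of fun i j => ∫ t, (((1 + t ^ 2) ^ 2)⁻¹ •
    (noiseCov σa σb σc σd ρab ρcd t ⊗ₖ !![t ^ 2, t; t, 1])) i j ∂τ

/-- The inverse `M^(-1/2)` of the positive semidefinite square root. -/
def invSqrt {ι : Type*} [Fintype ι] [DecidableEq ι] (M : Matrix ι ι ℝ) : Matrix ι ι ℝ :=
  (CFC.sqrt M)⁻¹

end RCBAR

end

noncomputable section

namespace RCBAR

/-! ### Sums over the binary tree -/

/-! Along the tree the process is an affine function of its root, X_k = base_k + slope_k X_1, where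
`base` and `slope` depend only on the inputs ((a_j, b_j), (ε_{2j}, ε_{2j+1})) of the proper
ancestors j < k. These inputs are i.i.d., but nothing makes X_1 independent of them. Each almost
sure limit is therefore proved first for the recursion started at 0, then for all starting points x
outside one common null set, and finally used at x = X_1(ω).

Law of large numbers. The transition operator of a uniformly chosen branch shrinks Lipschitz
constants by √ρ < 1, where ρ bounds the second moments of the coefficients. A tightness argument
then yields the stationary law τ (`exists_isStationary`). Passing from one generation to the next
costs a martingale term of L² size 2^{-n/2}. Sampling error and contraction together give summable
L¹ errors, so generation averages of bounded Lipschitz functions converge to integrals against τ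
(`ae_tendsto_genAvg`).

Quadratic strong law. The estimation error is S_{n-1}⁻¹ times a martingale, the score, and 2^{-n}
S_{n-1} → C. The product of two score components splits into a diagonal sum, governed by the law of
large numbers, and two sums of past score times new increment, whose normalised Cesàro means vanish
by an L² argument (`ae_tendsto_score_zero`). The starting point is negligible because the derivative
of the score in x carries the factor `slope`, which decays in mean square (`ae_tendsto_score_sub`).
A matrix argument transfers the limit to the estimator (`tendsto_average_errorForm`).

The rate follows because one term of a nonnegative sum of order n is itself O(n), and consistency
follows from the rate. C is positive definite because the noise prevents τ from being a point mass.
-/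

lemma sum_Ico_double {M : Type*} [AddCommMonoid M] (f : ℕ → M) (u v : ℕ) (huv : u ≤ v) :
    ∑ k ∈ Finset.Ico (2 * u) (2 * v), f k
      = ∑ k ∈ Finset.Ico u v, (f (2 * k) + f (2 * k + 1)) := by
  induction v, huv using Nat.le_induction with
  | base => simp
  | succ v huv ih =>
    rw [Finset.sum_Ico_succ_top huv, ← ih, show 2 * (v + 1) = 2 * v + 1 + 1 by ring,
      Finset.sum_Ico_succ_top (by omega), Finset.sum_Ico_succ_top (by omega), add_assoc]

lemma sum_gen_succ {M : Type*} [AddCommMonoid M] (f : ℕ → M) (n : ℕ) :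
    ∑ k ∈ gen (n + 1), f k = ∑ k ∈ gen n, (f (2 * k) + f (2 * k + 1)) := by
  have := sum_Ico_double f (2 ^ n) (2 ^ (n + 1)) (Nat.pow_le_pow_right (by norm_num) (by omega))
  rwa [← pow_succ', ← pow_succ'] at this

lemma sum_Ico_eq_sum_gen {M : Type*} [AddCommMonoid M] (f : ℕ → M) (n : ℕ) :
    ∑ k ∈ Finset.Ico 1 (2 ^ n), f k = ∑ j ∈ Finset.range n, ∑ k ∈ gen j, f k := by
  induction n with
  | zero => simp
  | succ n ih =>
    rw [Finset.sum_range_succ, ← ih, gen, Finset.sum_Ico_consecutive _ Nat.one_le_two_pow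
      (Nat.pow_le_pow_right (by norm_num) (by omega))]

lemma tree_eq_Ico (n : ℕ) : tree n = Finset.Ico 1 (2 ^ (n + 1)) := by
  induction n with
  | zero => rfl
  | succ n ih =>
    rw [tree, Finset.range_add_one, Finset.biUnion_insert]
    change gen (n + 1) ∪ tree n = _
    rw [ih, gen, Finset.union_comm, Finset.Ico_union_Ico_eq_Ico Nat.one_le_two_pow
      (Nat.pow_le_pow_right (by norm_num) (by omega))]

lemma card_gen (n : ℕ) : (gen n).card = 2 ^ n := by
  rw [gen, Nat.card_Ico, pow_succ]; omega

lemma card_tree_pred {n : ℕ} (hn : 1 ≤ n) : ((tree (n - 1)).card : ℝ) = 2 ^ n - 1 := by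
  rw [tree_eq_Ico, Nat.card_Ico, Nat.sub_add_cancel hn, Nat.cast_sub Nat.one_le_two_pow]
  simp

lemma one_le_of_mem_gen {n k : ℕ} (hk : k ∈ gen n) : 1 ≤ k :=
  Nat.one_le_two_pow.trans (Finset.mem_Ico.1 hk).1

/-! ### Weighted averages -/

/-- A Toeplitz average: the weights 2^j have total 2^n - 1, asymptotic to the normalisation. It
turns limits over generations into limits over the whole tree. -/
lemma tendsto_geometric_average {u : ℕ → ℝ} {l : ℝ} (hu : Tendsto u atTop (𝓝 l)) :
    Tendsto (fun n => ((2 : ℝ) ^ n)⁻¹ * ∑ j ∈ Finset.range n, 2 ^ j * u j) atTop (𝓝 l) := by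
  have hsum : ∀ n : ℕ, ∑ j ∈ Finset.range n, (2 : ℝ) ^ j = 2 ^ n - 1 := fun n => by
    rw [geom_sum_eq (by norm_num)]; norm_num
  have h1 : (fun j => (2 : ℝ) ^ j * (u j - l)) =o[atTop] fun j => (2 : ℝ) ^ j := by
    have h0 : (fun j => u j - l) =o[atTop] fun _ => (1 : ℝ) :=
      (Asymptotics.isLittleO_one_iff ℝ).2 (by simpa using hu.sub_const l)
    simpa using (Asymptotics.isBigO_refl (fun j : ℕ => (2 : ℝ) ^ j) atTop).mul_isLittleO h0
  have hinf : Tendsto (fun n : ℕ => (2 : ℝ) ^ n - 1) atTop atTop :=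
    tendsto_atTop_add_const_right _ _ (tendsto_pow_atTop_atTop_of_one_lt (by norm_num))
  have h2 := h1.sum_range (fun n => by positivity) (by simpa only [hsum] using hinf)
  simp only [hsum] at h2
  have h3 : (fun n => ∑ j ∈ Finset.range n, (2 : ℝ) ^ j * (u j - l)) =o[atTop]
      fun n => (2 : ℝ) ^ n := by
    refine h2.trans_le fun n => ?_
    have : (1 : ℝ) ≤ 2 ^ n := one_le_pow₀ (by norm_num)
    rw [Real.norm_of_nonneg (by linarith), Real.norm_of_nonneg (by linarith)]
    linarith
  have h4 := h3.tendsto_div_nhds_zero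
  have h5 : Tendsto (fun n : ℕ => ((2 : ℝ) ^ n)⁻¹) atTop (𝓝 0) :=
    (tendsto_pow_atTop_atTop_of_one_lt (by norm_num)).inv_tendsto_atTop
  have h6 := (h4.add (tendsto_const_nhds (x := l))).sub (h5.mul_const l)
  simp only [zero_add, zero_mul, sub_zero] at h6
  refine h6.congr fun n => ?_
  have hs : ∑ j ∈ Finset.range n, (2 : ℝ) ^ j * (u j - l)
      = ∑ j ∈ Finset.range n, (2 : ℝ) ^ j * u j - (2 ^ n - 1) * l := by
    rw [← hsum, Finset.sum_mul, ← Finset.sum_sub_distrib]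
    exact Finset.sum_congr rfl fun _ _ => by ring
  have : (2 : ℝ) ^ n ≠ 0 := by positivity
  rw [hs]; field_simp; ring

/-- The terms g v are negligible against v + 1. The added 1 makes the comparison sums diverge, while
they stay below (K + 1) N. -/
lemma tendsto_average_of_tendsto_zero {g v : ℕ → ℝ} (hg : Tendsto g atTop (𝓝 0))
    (hv : ∀ n, 0 ≤ v n) {K : ℝ} (hK : ∀ N : ℕ, ∑ n ∈ Finset.range N, v n ≤ K * N) :
    Tendsto (fun N : ℕ => (N : ℝ)⁻¹ * ∑ n ∈ Finset.range N, g n * v n) atTop (𝓝 0) := by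
  have h1 : (fun n => g n * v n) =o[atTop] fun n => v n + 1 := by
    have h0 : g =o[atTop] fun _ => (1 : ℝ) := (Asymptotics.isLittleO_one_iff ℝ).2 hg
    have : (fun n => g n * v n) =o[atTop] fun n => 1 * (v n + 1) := by
      refine h0.mul_isBigO (Asymptotics.IsBigO.of_bound 1 (Eventually.of_forall fun n => ?_))
      rw [Real.norm_of_nonneg (hv n), Real.norm_of_nonneg (by linarith [hv n])]
      linarith
    simpa using this
  have hge : ∀ N : ℕ, (N : ℝ) ≤ ∑ n ∈ Finset.range N, (v n + 1) := fun N => by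
    rw [Finset.sum_add_distrib]
    have := Finset.sum_nonneg fun n (_ : n ∈ Finset.range N) => hv n
    simpa using this
  have h2 := h1.sum_range (fun n => add_nonneg (hv n) zero_le_one)
    (tendsto_atTop_mono hge tendsto_natCast_atTop_atTop)
  have h3 : (fun N => ∑ n ∈ Finset.range N, (v n + 1)) =O[atTop] fun N : ℕ => (N : ℝ) := by
    refine Asymptotics.IsBigO.of_bound (K + 1) (Eventually.of_forall fun N => ?_)
    rw [Real.norm_of_nonneg ((Nat.cast_nonneg N).trans (hge N)),
      Real.norm_of_nonneg (Nat.cast_nonneg N), Finset.sum_add_distrib]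
    have := hK N
    simp only [Finset.sum_const, Finset.card_range, nsmul_eq_mul, mul_one]
    linarith
  exact (h2.trans_isBigO h3).tendsto_div_nhds_zero.congr fun N => by rw [div_eq_inv_mul]

/-! ### Almost sure convergence from summable moments -/

section AlmostSure

variable {Ω : Type*} [MeasurableSpace Ω] {P : Measure Ω}

/-- Summable expectations make the series of the U n almost surely finite, so its terms vanish. -/
lemma ae_tendsto_zero_of_lintegral {U : ℕ → Ω → ℝ≥0∞} (hU : ∀ n, AEMeasurable (U n) P)
    {c : ℕ → ℝ} (hc : Summable c) (hUc : ∀ n, ∫⁻ ω, U n ω ∂P ≤ ENNReal.ofReal (c n)) :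
    ∀ᵐ ω ∂P, Tendsto (fun n => U n ω) atTop (𝓝 0) := by
  have h1 : ∫⁻ ω, ∑' n, U n ω ∂P ≠ ∞ := by
    rw [lintegral_tsum hU]
    refine ne_top_of_le_ne_top ?_ (ENNReal.tsum_le_tsum hUc)
    exact hc.tsum_ofReal_ne_top
  filter_upwards [ae_lt_top' (AEMeasurable.tsum hU) h1] with ω hω
  exact ENNReal.tendsto_atTop_zero_of_tsum_ne_top hω.ne

lemma ae_tendsto_zero_of_integral {u : ℕ → Ω → ℝ} (hu : ∀ n, Integrable (u n) P)
    (h0 : ∀ n ω, 0 ≤ u n ω) {c : ℕ → ℝ} (hc : Summable c) (huc : ∀ n, ∫ ω, u n ω ∂P ≤ c n) :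
    ∀ᵐ ω ∂P, Tendsto (fun n => u n ω) atTop (𝓝 0) := by
  have := ae_tendsto_zero_of_lintegral (P := P) (U := fun n ω => ENNReal.ofReal (u n ω))
    (fun n => (hu n).1.aemeasurable.ennreal_ofReal) hc fun n => by
      rw [← ofReal_integral_eq_lintegral_ofReal (hu n) (Eventually.of_forall (h0 n))]
      exact ENNReal.ofReal_le_ofReal (huc n)
  filter_upwards [this] with ω hω
  have h2 := (ENNReal.tendsto_toReal ENNReal.zero_ne_top).comp hω
  simpa [Function.comp_def, ENNReal.toReal_ofReal (h0 _ ω)] using h2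

lemma tendsto_zero_of_sq {u : ℕ → ℝ} (h : Tendsto (fun n => u n ^ 2) atTop (𝓝 0)) :
    Tendsto u atTop (𝓝 0) := by
  have := h.sqrt
  simp only [Real.sqrt_sq_eq_abs, Real.sqrt_zero] at this
  exact (tendsto_zero_iff_abs_tendsto_zero u).2 this

lemma ae_tendsto_zero_of_integral_sq {u : ℕ → Ω → ℝ} (hu : ∀ n, MemLp (u n) 2 P)
    {c : ℕ → ℝ} (hc : Summable c) (huc : ∀ n, ∫ ω, u n ω ^ 2 ∂P ≤ c n) :
    ∀ᵐ ω ∂P, Tendsto (fun n => u n ω) atTop (𝓝 0) := by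
  filter_upwards [ae_tendsto_zero_of_integral (fun n => (hu n).integrable_sq)
    (fun n ω => sq_nonneg _) hc huc] with ω hω
  exact tendsto_zero_of_sq hω

/-- Strong law of large numbers for weakly correlated square integrable sequences. -/
lemma ae_tendsto_average_of_integral_sq {y : ℕ → Ω → ℝ} (hy : ∀ n, MemLp (y n) 2 P) {K : ℝ}
    (hK : ∀ u v, u ≤ v → ∫ ω, (∑ n ∈ Finset.Ico u v, y n ω) ^ 2 ∂P ≤ K * ((v : ℝ) - u)) :
    ∀ᵐ ω ∂P, Tendsto (fun N : ℕ => (N : ℝ)⁻¹ * ∑ n ∈ Finset.range N, y n ω) atTop (𝓝 0) := by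
  have hK0 : 0 ≤ K := by
    have := hK 0 1 (by norm_num)
    have h0 : 0 ≤ ∫ ω, (∑ n ∈ Finset.Ico 0 1, y n ω) ^ 2 ∂P :=
      integral_nonneg fun ω => sq_nonneg _
    simp only [Nat.cast_one, Nat.cast_zero, sub_zero, mul_one] at this
    linarith
  have hone : ∀ n, ∫ ω, y n ω ^ 2 ∂P ≤ K := fun n => by
    simpa using hK n (n + 1) (by omega)
  -- One bound serves both estimates below; the 9 comes from (2m + 1)² ≤ (3m)² for m ≥ 1.
  have hsummable : Summable fun m : ℕ => 9 * K * (1 / ((m : ℝ)) ^ 2) :=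
    (Real.summable_one_div_nat_pow.2 (by norm_num)).mul_left _
  have h1 : ∀ᵐ ω ∂P, Tendsto (fun m : ℕ => ((m : ℝ) ^ 2)⁻¹ * ∑ n ∈ Finset.range (m ^ 2), y n ω)
      atTop (𝓝 0) := by
    refine ae_tendsto_zero_of_integral_sq
      (fun m => (memLp_finsetSum _ fun n _ => hy n).const_mul _) hsummable fun m => ?_
    simp only [mul_pow, integral_const_mul]
    have h := hK 0 (m ^ 2) (Nat.zero_le _)
    rw [Nat.Ico_zero_eq_range] at h
    rcases Nat.eq_zero_or_pos m with rfl | hm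
    · simp
    have hm' : (0 : ℝ) < m := by exact_mod_cast hm
    calc ((((m : ℝ) ^ 2)⁻¹) ^ 2) * ∫ ω, (∑ n ∈ Finset.range (m ^ 2), y n ω) ^ 2 ∂P
        ≤ ((((m : ℝ) ^ 2)⁻¹) ^ 2) * (K * (m : ℝ) ^ 2) := by
          gcongr; simpa using h
      _ = K * (1 / (m : ℝ) ^ 2) := by field_simp
      _ ≤ 9 * K * (1 / (m : ℝ) ^ 2) := by gcongr; linarith
  -- Between m² and (m + 1)² there are 2m + 1 terms. By Cauchy–Schwarz this quantity dominates the
  -- squared partial sum from m² to any N in the gap, divided by m⁴.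
  have h2 : ∀ᵐ ω ∂P, Tendsto (fun m : ℕ => ((m : ℝ) ^ 4)⁻¹ * ((2 * m + 1) *
      ∑ n ∈ Finset.Ico (m ^ 2) ((m + 1) ^ 2), y n ω ^ 2)) atTop (𝓝 0) := by
    refine ae_tendsto_zero_of_integral
      (fun m => ((integrable_finsetSum _ fun n _ => (hy n).integrable_sq).const_mul _).const_mul _)
      (fun m ω => by positivity) hsummable fun m => ?_
    rw [integral_const_mul, integral_const_mul,
      integral_finsetSum _ fun n _ => (hy n).integrable_sq]
    rcases Nat.eq_zero_or_pos m with rfl | hm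
    · simp
    have hm' : (1 : ℝ) ≤ m := by exact_mod_cast hm
    have hb : ∑ n ∈ Finset.Ico (m ^ 2) ((m + 1) ^ 2), ∫ ω, y n ω ^ 2 ∂P ≤ (2 * m + 1) * K := by
      refine (Finset.sum_le_card_nsmul _ _ K fun n _ => hone n).trans_eq ?_
      rw [Nat.card_Ico, nsmul_eq_mul, show (m + 1) ^ 2 - m ^ 2 = 2 * m + 1 by
        rw [add_sq]; omega]
      push_cast; ring
    calc ((m : ℝ) ^ 4)⁻¹ * ((2 * m + 1) *
          ∑ n ∈ Finset.Ico (m ^ 2) ((m + 1) ^ 2), ∫ ω, y n ω ^ 2 ∂P)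
        ≤ ((m : ℝ) ^ 4)⁻¹ * ((2 * m + 1) * ((2 * m + 1) * K)) := by gcongr
      _ ≤ ((m : ℝ) ^ 4)⁻¹ * ((3 * m) * ((3 * m) * K)) := by gcongr <;> linarith
      _ = 9 * K * (1 / (m : ℝ) ^ 2) := by field_simp; ring
  filter_upwards [h1, h2] with ω hω1 hω2
  have hsqrt : Tendsto Nat.sqrt atTop atTop :=
    tendsto_atTop_atTop.2 fun b => ⟨b * b, fun N hN => Nat.le_sqrt.2 hN⟩
  have h3 := (hω1.abs.comp hsqrt).add (hω2.sqrt.comp hsqrt)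
  simp only [abs_zero, Real.sqrt_zero, add_zero] at h3
  refine squeeze_zero_norm' ?_ h3
  filter_upwards [eventually_ge_atTop 1] with N hN
  set m := Nat.sqrt N with hm
  have hmpos : 0 < m := Nat.sqrt_pos.2 hN
  have hmN : m ^ 2 ≤ N := Nat.sqrt_le' N
  have hNm : N < (m + 1) ^ 2 := Nat.lt_succ_sqrt' N
  have hm' : (0 : ℝ) < m := by exact_mod_cast hmpos
  have hmN' : (m : ℝ) ^ 2 ≤ N := by exact_mod_cast hmN
  have hsplit : ∑ n ∈ Finset.range N, y n ω
      = ∑ n ∈ Finset.range (m ^ 2), y n ω + ∑ n ∈ Finset.Ico (m ^ 2) N, y n ω :=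
    (Finset.sum_range_add_sum_Ico _ hmN).symm
  have hgap : |∑ n ∈ Finset.Ico (m ^ 2) N, y n ω| ≤ √((2 * m + 1) *
      ∑ n ∈ Finset.Ico (m ^ 2) ((m + 1) ^ 2), y n ω ^ 2) := by
    refine Real.abs_le_sqrt (sq_sum_le_card_mul_sum_sq.trans ?_)
    have hsub : Finset.Ico (m ^ 2) N ⊆ Finset.Ico (m ^ 2) ((m + 1) ^ 2) :=
      Finset.Ico_subset_Ico_right hNm.le
    refine mul_le_mul ?_ (Finset.sum_le_sum_of_subset_of_nonneg hsub fun _ _ _ => sq_nonneg _)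
      (Finset.sum_nonneg fun _ _ => sq_nonneg _) (by positivity)
    have : N - m ^ 2 ≤ 2 * m + 1 := by rw [add_sq] at hNm; omega
    rw [Nat.card_Ico]
    exact_mod_cast this
  have hinv : (N : ℝ)⁻¹ ≤ ((m : ℝ) ^ 2)⁻¹ := by gcongr
  have hs4 : √(((m : ℝ) ^ 4)⁻¹) = ((m : ℝ) ^ 2)⁻¹ := by
    rw [Real.sqrt_inv, show (m : ℝ) ^ 4 = ((m : ℝ) ^ 2) ^ 2 by ring, Real.sqrt_sq (by positivity)]
  rw [hsplit, Real.norm_eq_abs, abs_mul, abs_of_nonneg (by positivity : (0 : ℝ) ≤ (N : ℝ)⁻¹)]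
  simp only [Function.comp_apply]
  rw [abs_mul, abs_of_nonneg (by positivity : (0 : ℝ) ≤ ((m : ℝ) ^ 2)⁻¹),
    Real.sqrt_mul (by positivity), hs4, ← mul_add]
  exact mul_le_mul hinv ((abs_add_le _ _).trans (add_le_add_right hgap _)) (abs_nonneg _)
    (by positivity)

end AlmostSure

/-! ### Independent identically distributed inputs -/

section Iid

variable {Ω E : Type*} [MeasurableSpace E]

/-- The σ-algebra generated by `θ j`, `1 ≤ j < k`. -/
abbrev past (θ : ℕ → Ω → E) (k : ℕ) : MeasurableSpace Ω :=
  ⨆ j ∈ {j : ℕ | j + 1 < k}, MeasurableSpace.comap (θ (j + 1)) inferInstance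

lemma past_mono (θ : ℕ → Ω → E) {k l : ℕ} (h : k ≤ l) : past θ k ≤ past θ l :=
  biSup_mono fun _ hj => lt_of_lt_of_le hj h

lemma measurable_past (θ : ℕ → Ω → E) {j k : ℕ} (hj : 1 ≤ j) (hjk : j < k) :
    Measurable[past θ k] (θ j) := by
  obtain ⟨i, rfl⟩ := Nat.exists_eq_add_of_le' hj
  exact (comap_measurable (θ (i + 1))).mono
    (le_biSup (fun i => MeasurableSpace.comap (θ (i + 1)) inferInstance) (by exact hjk)) le_rfl

variable [MeasurableSpace Ω]

/-- The random variables `θ k`, `k ≥ 1`, are independent and have the law `ν`. -/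
structure IsIid (P : Measure Ω) (θ : ℕ → Ω → E) (ν : Measure E) : Prop where
  measurable : ∀ k, 1 ≤ k → Measurable (θ k)
  indep : iIndepFun (fun n => θ (n + 1)) P
  map_eq : ∀ k, 1 ≤ k → P.map (θ k) = ν

variable {P : Measure Ω} {θ : ℕ → Ω → E} {ν : Measure E}

namespace IsIid

lemma past_le (h : IsIid P θ ν) (k : ℕ) : past θ k ≤ ‹MeasurableSpace Ω› :=
  iSup₂_le fun j _ => (h.measurable (j + 1) (by omega)).comap_le

lemma indep_past (h : IsIid P θ ν) {k : ℕ} (hk : 1 ≤ k) :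
    Indep (past θ k) (MeasurableSpace.comap (θ k) inferInstance) P := by
  obtain ⟨i, rfl⟩ := Nat.exists_eq_add_of_le' hk
  have := indep_iSup_of_disjoint (fun n => (h.measurable (n + 1) (by omega)).comap_le) h.indep
    (S := {j : ℕ | j + 1 < i + 1}) (T := {i}) (by simp)
  simpa [past] using this

lemma indepFun {F : Type*} [MeasurableSpace F] (h : IsIid P θ ν) {k : ℕ} (hk : 1 ≤ k)
    {V : Ω → F} (hV : Measurable[past θ k] V) : IndepFun V (θ k) P :=
  indep_of_indep_of_le_left (h.indep_past hk) hV.comap_le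

lemma memLp_comp (h : IsIid P θ ν) {k : ℕ} (hk : 1 ≤ k) {ψ : E → ℝ} {p : ℝ≥0∞}
    (hψ : MemLp ψ p ν) : MemLp (fun ω => ψ (θ k ω)) p P := by
  rw [← h.map_eq k hk] at hψ
  exact hψ.comp_of_map (h.measurable k hk).aemeasurable

lemma integral_comp (h : IsIid P θ ν) {k : ℕ} (hk : 1 ≤ k) {ψ : E → ℝ} (hψ : Measurable ψ) :
    ∫ ω, ψ (θ k ω) ∂P = ∫ x, ψ x ∂ν := by
  rw [← h.map_eq k hk, integral_map (h.measurable k hk).aemeasurable hψ.aestronglyMeasurable]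

lemma integral_mul (h : IsIid P θ ν) {k : ℕ} (hk : 1 ≤ k) {U : Ω → ℝ}
    (hU : Measurable[past θ k] U) {ψ : E → ℝ} (hψ : Measurable ψ) :
    ∫ ω, U ω * ψ (θ k ω) ∂P = (∫ ω, U ω ∂P) * ∫ x, ψ x ∂ν := by
  rw [← h.integral_comp hk hψ]
  exact ((h.indepFun hk hU).comp measurable_id hψ).integral_fun_mul_eq_mul_integral
    (hU.mono (h.past_le k) le_rfl).aestronglyMeasurable
    (hψ.comp (h.measurable k hk)).aestronglyMeasurable

lemma memLp_mul (h : IsIid P θ ν) {k : ℕ} (hk : 1 ≤ k) {U : Ω → ℝ}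
    (hU : Measurable[past θ k] U) (hU2 : MemLp U 2 P) {ψ : E → ℝ} (hψ : Measurable ψ)
    (hψ2 : MemLp ψ 2 ν) : MemLp (fun ω => U ω * ψ (θ k ω)) 2 P := by
  have hm : AEStronglyMeasurable (fun ω => U ω * ψ (θ k ω)) P :=
    ((hU.mono (h.past_le k) le_rfl).mul (hψ.comp (h.measurable k hk))).aestronglyMeasurable
  rw [memLp_two_iff_integrable_sq hm]
  simp only [mul_pow]
  exact ((h.indepFun hk hU).comp (φ := fun x : ℝ => x ^ 2) (ψ := fun x => ψ x ^ 2)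
    (by fun_prop) (by fun_prop)).integrable_mul hU2.integrable_sq
    (h.memLp_comp hk hψ2).integrable_sq

/-- The freezing lemma: by independence the joint law of the past and the fresh input is a product,
so Fubini integrates out the input with the past held fixed. -/
lemma integral_prod [IsProbabilityMeasure P] {F : Type*} [MeasurableSpace F] (h : IsIid P θ ν)
    {k : ℕ} (hk : 1 ≤ k) {V : Ω → F} (hV : Measurable[past θ k] V) {f : F × E → ℝ}
    (hf : Measurable f) (hint : Integrable (fun ω => f (V ω, θ k ω)) P) :
    ∫ ω, f (V ω, θ k ω) ∂P = ∫ ω, ∫ x, f (V ω, x) ∂ν ∂P := by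
  have hV' : Measurable V := hV.mono (h.past_le k) le_rfl
  have hθ := h.measurable k hk
  have hmap := (indepFun_iff_map_prod_eq_prod_map_map hV'.aemeasurable hθ.aemeasurable).1
    (h.indepFun hk hV)
  rw [h.map_eq k hk] at hmap
  have : IsProbabilityMeasure ν := by
    rw [← h.map_eq k hk]; exact Measure.isProbabilityMeasure_map hθ.aemeasurable
  have : IsProbabilityMeasure (P.map V) := Measure.isProbabilityMeasure_map hV'.aemeasurable
  have h1 : ∫ ω, f (V ω, θ k ω) ∂P = ∫ z, f z ∂((P.map V).prod ν) := by
    rw [← hmap, integral_map (hV'.prodMk hθ).aemeasurable hf.aestronglyMeasurable]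
  have hint' : Integrable f ((P.map V).prod ν) := by
    rw [← hmap, integrable_map_measure hf.aestronglyMeasurable (hV'.prodMk hθ).aemeasurable]
    exact hint
  rw [h1, MeasureTheory.integral_prod _ hint', integral_map hV'.aemeasurable]
  exact (hf.stronglyMeasurable.integral_prod_right (f := fun z x => f (z, x))).aestronglyMeasurable

/-- Orthogonality of martingale increments: for j < k, `Z j` is one of the past variables to which
`Z k` is orthogonal, so only the squares survive. -/
lemma integral_sq_sum {Z : ℕ → Ω → ℝ} {s : Finset ℕ}
    (hZ : ∀ k ∈ s, MemLp (Z k) 2 P) (hm : ∀ k ∈ s, Measurable[past θ (k + 1)] (Z k))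
    (h0 : ∀ k ∈ s, ∀ U, Measurable[past θ k] U → MemLp U 2 P → ∫ ω, U ω * Z k ω ∂P = 0) :
    ∫ ω, (∑ k ∈ s, Z k ω) ^ 2 ∂P = ∑ k ∈ s, ∫ ω, Z k ω ^ 2 ∂P := by
  have hlt : ∀ j ∈ s, ∀ k ∈ s, j < k → ∫ ω, Z j ω * Z k ω ∂P = 0 := fun j hj k hk hjk =>
    h0 k hk _ ((hm j hj).mono (past_mono θ hjk) le_rfl) (hZ j hj)
  have horth : ∀ j ∈ s, ∀ k ∈ s, j ≠ k → ∫ ω, Z j ω * Z k ω ∂P = 0 := fun j hj k hk hjk => by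
    rcases lt_or_gt_of_ne hjk with hlt' | hgt
    · exact hlt j hj k hk hlt'
    · simpa only [mul_comm] using hlt k hk j hj hgt
  simp only [sq, Finset.sum_mul_sum]
  have hint : ∀ j ∈ s, ∀ k ∈ s, Integrable (fun ω => Z j ω * Z k ω) P := fun j hj k hk =>
    (hZ j hj).integrable_mul (hZ k hk)
  rw [integral_finsetSum _ fun j hj => integrable_finsetSum _ fun k hk => hint j hj k hk]
  refine Finset.sum_congr rfl fun j hj => ?_
  rw [integral_finsetSum _ fun k hk => hint j hj k hk]
  exact Finset.sum_eq_single_of_mem j hj fun k hk hkj => horth j hj k hk hkj.symm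

/-- Besides the orthogonality of the increments, u_k is independent of θ_k, so each second moment
factors. -/
lemma integral_sq_sum_mul (h : IsIid P θ ν) {u : ℕ → Ω → ℝ}
    {s : Finset ℕ} (hs : ∀ k ∈ s, 1 ≤ k) (hu : ∀ k ∈ s, MemLp (u k) 2 P)
    (hm : ∀ k ∈ s, Measurable[past θ k] (u k)) {ψ : E → ℝ} (hψ : Measurable ψ)
    (hψ2 : MemLp ψ 2 ν) (hψ0 : ∫ x, ψ x ∂ν = 0) :
    ∫ ω, (∑ k ∈ s, u k ω * ψ (θ k ω)) ^ 2 ∂P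
      = (∫ x, ψ x ^ 2 ∂ν) * ∑ k ∈ s, ∫ ω, u k ω ^ 2 ∂P := by
  rw [integral_sq_sum (fun k hk => h.memLp_mul (hs k hk) (hm k hk) (hu k hk) hψ hψ2)
    (fun k hk => ((hm k hk).mono (past_mono θ k.le_succ) le_rfl).mul
      (hψ.comp (measurable_past θ (hs k hk) k.lt_succ_self)))
    fun k hk U hU hU2 => ?_, Finset.mul_sum]
  · refine Finset.sum_congr rfl fun k hk => ?_
    simp only [mul_pow]
    rw [h.integral_mul (hs k hk) ((hm k hk).pow_const 2) (hψ.pow_const 2), mul_comm]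
  · simp only [← mul_assoc]
    exact (h.integral_mul (hs k hk) (hU.mul (hm k hk)) hψ).trans (by rw [hψ0, mul_zero])

end IsIid

lemma IsIid.memLp_sum_mul (h : IsIid P θ ν) {u : ℕ → Ω → ℝ}
    {s : Finset ℕ} (hs : ∀ k ∈ s, 1 ≤ k) (hu : ∀ k ∈ s, MemLp (u k) 2 P)
    (hm : ∀ k ∈ s, Measurable[past θ k] (u k)) {ψ : E → ℝ} (hψ : Measurable ψ)
    (hψ2 : MemLp ψ 2 ν) : MemLp (fun ω => ∑ k ∈ s, u k ω * ψ (θ k ω)) 2 P :=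
  memLp_finsetSum _ fun k hk => h.memLp_mul (hs k hk) (hm k hk) (hu k hk) hψ hψ2

/-- Averages over the tree of martingale differences with bounded coefficients vanish. -/
lemma IsIid.ae_tendsto_average_mul [IsProbabilityMeasure P] (h : IsIid P θ ν) {u : ℕ → Ω → ℝ}
    (hm : ∀ k, 1 ≤ k → Measurable[past θ k] (u k)) {K : ℝ} (hK : ∀ k ω, |u k ω| ≤ K)
    {ψ : E → ℝ} (hψ : Measurable ψ) (hψ2 : MemLp ψ 2 ν) (hψ0 : ∫ x, ψ x ∂ν = 0) :
    ∀ᵐ ω ∂P, Tendsto (fun n : ℕ => ((2 : ℝ) ^ n)⁻¹ *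
      ∑ k ∈ Finset.Ico 1 (2 ^ n), u k ω * ψ (θ k ω)) atTop (𝓝 0) := by
  have hs : ∀ n : ℕ, ∀ k ∈ Finset.Ico 1 (2 ^ n), 1 ≤ k := fun n k hk => (Finset.mem_Ico.1 hk).1
  have hu : ∀ k, 1 ≤ k → MemLp (u k) 2 P := fun k hk =>
    MemLp.of_bound ((hm k hk).mono (h.past_le k) le_rfl).aestronglyMeasurable K
      (Eventually.of_forall (hK k))
  set V := ∫ x, ψ x ^ 2 ∂ν with hVdef
  have hV : 0 ≤ V := integral_nonneg fun x => sq_nonneg _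
  have hL2 : ∀ n : ℕ, MemLp (fun ω => ((2 : ℝ) ^ n)⁻¹ *
      ∑ k ∈ Finset.Ico 1 (2 ^ n), u k ω * ψ (θ k ω)) 2 P := fun n =>
    (h.memLp_sum_mul (hs n) (fun k hk => hu k (hs n k hk))
      (fun k hk => hm k (hs n k hk)) hψ hψ2).const_mul _
  -- Fewer than 2^n orthogonal terms, each of second moment at most V K², divided by 4^n: a
  -- geometric bound.
  refine ae_tendsto_zero_of_integral_sq hL2
    ((summable_geometric_of_lt_one (r := 1 / 2) (by norm_num) (by norm_num)).mul_left (V * K ^ 2))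
    fun n => ?_
  simp only [mul_pow, integral_const_mul]
  rw [h.integral_sq_sum_mul (hs n) (fun k hk => hu k (hs n k hk))
      (fun k hk => hm k (hs n k hk)) hψ hψ2 hψ0, ← hVdef]
  have hone : ∀ k ∈ Finset.Ico 1 (2 ^ n), ∫ ω, u k ω ^ 2 ∂P ≤ K ^ 2 := fun k hk =>
    (integral_mono (hu k (hs n k hk)).integrable_sq (integrable_const (K ^ 2))
        fun ω => sq_le_sq' (abs_le.1 (hK k ω)).1 (abs_le.1 (hK k ω)).2).trans_eq (by simp)
  have hcard : ((Finset.Ico 1 (2 ^ n)).card : ℝ) ≤ 2 ^ n := by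
    rw [Nat.card_Ico]
    exact_mod_cast Nat.sub_le _ _
  have hb : ∑ k ∈ Finset.Ico 1 (2 ^ n), ∫ ω, u k ω ^ 2 ∂P ≤ 2 ^ n * K ^ 2 := by
    refine (Finset.sum_le_card_nsmul _ _ (K ^ 2) hone).trans ?_
    rw [nsmul_eq_mul]
    exact mul_le_mul_of_nonneg_right hcard (sq_nonneg K)
  calc (((2 : ℝ) ^ n)⁻¹) ^ 2 * (V * ∑ k ∈ Finset.Ico 1 (2 ^ n), ∫ ω, u k ω ^ 2 ∂P)
      ≤ (((2 : ℝ) ^ n)⁻¹) ^ 2 * (V * (2 ^ n * K ^ 2)) := by gcongr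
    _ = (V * K ^ 2) * (1 / 2) ^ n := by
      rw [_root_.one_div_pow]
      field_simp

/-- A geometric series starting at the first power of two beyond k. The subtracted 2 / 2^v lets the
induction close; the maximum with 0 covers the v for which no term has yet appeared. -/
lemma sum_indicator_inv_two_pow_le {k : ℕ} (hk : 1 ≤ k) (v : ℕ) :
    ∑ n ∈ Finset.range v, (if k < 2 ^ n then ((2 : ℝ) ^ n)⁻¹ else 0)
      ≤ max 0 (2 / (k : ℝ) - 2 / 2 ^ v) := by
  have hk' : (0 : ℝ) < k := by exact_mod_cast hk
  induction v with
  | zero => simp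
  | succ v ih =>
    rw [Finset.sum_range_succ]
    split_ifs with hlt
    · have hlt' : (k : ℝ) < 2 ^ v := by exact_mod_cast hlt
      have h1 : 2 / (2 : ℝ) ^ v ≤ 2 / k := by gcongr
      rw [max_eq_right (by linarith)] at ih
      refine le_max_of_le_right ?_
      have h2 : 2 / (2 : ℝ) ^ (v + 1) = ((2 : ℝ) ^ v)⁻¹ := by rw [pow_succ]; field_simp
      have h3 : 2 / (2 : ℝ) ^ v = 2 * ((2 : ℝ) ^ v)⁻¹ := by rw [div_eq_mul_inv]
      linarith
    · rw [add_zero]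
      refine ih.trans (max_le_max_left _ ?_)
      gcongr
      · norm_num
      · omega

/-- Cesàro means of the normalised martingales `2⁻ⁿ ∑_{k < 2ⁿ} u_k ψ(θ_k)` vanish when the
second moment of `u_k` grows linearly. -/
lemma IsIid.ae_tendsto_cesaro_mul [IsProbabilityMeasure P] (h : IsIid P θ ν) {u : ℕ → Ω → ℝ}
    (hm : ∀ k, 1 ≤ k → Measurable[past θ k] (u k)) (hu : ∀ k, 1 ≤ k → MemLp (u k) 2 P) {K : ℝ}
    (hK : ∀ k, 1 ≤ k → ∫ ω, u k ω ^ 2 ∂P ≤ K * k)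
    {ψ : E → ℝ} (hψ : Measurable ψ) (hψ2 : MemLp ψ 2 ν) (hψ0 : ∫ x, ψ x ∂ν = 0) :
    ∀ᵐ ω ∂P, Tendsto (fun N : ℕ => (N : ℝ)⁻¹ * ∑ n ∈ Finset.range N, ((2 : ℝ) ^ n)⁻¹ *
      ∑ k ∈ Finset.Ico 1 (2 ^ n), u k ω * ψ (θ k ω)) atTop (𝓝 0) := by
  set V := ∫ x, ψ x ^ 2 ∂ν with hVdef
  have hV : 0 ≤ V := integral_nonneg fun x => sq_nonneg _
  have hK0 : 0 ≤ K := by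
    have := hK 1 le_rfl
    have h0 : 0 ≤ ∫ ω, u 1 ω ^ 2 ∂P := integral_nonneg fun ω => sq_nonneg _
    simp only [Nat.cast_one, mul_one] at this
    linarith
  have hs : ∀ n : ℕ, ∀ k ∈ Finset.Ico 1 (2 ^ n), 1 ≤ k := fun n k hk => (Finset.mem_Ico.1 hk).1
  have hL2 : ∀ n : ℕ, MemLp (fun ω => ((2 : ℝ) ^ n)⁻¹ *
      ∑ k ∈ Finset.Ico 1 (2 ^ n), u k ω * ψ (θ k ω)) 2 P := fun n =>
    (h.memLp_sum_mul (hs n) (fun k hk => hu k (hs n k hk))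
      (fun k hk => hm k (hs n k hk)) hψ hψ2).const_mul _
  refine ae_tendsto_average_of_integral_sq (K := V * (2 * K)) hL2 fun a b hab => ?_
  -- After exchanging the sums, individual k enters with weight w k ≤ 2 / k. One factor w k thus
  -- absorbs the linear growth of the second moment of u_k, and the other remains to be summed.
  set w : ℕ → ℝ := fun k => ∑ n ∈ Finset.Ico a b, if k < 2 ^ n then ((2 : ℝ) ^ n)⁻¹ else 0
    with hw
  have hw0 : ∀ k, 0 ≤ w k := fun k =>
    Finset.sum_nonneg fun n _ => by split_ifs <;> positivity
  have hwk : ∀ k, 1 ≤ k → w k * k ≤ 2 := fun k hk => by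
    have hk' : (0 : ℝ) < k := by exact_mod_cast hk
    have h1 : w k ≤ 2 / k := by
      refine ((Finset.sum_le_sum_of_subset_of_nonneg (fun n hn => Finset.mem_range.2
        (Finset.mem_Ico.1 hn).2) fun n _ _ => by split_ifs <;> positivity).trans
        (sum_indicator_inv_two_pow_le hk b)).trans (max_le (by positivity) ?_)
      have : 0 ≤ 2 / (2 : ℝ) ^ b := by positivity
      linarith
    exact (le_div_iff₀ hk').1 h1
  have hite : ∀ n ∈ Finset.Ico a b, ∀ f : ℕ → ℝ, ((2 : ℝ) ^ n)⁻¹ * ∑ k ∈ Finset.Ico 1 (2 ^ n), f k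
      = ∑ k ∈ Finset.Ico 1 (2 ^ b), (if k < 2 ^ n then ((2 : ℝ) ^ n)⁻¹ else 0) * f k := by
    intro n hn f
    have hle : 2 ^ n ≤ 2 ^ b := Nat.pow_le_pow_right (by norm_num) (Finset.mem_Ico.1 hn).2.le
    have hfilter : Finset.Ico 1 (2 ^ n) = (Finset.Ico 1 (2 ^ b)).filter (· < 2 ^ n) := by
      ext k
      simp only [Finset.mem_Ico, Finset.mem_filter]
      exact ⟨fun hk => ⟨⟨hk.1, hk.2.trans_le hle⟩, hk.2⟩, fun hk => ⟨hk.1.1, hk.2⟩⟩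
    rw [hfilter, Finset.sum_filter, Finset.mul_sum]
    exact Finset.sum_congr rfl fun k _ => by split_ifs <;> simp
  have hsum : ∀ ω, ∑ n ∈ Finset.Ico a b, ((2 : ℝ) ^ n)⁻¹ *
      ∑ k ∈ Finset.Ico 1 (2 ^ n), u k ω * ψ (θ k ω)
      = ∑ k ∈ Finset.Ico 1 (2 ^ b), (w k * u k ω) * ψ (θ k ω) := fun ω => by
    rw [Finset.sum_congr rfl fun n hn => hite n hn fun k => u k ω * ψ (θ k ω), Finset.sum_comm]
    refine Finset.sum_congr rfl fun k _ => ?_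
    rw [← Finset.sum_mul, mul_assoc]
  simp only [hsum]
  rw [h.integral_sq_sum_mul (u := fun k ω => w k * u k ω) (hs b)
    (fun k hk => (hu k (hs b k hk)).const_mul _)
    (fun k hk => (hm k (hs b k hk)).const_mul _) hψ hψ2 hψ0, ← hVdef, mul_assoc]
  refine mul_le_mul_of_nonneg_left ?_ hV
  have hterm : ∀ k ∈ Finset.Ico 1 (2 ^ b), ∫ ω, (w k * u k ω) ^ 2 ∂P ≤ (2 * K) * w k := by
    intro k hk
    simp only [mul_pow, integral_const_mul]
    have h1 := hK k (hs b k hk)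
    have h2 := hwk k (hs b k hk)
    calc w k ^ 2 * ∫ ω, u k ω ^ 2 ∂P ≤ w k ^ 2 * (K * k) := by gcongr
      _ = w k * K * (w k * k) := by ring
      _ ≤ w k * K * 2 := mul_le_mul_of_nonneg_left h2 (mul_nonneg (hw0 k) hK0)
      _ = (2 * K) * w k := by ring
  refine (Finset.sum_le_sum hterm).trans ?_
  rw [← Finset.mul_sum]
  refine mul_le_mul_of_nonneg_left ?_ (by linarith)
  -- Undoing the exchange: each n in [a, b) contributes at most 1, so the total weight is at most b
  -- - a.
  have hcount : ∑ k ∈ Finset.Ico 1 (2 ^ b), w k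
      = ∑ n ∈ Finset.Ico a b, ((2 : ℝ) ^ n)⁻¹ * ∑ k ∈ Finset.Ico 1 (2 ^ n), (1 : ℝ) := by
    rw [Finset.sum_congr rfl fun n hn => hite n hn fun _ => 1, Finset.sum_comm]
    simp only [mul_one]
  rw [hcount]
  refine (Finset.sum_le_card_nsmul _ _ 1 fun n _ => ?_).trans_eq ?_
  · have hcard : ((Finset.Ico 1 (2 ^ n)).card : ℝ) ≤ 2 ^ n := by
      rw [Nat.card_Ico]
      exact_mod_cast Nat.sub_le _ _
    rw [Finset.sum_const, nsmul_eq_mul, mul_one, inv_mul_le_one₀ (by positivity)]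
    exact hcard
  · rw [Nat.card_Ico, nsmul_eq_mul, mul_one, Nat.cast_sub hab]

end Iid

/-! ### Affine recursions on the tree -/

/-- The inputs `((a_k, b_k), (ε_{2k}, ε_{2k+1}))` attached to an individual. -/
abbrev Input := (ℝ × ℝ) × (ℝ × ℝ)

/-- The coefficient of the transition to the child `2k + s`. -/
def coefOf (s : ℕ) (z : Input) : ℝ := if s = 0 then z.1.1 else z.1.2

/-- The noise of the transition to the child `2k + s`. -/
def noiseOf (s : ℕ) (z : Input) : ℝ := if s = 0 then z.2.1 else z.2.2

lemma measurable_coefOf (s : ℕ) : Measurable (coefOf s) := by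
  unfold coefOf; split_ifs <;> fun_prop

lemma measurable_noiseOf (s : ℕ) : Measurable (noiseOf s) := by
  unfold noiseOf; split_ifs <;> fun_prop

/-- The product of the coefficients on the path from the root to `k`. -/
def slope (z : ℕ → Input) (k : ℕ) : ℝ :=
  if k ≤ 1 then 1 else coefOf (k % 2) (z (k / 2)) * slope z (k / 2)
termination_by k
decreasing_by omega

/-- The process started at `0`. -/
def base (z : ℕ → Input) (k : ℕ) : ℝ :=
  if k ≤ 1 then 0 else coefOf (k % 2) (z (k / 2)) * base z (k / 2) + noiseOf (k % 2) (z (k / 2))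
termination_by k
decreasing_by omega

lemma slope_one (z : ℕ → Input) : slope z 1 = 1 := by rw [slope]; simp

lemma base_one (z : ℕ → Input) : base z 1 = 0 := by rw [base]; simp

lemma slope_child (z : ℕ → Input) {k s : ℕ} (hk : 1 ≤ k) (hs : s < 2) :
    slope z (2 * k + s) = coefOf s (z k) * slope z k := by
  rw [slope, if_neg (by omega), show (2 * k + s) % 2 = s by omega,
    show (2 * k + s) / 2 = k by omega]

lemma base_child (z : ℕ → Input) {k s : ℕ} (hk : 1 ≤ k) (hs : s < 2) :
    base z (2 * k + s) = coefOf s (z k) * base z k + noiseOf s (z k) := by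
  rw [base, if_neg (by omega), show (2 * k + s) % 2 = s by omega,
    show (2 * k + s) / 2 = k by omega]

/-- The recursion is affine in the root value. This isolates X_1, whose dependence on the inputs is
unknown, from quantities built out of the inputs alone. -/
lemma eq_base_add_slope_mul (z : ℕ → Input) {x : ℕ → ℝ}
    (hx : ∀ k s, 1 ≤ k → s < 2 → x (2 * k + s) = coefOf s (z k) * x k + noiseOf s (z k)) :
    ∀ k, 1 ≤ k → x k = base z k + slope z k * x 1 := by
  intro k
  induction k using Nat.strong_induction_on with
  | _ k ih =>
    intro hk
    rcases hk.eq_or_lt with rfl | hk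
    · rw [base_one, slope_one]; ring
    · have hdiv : k = 2 * (k / 2) + k % 2 := by omega
      rw [hdiv, hx _ _ (by omega) (by omega), base_child z (by omega) (by omega),
        slope_child z (by omega) (by omega), ih (k / 2) (by omega) (by omega)]
      ring

/-- Moment assumptions on the law of the inputs. -/
structure InputLaw (ν : Measure Input) (ρ : ℝ) : Prop where
  prob : IsProbabilityMeasure ν
  memLp_coef : ∀ s, MemLp (coefOf s) 4 ν
  memLp_noise : ∀ s, MemLp (noiseOf s) 4 ν
  -- Any larger ρ < 1 still bounds the second moments. This lower bound gives √(1/2) ≤ √ρ, so that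
  -- contraction is the slower of the two rates, and 2ρ - 1 ≥ 1/2, which controls a geometric sum of
  -- ratio 2ρ.
  le_rho : 3 / 4 ≤ ρ
  rho_lt : ρ < 1
  sq_le : ∀ s, ∫ z, coefOf s z ^ 2 ∂ν ≤ ρ

/-- The variance of |u| is nonnegative. -/
lemma integral_abs_le_of_integral_sq_le {Ω : Type*} [MeasurableSpace Ω] {P : Measure Ω}
    [IsProbabilityMeasure P] {u : Ω → ℝ} (hu : MemLp u 2 P) {δ : ℝ} (hδ : 0 ≤ δ)
    (h : ∫ ω, u ω ^ 2 ∂P ≤ δ ^ 2) : ∫ ω, |u ω| ∂P ≤ δ := by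
  have h1 := variance_nonneg (fun ω => |u ω|) P
  rw [variance_eq_sub (X := fun ω => |u ω|) hu.abs] at h1
  have h2 : ∫ ω, ((fun ω => |u ω|) ^ 2) ω ∂P = ∫ ω, u ω ^ 2 ∂P := by
    simp [sq_abs]
  rw [h2] at h1
  exact abs_le_of_sq_le_sq' (by linarith) hδ |>.2

namespace InputLaw

variable {ν : Measure Input} {ρ : ℝ}

lemma memLp_two_coef (h : InputLaw ν ρ) (s : ℕ) : MemLp (coefOf s) 2 ν :=
  have := h.prob
  (h.memLp_coef s).mono_exponent (by norm_num)

lemma memLp_two_noise (h : InputLaw ν ρ) (s : ℕ) : MemLp (noiseOf s) 2 ν :=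
  have := h.prob
  (h.memLp_noise s).mono_exponent (by norm_num)

lemma integrable_coef (h : InputLaw ν ρ) (s : ℕ) : Integrable (coefOf s) ν :=
  have := h.prob
  (h.memLp_two_coef s).integrable (by norm_num)

lemma integrable_noise (h : InputLaw ν ρ) (s : ℕ) : Integrable (noiseOf s) ν :=
  have := h.prob
  (h.memLp_two_noise s).integrable (by norm_num)

lemma rho_pos (h : InputLaw ν ρ) : 0 < ρ := by linarith [h.le_rho]

lemma sqrt_lt_one (h : InputLaw ν ρ) : √ρ < 1 := by
  rw [Real.sqrt_lt' one_pos]; simpa using h.rho_lt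

lemma integral_abs_coef_le (h : InputLaw ν ρ) (s : ℕ) : ∫ z, |coefOf s z| ∂ν ≤ √ρ :=
  have := h.prob
  integral_abs_le_of_integral_sq_le (h.memLp_two_coef s) (Real.sqrt_nonneg _)
    (by rw [Real.sq_sqrt h.rho_pos.le]; exact h.sq_le s)

end InputLaw

/-! ### Moments of the recursion -/

section Moments

lemma tree_induction {p : ℕ → Prop} (h1 : p 1)
    (h2 : ∀ k s, 1 ≤ k → s < 2 → p k → p (2 * k + s)) : ∀ k, 1 ≤ k → p k := by
  intro k
  induction k using Nat.strong_induction_on with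
  | _ k ih =>
    intro hk
    rcases hk.eq_or_lt with rfl | hk
    · exact h1
    · rw [show k = 2 * (k / 2) + k % 2 by omega]
      exact h2 _ _ (by omega) (by omega) (ih _ (by omega) (by omega))

/-- The path to k uses only the inputs of proper ancestors, whose labels are smaller than k.
Filtering by label instead of by generation is thus legitimate and reveals one input at a time. -/
lemma measurable_slope {Ω : Type*} (θ : ℕ → Ω → Input) : ∀ k, 1 ≤ k →
    Measurable[past θ k] fun ω => slope (fun j => θ j ω) k := by
  refine tree_induction ?_ fun k s hk hs ih => ?_
  · simp only [slope_one]; exact measurable_const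
  · simp only [slope_child _ hk hs]
    exact ((measurable_coefOf s).comp (measurable_past θ hk (by omega))).mul
      (ih.mono (past_mono θ (by omega)) le_rfl)

lemma measurable_base {Ω : Type*} (θ : ℕ → Ω → Input) : ∀ k, 1 ≤ k →
    Measurable[past θ k] fun ω => base (fun j => θ j ω) k := by
  refine tree_induction ?_ fun k s hk hs ih => ?_
  · simp only [base_one]; exact measurable_const
  · simp only [base_child _ hk hs]
    exact (((measurable_coefOf s).comp (measurable_past θ hk (by omega))).mul
      (ih.mono (past_mono θ (by omega)) le_rfl)).add
      ((measurable_noiseOf s).comp (measurable_past θ hk (by omega)))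

variable {Ω : Type*} [MeasurableSpace Ω] {P : Measure Ω} {θ : ℕ → Ω → Input} {ν : Measure Input}
  {ρ : ℝ}

lemma memLp_slope [IsProbabilityMeasure P] (h : IsIid P θ ν) (hν : InputLaw ν ρ) : ∀ k, 1 ≤ k →
    MemLp (fun ω => slope (fun j => θ j ω) k) 2 P := by
  refine tree_induction ?_ fun k s hk hs ih => ?_
  · simp only [slope_one]; exact memLp_const 1
  · simp only [slope_child _ hk hs, mul_comm (coefOf s _)]
    exact h.memLp_mul hk (measurable_slope θ k hk) ih (measurable_coefOf s) (hν.memLp_two_coef s)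

lemma memLp_base [IsProbabilityMeasure P] (h : IsIid P θ ν) (hν : InputLaw ν ρ) : ∀ k, 1 ≤ k →
    MemLp (fun ω => base (fun j => θ j ω) k) 2 P := by
  refine tree_induction ?_ fun k s hk hs ih => ?_
  · simp only [base_one]; exact memLp_const 0
  · simp only [base_child _ hk hs, mul_comm (coefOf s _)]
    exact (h.memLp_mul hk (measurable_base θ k hk) ih (measurable_coefOf s)
      (hν.memLp_two_coef s)).add (h.memLp_comp hk (hν.memLp_two_noise s))

/-- Each step down the path multiplies by a coefficient independent of the past, of second moment at
most ρ. -/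
lemma integral_sq_slope_le [IsProbabilityMeasure P] (h : IsIid P θ ν) (hν : InputLaw ν ρ) (n : ℕ) :
    ∀ k ∈ gen n, ∫ ω, slope (fun j => θ j ω) k ^ 2 ∂P ≤ ρ ^ n := by
  induction n with
  | zero =>
    intro k hk
    obtain rfl : k = 1 := by simp [gen] at hk; omega
    simp [slope_one]
  | succ n ih =>
    intro k hk
    have hk' : k / 2 ∈ gen n := by
      simp only [gen, Finset.mem_Ico, pow_succ] at hk ⊢; omega
    have h1 := one_le_of_mem_gen hk'
    rw [show k = 2 * (k / 2) + k % 2 by omega]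
    simp only [slope_child _ h1 (Nat.mod_lt k two_pos), mul_comm (coefOf _ _), mul_pow]
    rw [h.integral_mul (ψ := fun z => coefOf (k % 2) z ^ 2) h1
      ((measurable_slope θ _ h1).pow_const 2) ((measurable_coefOf _).pow_const 2), pow_succ]
    exact mul_le_mul (ih _ hk') (hν.sq_le _) (integral_nonneg fun _ => sq_nonneg _)
      (pow_nonneg hν.rho_pos.le _)

lemma exists_integral_abs_base_le [IsProbabilityMeasure P] (h : IsIid P θ ν)
    (hν : InputLaw ν ρ) : ∃ K : ℝ, 0 ≤ K ∧ ∀ k, 1 ≤ k →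
      ∫ ω, |base (fun j => θ j ω) k| ∂P ≤ K := by
  have := hν.prob
  set b := max (∫ z, |noiseOf 0 z| ∂ν) (∫ z, |noiseOf 1 z| ∂ν) with hb
  have hb0 : 0 ≤ b := le_max_of_le_left (integral_nonneg fun _ => abs_nonneg _)
  have hbs : ∀ s < 2, ∫ z, |noiseOf s z| ∂ν ≤ b := fun s hs => by
    interval_cases s
    · exact le_max_left _ _
    · exact le_max_right _ _
  have hr := hν.sqrt_lt_one
  have hr' : 0 < 1 - √ρ := by linarith
  -- The fixed point of r ↦ √ρ r + b, the recursion satisfied by the bounds on the first moments.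
  refine ⟨b / (1 - √ρ), by positivity, tree_induction ?_ fun k s hk hs ih => ?_⟩
  · simp only [base_one, abs_zero, integral_zero]; positivity
  have hc : Integrable (fun ω => |base (fun j => θ j ω) k| * |coefOf s (θ k ω)|) P := by
    have := (h.memLp_mul hk (measurable_base θ k hk) (memLp_base h hν k hk)
      (measurable_coefOf s) (hν.memLp_two_coef s)).integrable (by norm_num)
    simpa only [abs_mul] using this.abs
  have hn : Integrable (fun ω => |noiseOf s (θ k ω)|) P :=
    ((h.memLp_comp hk (hν.memLp_two_noise s)).integrable (by norm_num)).abs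
  have hle : ∀ ω, |base (fun j => θ j ω) (2 * k + s)|
      ≤ |base (fun j => θ j ω) k| * |coefOf s (θ k ω)| + |noiseOf s (θ k ω)| := fun ω => by
    rw [base_child _ hk hs, mul_comm, ← abs_mul]
    exact abs_add_le _ _
  refine (integral_mono ((memLp_base h hν _ (by omega)).integrable (by norm_num)).abs (hc.add hn)
    hle).trans ?_
  rw [integral_add' hc hn, h.integral_mul (U := fun ω => |base (fun j => θ j ω) k|)
    (ψ := fun z => |coefOf s z|) hk
    (continuous_abs.measurable.comp (measurable_base θ k hk)) (measurable_coefOf s).abs,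
    h.integral_comp (ψ := fun z => |noiseOf s z|) hk (measurable_noiseOf s).abs]
  calc (∫ ω, |base (fun j => θ j ω) k| ∂P) * (∫ z, |coefOf s z| ∂ν) + ∫ z, |noiseOf s z| ∂ν
      ≤ b / (1 - √ρ) * √ρ + b := by
        refine add_le_add (mul_le_mul ih (hν.integral_abs_coef_le s)
          (integral_nonneg fun _ => abs_nonneg _) (by positivity)) (hbs s hs)
    _ = b / (1 - √ρ) := by field_simp; ring

/-- The average of a function of the individuals over a generation. -/
def genAvg (n : ℕ) (f : ℕ → ℝ) : ℝ := ((2 : ℝ) ^ n)⁻¹ * ∑ k ∈ gen n, f k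

lemma genAvg_const (n : ℕ) (x : ℝ) : genAvg n (fun _ => x) = x := by
  simp [genAvg, card_gen]

lemma genAvg_sub (n : ℕ) (f g : ℕ → ℝ) :
    genAvg n (fun k => f k - g k) = genAvg n f - genAvg n g := by
  simp [genAvg, Finset.sum_sub_distrib, mul_sub]

lemma genAvg_mono {n : ℕ} {f g : ℕ → ℝ} (h : ∀ k ∈ gen n, f k ≤ g k) :
    genAvg n f ≤ genAvg n g :=
  mul_le_mul_of_nonneg_left (Finset.sum_le_sum h) (by positivity)

lemma abs_genAvg_le (n : ℕ) (f : ℕ → ℝ) : |genAvg n f| ≤ genAvg n fun k => |f k| := by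
  rw [genAvg, abs_mul, abs_of_nonneg (by positivity : (0 : ℝ) ≤ ((2 : ℝ) ^ n)⁻¹)]
  exact mul_le_mul_of_nonneg_left (Finset.abs_sum_le_sum_abs _ _) (by positivity)

lemma genAvg_sq_le (n : ℕ) (f : ℕ → ℝ) : genAvg n f ^ 2 ≤ genAvg n fun k => f k ^ 2 := by
  have h := sq_sum_le_card_mul_sum_sq (s := gen n) (f := f)
  rw [card_gen] at h
  push_cast at h
  have h2 : (0 : ℝ) < 2 ^ n := by positivity
  calc genAvg n f ^ 2 = (((2 : ℝ) ^ n)⁻¹) ^ 2 * (∑ k ∈ gen n, f k) ^ 2 := by rw [genAvg, mul_pow]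
    _ ≤ (((2 : ℝ) ^ n)⁻¹) ^ 2 * (2 ^ n * ∑ k ∈ gen n, f k ^ 2) := by gcongr
    _ = genAvg n fun k => f k ^ 2 := by rw [genAvg]; field_simp

/-- The mean squares over generations have expectation at most ρ^n, which is summable; Jensen passes
to absolute values. This is what makes the tree averages forget the root. -/
lemma ae_tendsto_genAvg_abs_slope [IsProbabilityMeasure P] (h : IsIid P θ ν)
    (hν : InputLaw ν ρ) :
    ∀ᵐ ω ∂P, Tendsto (fun n => genAvg n fun k => |slope (fun j => θ j ω) k|) atTop (𝓝 0) := by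
  have hint : ∀ n, ∀ k ∈ gen n, Integrable (fun ω => slope (fun j => θ j ω) k ^ 2) P :=
    fun n k hk => (memLp_slope h hν k (one_le_of_mem_gen hk)).integrable_sq
  have := ae_tendsto_zero_of_integral (P := P)
    (u := fun n ω => genAvg n fun k => slope (fun j => θ j ω) k ^ 2)
    (fun n => (integrable_finsetSum _ (hint n)).const_mul _)
    (fun n ω => mul_nonneg (by positivity) (Finset.sum_nonneg fun _ _ => sq_nonneg _))
    (summable_geometric_of_lt_one hν.rho_pos.le hν.rho_lt) fun n => by
      simp only [genAvg]
      rw [integral_const_mul, integral_finsetSum _ (hint n)]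
      exact (genAvg_mono (integral_sq_slope_le h hν n)).trans_eq (genAvg_const n _)
  filter_upwards [this] with ω hω
  refine tendsto_zero_of_sq (squeeze_zero (fun n => sq_nonneg _) (fun n => ?_) hω)
  simpa only [sq_abs] using genAvg_sq_le n fun k => |slope (fun j => θ j ω) k|

end Moments

/-! ### Bounded Lipschitz functions and the transition operator -/

/-- `f` is bounded by `M` and Lipschitz with constant `l`. -/
structure BddLip (l M : ℝ) (f : ℝ → ℝ) : Prop where
  lip : ∀ x y, |f x - f y| ≤ l * |x - y|
  bdd : ∀ x, |f x| ≤ M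

namespace BddLip

variable {l l' M M' : ℝ} {f g : ℝ → ℝ}

lemma lip_nonneg (h : BddLip l M f) : 0 ≤ l := by
  have := (abs_nonneg _).trans (h.lip 1 0)
  simpa using this

lemma bdd_nonneg (h : BddLip l M f) : 0 ≤ M := (abs_nonneg _).trans (h.bdd 0)

lemma lipschitzWith (h : BddLip l M f) : LipschitzWith ⟨l, h.lip_nonneg⟩ f :=
  LipschitzWith.of_dist_le_mul fun x y => h.lip x y

lemma continuous (h : BddLip l M f) : Continuous f := h.lipschitzWith.continuous

lemma measurable (h : BddLip l M f) : Measurable f := h.continuous.measurable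

lemma integrable_comp {Ω : Type*} [MeasurableSpace Ω] {P : Measure Ω} [IsFiniteMeasure P]
    (h : BddLip l M f) {u : Ω → ℝ} (hu : Measurable u) : Integrable (fun ω => f (u ω)) P :=
  Integrable.of_bound (h.measurable.comp hu).aestronglyMeasurable M
    (Eventually.of_forall fun _ => h.bdd _)

lemma mul (hf : BddLip l M f) (hg : BddLip l' M' g) :
    BddLip (M * l' + M' * l) (M * M') fun x => f x * g x where
  lip x y := by
    have h1 : f x * g x - f y * g y = f x * (g x - g y) + g y * (f x - f y) := by ring
    rw [h1]
    refine (abs_add_le _ _).trans ?_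
    rw [abs_mul, abs_mul]
    have e1 := mul_le_mul (hf.bdd x) (hg.lip x y) (abs_nonneg _) hf.bdd_nonneg
    have e2 := mul_le_mul (hg.bdd y) (hf.lip x y) (abs_nonneg _) hg.bdd_nonneg
    linarith
  bdd x := by
    rw [abs_mul]
    exact mul_le_mul (hf.bdd x) (hg.bdd x) (abs_nonneg _) hf.bdd_nonneg

end BddLip

/-- The transition operator of the process along a uniformly chosen branch. -/
def transition (ν : Measure Input) (f : ℝ → ℝ) (x : ℝ) : ℝ :=
  (∫ z, f (coefOf 0 z * x + noiseOf 0 z) ∂ν + ∫ z, f (coefOf 1 z * x + noiseOf 1 z) ∂ν) / 2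

section Transition

variable {ν : Measure Input} {ρ l M : ℝ} {f : ℝ → ℝ}

lemma measurable_affine (s : ℕ) (x : ℝ) : Measurable fun z => coefOf s z * x + noiseOf s z :=
  ((measurable_coefOf s).mul_const x).add (measurable_noiseOf s)

/-- Two starting points fed with the same input end at distance |coefficient| |x - y|, and the mean
absolute coefficient is at most √ρ. This contraction is the source of ergodicity. -/
lemma abs_integral_affine_sub_le (hν : InputLaw ν ρ) (hf : BddLip l M f) (s : ℕ) (x y : ℝ) :
    |∫ z, f (coefOf s z * x + noiseOf s z) ∂ν - ∫ z, f (coefOf s z * y + noiseOf s z) ∂ν|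
      ≤ l * √ρ * |x - y| := by
  have := hν.prob
  rw [← integral_sub (hf.integrable_comp (measurable_affine s x))
    (hf.integrable_comp (measurable_affine s y))]
  refine abs_integral_le_integral_abs.trans ?_
  have hle : ∀ z, |f (coefOf s z * x + noiseOf s z) - f (coefOf s z * y + noiseOf s z)|
      ≤ (l * |x - y|) * |coefOf s z| := fun z => by
    refine (hf.lip _ _).trans_eq ?_
    rw [show coefOf s z * x + noiseOf s z - (coefOf s z * y + noiseOf s z)
      = coefOf s z * (x - y) by ring, abs_mul]
    ring
  refine (integral_mono (((hf.integrable_comp (measurable_affine s x)).sub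
    (hf.integrable_comp (measurable_affine s y))).abs)
    ((hν.integrable_coef s).abs.const_mul _) hle).trans ?_
  rw [integral_const_mul]
  calc l * |x - y| * ∫ z, |coefOf s z| ∂ν ≤ l * |x - y| * √ρ :=
        mul_le_mul_of_nonneg_left (hν.integral_abs_coef_le s)
          (mul_nonneg hf.lip_nonneg (abs_nonneg _))
    _ = l * √ρ * |x - y| := by ring

lemma BddLip.transition (hf : BddLip l M f) (hν : InputLaw ν ρ) :
    BddLip (l * √ρ) M (transition ν f) where
  lip x y := by
    have h0 := abs_integral_affine_sub_le hν hf 0 x y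
    have h1 := abs_integral_affine_sub_le hν hf 1 x y
    rw [abs_le] at *
    unfold RCBAR.transition
    constructor <;> linarith [h0.1, h0.2, h1.1, h1.2]
  bdd x := by
    have := hν.prob
    have h : ∀ s, |∫ z, f (coefOf s z * x + noiseOf s z) ∂ν| ≤ M := fun s => by
      have := norm_integral_le_of_norm_le_const (μ := ν) (C := M)
        (f := fun z => f (coefOf s z * x + noiseOf s z)) (Eventually.of_forall fun z => hf.bdd _)
      simpa using this
    have h0 := abs_le.1 (h 0)
    have h1 := abs_le.1 (h 1)
    rw [abs_le]
    unfold RCBAR.transition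
    constructor <;> linarith

lemma BddLip.iterate_transition (hf : BddLip l M f) (hν : InputLaw ν ρ) (n : ℕ) :
    BddLip (l * √ρ ^ n) M ((RCBAR.transition ν)^[n] f) := by
  induction n with
  | zero => simpa using hf
  | succ n ih =>
    rw [Function.iterate_succ_apply', pow_succ, ← mul_assoc]
    exact ih.transition hν

/-- One step from 0 moves by the noise alone, so K can be its mean absolute value. Since K is the
same for all f, applying this to the iterates yields a geometric Cauchy sequence. -/
lemma exists_abs_transition_zero_sub_le (hν : InputLaw ν ρ) : ∃ K : ℝ, 0 ≤ K ∧
    ∀ l M f, BddLip l M f → |transition ν f 0 - f 0| ≤ l * K := by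
  have := hν.prob
  refine ⟨(∫ z, |noiseOf 0 z| ∂ν + ∫ z, |noiseOf 1 z| ∂ν) / 2,
    div_nonneg (add_nonneg (integral_nonneg fun _ => abs_nonneg _)
      (integral_nonneg fun _ => abs_nonneg _)) zero_le_two, fun l M f hf => ?_⟩
  have h : ∀ s, |∫ z, f (coefOf s z * 0 + noiseOf s z) ∂ν - f 0| ≤ l * ∫ z, |noiseOf s z| ∂ν := by
    intro s
    have h1 : ∫ z, f (coefOf s z * 0 + noiseOf s z) ∂ν - f 0
        = ∫ z, (f (coefOf s z * 0 + noiseOf s z) - f 0) ∂ν := by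
      rw [integral_sub (hf.integrable_comp (measurable_affine s 0)) (integrable_const _)]
      simp
    rw [h1, ← integral_const_mul]
    refine abs_integral_le_integral_abs.trans (integral_mono
      ((hf.integrable_comp (measurable_affine s 0)).sub (integrable_const _)).abs
      ((hν.integrable_noise s).abs.const_mul _) fun z => ?_)
    simpa using hf.lip (coefOf s z * 0 + noiseOf s z) 0
  have h0 := abs_le.1 (h 0)
  have h1 := abs_le.1 (h 1)
  rw [abs_le]
  unfold transition
  constructor <;> linarith [h0.1, h0.2, h1.1, h1.2]

/-- `τ` is the stationary law of the transition operator. -/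
structure IsStationary (ν : Measure Input) (ρ : ℝ) (τ : Measure ℝ) : Prop where
  prob : IsProbabilityMeasure τ
  exists_bound : ∃ K : ℝ, 0 ≤ K ∧ ∀ l M f, BddLip l M f → ∀ n x,
    |(transition ν)^[n] f x - ∫ t, f t ∂τ| ≤ l * √ρ ^ n * (|x| + K)

/-- The iterates at 0 of `transition ν f` are those of f shifted by one, hence have the same limit.
-/
lemma IsStationary.integral_transition {τ : Measure ℝ} (hτ : IsStationary ν ρ τ)
    (hν : InputLaw ν ρ) (hf : BddLip l M f) :
    ∫ t, RCBAR.transition ν f t ∂τ = ∫ t, f t ∂τ := by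
  obtain ⟨K, -, hK⟩ := hτ.exists_bound
  have hlim : ∀ l M f, BddLip l M f →
      Tendsto (fun n => (RCBAR.transition ν)^[n] f 0) atTop (𝓝 (∫ t, f t ∂τ)) := by
    intro l M f hf
    have h0 := tendsto_pow_atTop_nhds_zero_of_lt_one (Real.sqrt_nonneg ρ) hν.sqrt_lt_one
    have h1 := (h0.const_mul l).mul_const (|(0 : ℝ)| + K)
    rw [mul_zero, zero_mul] at h1
    exact tendsto_iff_norm_sub_tendsto_zero.2
      (squeeze_zero (fun n => norm_nonneg _) (fun n => hK l M f hf n 0) h1)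
  have h1 := (hlim l M f hf).comp (tendsto_add_atTop_nat 1)
  exact tendsto_nhds_unique (hlim _ _ _ (hf.transition hν)) h1

end Transition

/-! ### The random branch -/

section Branch

lemma branch_mem_gen (κ : ℕ → Fin 2) (n : ℕ) : branch κ n ∈ gen n := by
  induction n with
  | zero => simp [branch, gen]
  | succ n ih =>
    have := (κ n).isLt
    simp only [gen, Finset.mem_Ico, branch] at ih ⊢
    rw [pow_succ' 2 (n + 1)]
    have : 2 ^ (n + 1) = 2 * 2 ^ n := pow_succ' 2 n
    omega

/-- The law of a fair coin. -/
abbrev fairCoin : Measure (Fin 2) := (PMF.uniformOfFintype (Fin 2)).toMeasure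

lemma isIid_coins : IsIid coins (fun k (κ : ℕ → Fin 2) => κ (k - 1)) fairCoin where
  measurable k _ := measurable_pi_apply _
  indep := by
    have := iIndepFun_infinitePi (P := fun _ : ℕ => fairCoin) (X := fun _ x => x)
      (fun _ => measurable_id)
    simpa only [Nat.add_sub_cancel] using! this
  map_eq k _ := Measure.infinitePi_map_eval (fun _ => fairCoin) (k - 1)

/-- The position in generation n is decided by the first n coins, exactly those in the past of index
n + 1, because coin k is the coordinate k - 1. -/
lemma measurable_branch (n : ℕ) :
    Measurable[past (fun k (κ : ℕ → Fin 2) => κ (k - 1)) (n + 1)] fun κ => branch κ n := by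
  induction n with
  | zero => exact measurable_const
  | succ n ih =>
    have h1 := ih.mono (past_mono (fun k (κ : ℕ → Fin 2) => κ (k - 1))
      (show n + 1 ≤ n + 1 + 1 by omega)) le_rfl
    have h2 := measurable_past (fun k (κ : ℕ → Fin 2) => κ (k - 1))
      (show 1 ≤ n + 1 by omega) (show n + 1 < n + 1 + 1 by omega)
    exact (measurable_of_countable fun p : ℕ × Fin 2 => 2 * p.1 + (p.2 : ℕ)).comp (h1.prodMk h2)

lemma integral_fairCoin (f : Fin 2 → ℝ) : ∫ x, f x ∂fairCoin = (f 0 + f 1) / 2 := by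
  rw [PMF.integral_eq_sum, Fin.sum_univ_two]
  simp [PMF.uniformOfFintype_apply]
  ring

/-- The branch is uniform on its generation: the last coin is independent of the current position
and averages over its two children. -/
lemma integral_branch {M : ℝ} (n : ℕ) : ∀ F : ℕ → ℝ, (∀ k, |F k| ≤ M) →
    ∫ κ, F (branch κ n) ∂coins = genAvg n F := by
  induction n with
  | zero => intro F _; simp [branch, genAvg, gen]
  | succ n ih =>
    intro F hF
    have hb : Measurable fun κ => branch κ n :=
      (measurable_branch n).mono (isIid_coins.past_le _) le_rfl
    have hm : Measurable fun p : ℕ × Fin 2 => F (2 * p.1 + (p.2 : ℕ)) := measurable_of_countable _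
    have h1 := isIid_coins.integral_prod (k := n + 1) (by omega) (measurable_branch n) hm
      (Integrable.of_bound (hm.comp (hb.prodMk (measurable_pi_apply _))).aestronglyMeasurable M
        (Eventually.of_forall fun κ => hF _))
    simp only [Nat.add_sub_cancel, integral_fairCoin] at h1
    have h2 := ih (fun k => (F (2 * k) + F (2 * k + 1)) / 2) fun k => by
      have e1 := abs_le.1 (hF (2 * k))
      have e2 := abs_le.1 (hF (2 * k + 1))
      rw [abs_le]; constructor <;> linarith
    calc ∫ κ, F (branch κ (n + 1)) ∂coins
        = ∫ κ, F (2 * branch κ n + (κ n : ℕ)) ∂coins := rfl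
      _ = genAvg n fun k => (F (2 * k) + F (2 * k + 1)) / 2 := by
        rw [h1, ← h2]; simp
      _ = genAvg (n + 1) F := by
        rw [genAvg, genAvg, sum_gen_succ, ← Finset.sum_div, pow_succ]
        field_simp

variable {Ω : Type*} [MeasurableSpace Ω] {P : Measure Ω}

lemma measurable_branchProcess {g : ℕ → Ω → ℝ} (hg : ∀ k, 1 ≤ k → Measurable (g k)) (n : ℕ) :
    Measurable (branchProcess g n) := by
  -- Nothing is assumed about label 0, which the branch never visits, so the value there is replaced
  -- by 0.
  have h1 : Measurable fun p : Ω × ℕ => if 1 ≤ p.2 then g p.2 p.1 else 0 := by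
    refine measurable_from_prod_countable_left fun k => ?_
    by_cases hk : 1 ≤ k
    · simpa [hk] using hg k hk
    · simp [hk]
  have h2 : Measurable fun p : Ω × (ℕ → Fin 2) => (p.1, branch p.2 n) :=
    measurable_fst.prodMk (((measurable_branch n).mono (isIid_coins.past_le _) le_rfl).comp
      measurable_snd)
  convert h1.comp h2 using 1
  funext p
  simp [branchProcess, one_le_of_mem_gen (branch_mem_gen p.2 n)]

lemma integral_branchProcess [IsProbabilityMeasure P] {g : ℕ → Ω → ℝ}
    (hg : ∀ k, 1 ≤ k → Measurable (g k)) (n : ℕ)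
    {f : ℝ → ℝ} (hf : Measurable f) {M : ℝ} (hM : ∀ x, |f x| ≤ M) :
    ∫ p, f (branchProcess g n p) ∂(P.prod coins) = ∫ ω, genAvg n (fun k => f (g k ω)) ∂P := by
  have hint : Integrable (fun p => f (branchProcess g n p)) (P.prod coins) :=
    Integrable.of_bound (hf.comp (measurable_branchProcess hg n)).aestronglyMeasurable M
      (Eventually.of_forall fun p => hM _)
  rw [MeasureTheory.integral_prod _ hint]
  exact integral_congr_ae (Eventually.of_forall fun ω =>
    integral_branch n (fun k => f (g k ω)) fun k => hM _)

end Branch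

/-! ### Law of large numbers on the tree -/

section LLN

variable {Ω : Type*} [MeasurableSpace Ω] {P : Measure Ω} [IsProbabilityMeasure P]
  {θ : ℕ → Ω → Input} {ν : Measure Input} {ρ l M : ℝ} {f : ℝ → ℝ}

omit [IsProbabilityMeasure P] in
lemma measurable_base' (h : IsIid P θ ν) {k : ℕ} (hk : 1 ≤ k) :
    Measurable fun ω => base (fun j => θ j ω) k :=
  (measurable_base θ k hk).mono (h.past_le k) le_rfl

/-- The deviation of the mean of `f` over the two children of `k` from its conditional mean. -/
def childDev (ν : Measure Input) (θ : ℕ → Ω → Input) (f : ℝ → ℝ) (k : ℕ) (ω : Ω) : ℝ :=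
  (f (base (fun j => θ j ω) (2 * k)) + f (base (fun j => θ j ω) (2 * k + 1))) / 2
    - transition ν f (base (fun j => θ j ω) k)

omit [MeasurableSpace Ω] in
lemma abs_childDev_le (hν : InputLaw ν ρ) (hf : BddLip l M f) (k : ℕ) (ω : Ω) :
    |childDev ν θ f k ω| ≤ 2 * M := by
  have h1 := abs_le.1 (hf.bdd (base (fun j => θ j ω) (2 * k)))
  have h2 := abs_le.1 (hf.bdd (base (fun j => θ j ω) (2 * k + 1)))
  have h3 := abs_le.1 ((hf.transition hν).bdd (base (fun j => θ j ω) k))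
  rw [abs_le]
  unfold childDev
  constructor <;> linarith

omit [MeasurableSpace Ω] in
lemma measurable_childDev (hν : InputLaw ν ρ) (hf : BddLip l M f) {k : ℕ} (hk : 1 ≤ k) :
    Measurable[past θ (k + 1)] (childDev ν θ f k) := by
  have hb := (measurable_base θ k hk).mono (past_mono θ k.le_succ) le_rfl
  have hc : ∀ s < 2, Measurable[past θ (k + 1)] fun ω => base (fun j => θ j ω) (2 * k + s) := by
    intro s hs
    simp only [base_child _ hk hs]
    exact (((measurable_coefOf s).comp (measurable_past θ hk k.lt_succ_self)).mul hb).add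
      ((measurable_noiseOf s).comp (measurable_past θ hk k.lt_succ_self))
  exact (((hf.measurable.comp (hc 0 two_pos)).add
    (hf.measurable.comp (hc 1 one_lt_two))).div_const 2).sub
    ((hf.transition hν).measurable.comp hb)

/-- Integrating out the fresh input θ_k with the past frozen replaces f at each child by its
conditional mean, and `transition` is the mean of the two. The deviations are therefore martingale
increments in the label order. -/
lemma integral_mul_childDev (h : IsIid P θ ν) (hν : InputLaw ν ρ) (hf : BddLip l M f) {k : ℕ}
    (hk : 1 ≤ k) {U : Ω → ℝ} (hU : Measurable[past θ k] U) (hU2 : MemLp U 2 P) :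
    ∫ ω, U ω * childDev ν θ f k ω ∂P = 0 := by
  have hUi : Integrable U P := hU2.integrable (by norm_num)
  have hint : ∀ g : ℝ → ℝ, ∀ l', BddLip l' M g → ∀ j, 1 ≤ j →
      Integrable (fun ω => U ω * g (base (fun i => θ i ω) j)) P := fun g l' hg j hj =>
    hUi.mul_bdd (c := M) (hg.measurable.comp (measurable_base' h hj)).aestronglyMeasurable
      (Eventually.of_forall fun ω => hg.bdd _)
  have hchild : ∀ s < 2, ∫ ω, U ω * f (base (fun j => θ j ω) (2 * k + s)) ∂P
      = ∫ ω, U ω * ∫ z, f (coefOf s z * base (fun j => θ j ω) k + noiseOf s z) ∂ν ∂P := by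
    intro s hs
    have h1 := h.integral_prod hk (V := fun ω => (U ω, base (fun j => θ j ω) k))
      (hU.prodMk (measurable_base θ k hk))
      (f := fun p : (ℝ × ℝ) × Input => p.1.1 * f (coefOf s p.2 * p.1.2 + noiseOf s p.2))
      ((measurable_fst.comp measurable_fst).mul (hf.measurable.comp
        ((((measurable_coefOf s).comp measurable_snd).mul (measurable_snd.comp measurable_fst)).add
          ((measurable_noiseOf s).comp measurable_snd))))
      (by simpa only [base_child _ hk hs] using hint f l hf (2 * k + s) (by omega))
    simpa only [base_child _ hk hs, integral_const_mul] using h1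
  have hcint : ∀ s, Integrable (fun ω => U ω *
      ∫ z, f (coefOf s z * base (fun j => θ j ω) k + noiseOf s z) ∂ν) P := fun s => by
    have hc : BddLip (l * √ρ) M fun x => ∫ z, f (coefOf s z * x + noiseOf s z) ∂ν := by
      refine ⟨abs_integral_affine_sub_le hν hf s, fun x => ?_⟩
      have := hν.prob
      have := norm_integral_le_of_norm_le_const (μ := ν) (C := M)
        (f := fun z => f (coefOf s z * x + noiseOf s z)) (Eventually.of_forall fun z => hf.bdd _)
      simpa using this
    exact hint _ _ hc k hk
  have e0 := hchild 0 two_pos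
  have e1 := hchild 1 one_lt_two
  rw [add_zero] at e0
  have hexp : ∀ ω, U ω * childDev ν θ f k ω
      = (U ω * f (base (fun j => θ j ω) (2 * k))
          + U ω * f (base (fun j => θ j ω) (2 * k + 1))) / 2
        - (U ω * (∫ z, f (coefOf 0 z * base (fun j => θ j ω) k + noiseOf 0 z) ∂ν)
          + U ω * ∫ z, f (coefOf 1 z * base (fun j => θ j ω) k + noiseOf 1 z) ∂ν) / 2 := fun ω => by
    simp only [childDev, transition]; ring
  simp only [hexp]
  have i0 := hint f l hf (2 * k) (by omega)
  have i1 := hint f l hf (2 * k + 1) (by omega)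
  have e2 := integral_sub ((i0.add i1).div_const 2) (((hcint 0).add (hcint 1)).div_const 2)
  have e3 := integral_add i0 i1
  have e4 := integral_add (hcint 0) (hcint 1)
  simp only [Pi.add_apply, integral_div] at e2
  rw [e2, e3, e4, e0, e1, sub_self]

omit [MeasurableSpace Ω] [IsProbabilityMeasure P] in
lemma genAvg_succ_sub (f : ℝ → ℝ) (n : ℕ) (ω : Ω) :
    genAvg (n + 1) (fun k => f (base (fun j => θ j ω) k))
      - genAvg n (fun k => transition ν f (base (fun j => θ j ω) k))
      = ((2 : ℝ) ^ n)⁻¹ * ∑ k ∈ gen n, childDev ν θ f k ω := by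
  simp only [childDev]
  rw [genAvg, genAvg, sum_gen_succ, Finset.sum_sub_distrib, ← Finset.sum_div, pow_succ]
  field_simp

lemma memLp_childDev (h : IsIid P θ ν) (hν : InputLaw ν ρ) (hf : BddLip l M f) {k : ℕ}
    (hk : 1 ≤ k) : MemLp (childDev ν θ f k) 2 P :=
  MemLp.of_bound ((measurable_childDev hν hf hk).mono (h.past_le _) le_rfl).aestronglyMeasurable
    (2 * M) (Eventually.of_forall (abs_childDev_le hν hf k))

/-- An average of 2^n orthogonal deviations, each bounded by 2M. -/
lemma integral_sq_genAvg_succ_sub_le (h : IsIid P θ ν) (hν : InputLaw ν ρ) (hf : BddLip l M f)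
    (n : ℕ) : ∫ ω, (genAvg (n + 1) (fun k => f (base (fun j => θ j ω) k))
      - genAvg n (fun k => transition ν f (base (fun j => θ j ω) k))) ^ 2 ∂P
      ≤ (2 * M) ^ 2 * ((2 : ℝ) ^ n)⁻¹ := by
  conv_lhs => simp only [genAvg_succ_sub, mul_pow _ _ 2, integral_const_mul]
  rw [IsIid.integral_sq_sum (θ := θ)
    (fun k hk => memLp_childDev h hν hf (one_le_of_mem_gen hk))
    (fun k hk => measurable_childDev hν hf (one_le_of_mem_gen hk))
    fun k hk U hU hU2 => integral_mul_childDev h hν hf (one_le_of_mem_gen hk) hU hU2]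
  have hone : ∀ k ∈ gen n, ∫ ω, childDev ν θ f k ω ^ 2 ∂P ≤ (2 * M) ^ 2 := fun k hk =>
    (integral_mono (memLp_childDev h hν hf (one_le_of_mem_gen hk)).integrable_sq
      (integrable_const _) fun ω => sq_le_sq' (abs_le.1 (abs_childDev_le hν hf k ω)).1
        (abs_le.1 (abs_childDev_le hν hf k ω)).2).trans_eq (by simp)
  have hs := Finset.sum_le_card_nsmul _ _ _ hone
  rw [card_gen, nsmul_eq_mul] at hs
  push_cast at hs
  calc (((2 : ℝ) ^ n)⁻¹) ^ 2 * ∑ k ∈ gen n, ∫ ω, childDev ν θ f k ω ^ 2 ∂P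
      ≤ (((2 : ℝ) ^ n)⁻¹) ^ 2 * (2 ^ n * (2 * M) ^ 2) := by gcongr
    _ = (2 * M) ^ 2 * ((2 : ℝ) ^ n)⁻¹ := by field_simp

omit [IsProbabilityMeasure P] in
lemma measurable_genAvg_base (h : IsIid P θ ν) (hf : BddLip l M f) (n : ℕ) :
    Measurable fun ω => genAvg n fun k => f (base (fun j => θ j ω) k) :=
  (Finset.measurable_fun_sum _ fun _ hk =>
    hf.measurable.comp (measurable_base' h (one_le_of_mem_gen hk))).const_mul _

omit [MeasurableSpace Ω] in
lemma abs_genAvg_le_of_bdd (hf : BddLip l M f) (n : ℕ) (x : ℕ → ℝ) :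
    |genAvg n fun k => f (x k)| ≤ M :=
  (abs_genAvg_le _ _).trans ((genAvg_mono fun _ _ => hf.bdd _).trans_eq (genAvg_const n M))

lemma memLp_genAvg_base (h : IsIid P θ ν) (hf : BddLip l M f) (n : ℕ) :
    MemLp (fun ω => genAvg n fun k => f (base (fun j => θ j ω) k)) 2 P :=
  MemLp.of_bound (measurable_genAvg_base h hf n).aestronglyMeasurable M
    (Eventually.of_forall fun _ => abs_genAvg_le_of_bdd hf n _)

lemma integral_genAvg_base (h : IsIid P θ ν) (hν : InputLaw ν ρ) (n : ℕ) :
    ∀ l M f, BddLip l M f →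
    ∫ ω, genAvg n (fun k => f (base (fun j => θ j ω) k)) ∂P = (transition ν)^[n] f 0 := by
  induction n with
  | zero => intro l M f _; simp [genAvg, gen, base_one]
  | succ n ih =>
    intro l M f hf
    have h1 : ∫ ω, (genAvg (n + 1) (fun k => f (base (fun j => θ j ω) k))
      - genAvg n (fun k => transition ν f (base (fun j => θ j ω) k))) ∂P = 0 := by
      simp only [genAvg_succ_sub, integral_const_mul]
      rw [integral_finsetSum _ fun k hk =>
        (memLp_childDev h hν hf (one_le_of_mem_gen hk)).integrable (by norm_num),
        Finset.sum_eq_zero fun k hk => ?_, mul_zero]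
      simpa using integral_mul_childDev h hν hf (one_le_of_mem_gen hk) (U := fun _ => 1)
        measurable_const (memLp_const 1)
    rw [integral_sub ((memLp_genAvg_base h hf _).integrable (by norm_num))
      ((memLp_genAvg_base h (hf.transition hν) _).integrable (by norm_num)), sub_eq_zero,
      ih _ _ _ (hf.transition hν)] at h1
    rw [h1, Function.iterate_succ_apply]

end LLN

/-! ### Existence of the stationary law -/

section Stationary

variable {Ω : Type*} [MeasurableSpace Ω] {P : Measure Ω} [IsProbabilityMeasure P]
  {θ : ℕ → Ω → Input} {ν : Measure Input} {ρ l M : ℝ} {f : ℝ → ℝ}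

/-- The law of the process started at `0` along the random branch. -/
def branchLaw (P : Measure Ω) (θ : ℕ → Ω → Input) (n : ℕ) : Measure ℝ :=
  (P.prod coins).map (branchProcess (fun k ω => base (fun j => θ j ω) k) n)

lemma isProbabilityMeasure_branchLaw (h : IsIid P θ ν) (n : ℕ) :
    IsProbabilityMeasure (branchLaw P θ n) :=
  Measure.isProbabilityMeasure_map
    (measurable_branchProcess (fun _ => measurable_base' h) n).aemeasurable

lemma integral_branchLaw (h : IsIid P θ ν) (n : ℕ) {f : ℝ → ℝ} (hf : Measurable f) {M : ℝ}
    (hM : ∀ x, |f x| ≤ M) :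
    ∫ x, f x ∂branchLaw P θ n = ∫ ω, genAvg n (fun k => f (base (fun j => θ j ω) k)) ∂P := by
  rw [branchLaw, integral_map
    (measurable_branchProcess (fun _ => measurable_base' h) n).aemeasurable
    hf.aestronglyMeasurable, integral_branchProcess (fun _ => measurable_base' h) n hf hM]

/-- Markov's inequality, with first moments bounded uniformly over the tree. -/
lemma isTight_branchLaw (h : IsIid P θ ν) (hν : InputLaw ν ρ) :
    IsTightMeasureSet (Set.range (branchLaw P θ)) := by
  obtain ⟨K, hK0, hK⟩ := exists_integral_abs_base_le h hν
  refine isTightMeasureSet_of_tendsto_measure_norm_gt ?_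
  have hlim : Tendsto (fun r : ℝ => ENNReal.ofReal (K / r)) atTop (𝓝 0) := by
    have := ENNReal.tendsto_ofReal ((tendsto_const_nhds (x := K)).div_atTop tendsto_id)
    simpa using this
  refine tendsto_of_tendsto_of_tendsto_of_le_of_le' tendsto_const_nhds hlim
    (Eventually.of_forall fun _ => zero_le) ?_
  filter_upwards [eventually_gt_atTop 0] with r hr
  refine iSup₂_le ?_
  rintro _ ⟨n, rfl⟩
  have := isProbabilityMeasure_branchLaw h n
  have hS : MeasurableSet {x : ℝ | r < ‖x‖} := measurableSet_lt measurable_const measurable_norm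
  rw [← ofReal_measureReal (measure_ne_top _ _), ← integral_indicator_one hS]
  refine ENNReal.ofReal_le_ofReal ?_
  have hind : ∀ x, |({x : ℝ | r < ‖x‖}.indicator (1 : ℝ → ℝ)) x| ≤ 1 := fun x => by
    simp only [Set.indicator, Pi.one_apply]
    split_ifs <;> simp
  rw [integral_branchLaw h n (measurable_one.indicator hS) hind]
  have hint : ∀ k ∈ gen n, Integrable (fun ω => |base (fun j => θ j ω) k| / r) P := fun k hk =>
    ((memLp_base h hν k (one_le_of_mem_gen hk)).integrable (by norm_num)).abs.div_const r
  have hle : ∀ ω, genAvg n (fun k => ({x : ℝ | r < ‖x‖}.indicator (1 : ℝ → ℝ))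
      (base (fun j => θ j ω) k)) ≤ genAvg n fun k => |base (fun j => θ j ω) k| / r := fun ω => by
    refine genAvg_mono fun k _ => ?_
    by_cases hx : r < ‖base (fun j => θ j ω) k‖
    · rw [Set.indicator_of_mem (by exact hx), Pi.one_apply, one_le_div hr]
      exact hx.le
    · rw [Set.indicator_of_notMem (by exact hx)]
      positivity
  refine (integral_mono_of_nonneg (Eventually.of_forall fun ω => mul_nonneg (by positivity)
    (Finset.sum_nonneg fun _ _ => Set.indicator_nonneg (fun _ _ => zero_le_one) _))
    ((integrable_finsetSum _ hint).const_mul _) (Eventually.of_forall hle)).trans ?_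
  rw [integral_const_mul, integral_finsetSum _ hint]
  refine (genAvg_mono fun k hk => ?_).trans_eq (genAvg_const n (K / r))
  rw [integral_div]
  exact div_le_div_of_nonneg_right (hK k (one_le_of_mem_gen hk)) hr.le

/-- Tightness supplies a cluster point τ of the branch laws started at 0. Contraction makes the
iterates at 0 converge geometrically, so their limit must be the integral against τ, and it also
gives the rate from any other point. -/
theorem exists_isStationary (h : IsIid P θ ν) (hν : InputLaw ν ρ) : ∃ τ, IsStationary ν ρ τ := by
  set μ : ℕ → ProbabilityMeasure ℝ := fun n => ⟨branchLaw P θ n, isProbabilityMeasure_branchLaw h n⟩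
    with hμ
  have hcomp : IsCompact (closure (Set.range μ)) := by
    refine isCompact_closure_of_isTightMeasureSet ((isTight_branchLaw h hν).subset ?_)
    rintro _ ⟨_, ⟨n, rfl⟩, rfl⟩
    exact ⟨n, rfl⟩
  obtain ⟨τ, -, hτ⟩ := hcomp.exists_mapClusterPt (f := atTop) (u := μ)
    (tendsto_principal.2 (Eventually.of_forall fun n => subset_closure (Set.mem_range_self n)))
  obtain ⟨K, hK0, hK⟩ := exists_abs_transition_zero_sub_le hν
  have hr := hν.sqrt_lt_one
  have hr' : 0 < 1 - √ρ := by linarith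
  -- The constant sums the geometric series of the one-step displacements from 0; moving from x to 0
  -- accounts for |x|.
  refine ⟨(τ : Measure ℝ), inferInstance, K / (1 - √ρ), by positivity, fun l M f hf n x => ?_⟩
  have hstep : ∀ n, dist ((transition ν)^[n] f 0) ((transition ν)^[n + 1] f 0)
      ≤ l * K * √ρ ^ n := fun n => by
    rw [dist_comm, Function.iterate_succ_apply', Real.dist_eq]
    exact (hK _ _ _ (hf.iterate_transition hν n)).trans_eq (by ring)
  obtain ⟨lim, hlim⟩ := cauchySeq_tendsto_of_complete
    (cauchySeq_of_le_geometric _ _ hr hstep)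
  have hτlim : ∫ t, f t ∂(τ : Measure ℝ) = lim := by
    have hcont := ProbabilityMeasure.continuous_integral_boundedContinuousFunction
      (BoundedContinuousFunction.ofNormedAddCommGroup f hf.continuous M hf.bdd)
    have hcl := hτ.continuousAt_comp hcont.continuousAt
    have heq : ((fun m : ProbabilityMeasure ℝ => ∫ x, (BoundedContinuousFunction.ofNormedAddCommGroup
        f hf.continuous M hf.bdd) x ∂(m : Measure ℝ)) ∘ μ) = fun n => (transition ν)^[n] f 0 := by
      funext n
      rw [← integral_genAvg_base h hν n l M f hf, ← integral_branchLaw h n hf.measurable hf.bdd]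
      rfl
    rw [heq] at hcl
    have hne : (𝓝 (∫ t, f t ∂(τ : Measure ℝ)) ⊓ 𝓝 lim).NeBot :=
      hcl.neBot.mono (inf_le_inf le_rfl hlim)
    exact eq_of_nhds_neBot hne
  have h1 := dist_le_of_le_geometric_of_tendsto _ _ hr hstep hlim n
  have h2 := (hf.iterate_transition hν n).lip x 0
  rw [Real.dist_eq] at h1
  rw [hτlim]
  calc |(transition ν)^[n] f x - lim|
      ≤ |(transition ν)^[n] f x - (transition ν)^[n] f 0| + |(transition ν)^[n] f 0 - lim| :=
        abs_sub_le _ _ _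
    _ ≤ l * √ρ ^ n * |x - 0| + l * K * √ρ ^ n / (1 - √ρ) := add_le_add h2 h1
    _ = l * √ρ ^ n * (|x| + K / (1 - √ρ)) := by rw [sub_zero]; ring

end Stationary

/-! ### Almost sure convergence of the averages over the generations -/

section Average

variable {Ω : Type*} [MeasurableSpace Ω] {P : Measure Ω} [IsProbabilityMeasure P]
  {θ : ℕ → Ω → Input} {ν : Measure Input} {ρ l M : ℝ} {f : ℝ → ℝ} {τ : Measure ℝ}

/-- Telescoping over j generations: every one-step sampling error occurs at generation m or later,
so none exceeds the bound 2M · 2^{-m/2}. -/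
lemma integral_abs_genAvg_sub_iterate_le (h : IsIid P θ ν) (hν : InputLaw ν ρ) (hf : BddLip l M f)
    (j : ℕ) : ∀ m, ∫ ω, |genAvg (m + j) (fun k => f (base (fun j => θ j ω) k))
      - genAvg m (fun k => (transition ν)^[j] f (base (fun j => θ j ω) k))| ∂P
      ≤ j * (2 * M * √(1 / 2) ^ m) := by
  induction j with
  | zero => intro m; simp
  | succ j ih =>
    intro m
    have hM := hf.bdd_nonneg
    have hj := hf.iterate_transition hν j
    have i1 := memLp_genAvg_base h hf (m + (j + 1))
    have i2 := memLp_genAvg_base h hj (m + 1)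
    have i3 := memLp_genAvg_base h (hj.transition hν) m
    have e1 := ih (m + 1)
    have e2 : ∫ ω, |genAvg (m + 1) (fun k => (transition ν)^[j] f (base (fun j => θ j ω) k))
        - genAvg m (fun k => transition ν ((transition ν)^[j] f) (base (fun j => θ j ω) k))| ∂P
        ≤ 2 * M * √(1 / 2) ^ m := by
      refine integral_abs_le_of_integral_sq_le (i2.sub i3) (by positivity)
        ((integral_sq_genAvg_succ_sub_le h hν hj m).trans_eq ?_)
      have hsq : (√(1 / 2) ^ m) ^ 2 = ((2 : ℝ) ^ m)⁻¹ := by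
        rw [← pow_mul, mul_comm, pow_mul, Real.sq_sqrt (by norm_num), one_div, inv_pow]
      rw [mul_pow (2 * M) (√(1 / 2) ^ m) 2, hsq]
    have hq : √(1 / 2) ^ (m + 1) ≤ √(1 / 2) ^ m :=
      pow_le_pow_of_le_one (Real.sqrt_nonneg _) (Real.sqrt_le_one.2 (by norm_num)) (by omega)
    rw [show m + 1 + j = m + (j + 1) by ring] at e1
    have hle := integral_mono (((i1.sub i3).integrable (by norm_num)).abs)
      ((((i1.sub i2).integrable (by norm_num)).abs).add
        (((i2.sub i3).integrable (by norm_num)).abs)) fun ω => abs_sub_le _ _ _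
    have hadd := integral_add (((i1.sub i2).integrable (by norm_num)).abs)
      (((i2.sub i3).integrable (by norm_num)).abs)
    simp only [Function.iterate_succ_apply']
    calc _ ≤ _ := hle
      _ = _ := hadd
      _ ≤ j * (2 * M * √(1 / 2) ^ (m + 1)) + 2 * M * √(1 / 2) ^ m := add_le_add e1 e2
      _ ≤ j * (2 * M * √(1 / 2) ^ m) + 2 * M * √(1 / 2) ^ m := by gcongr
      _ = ((j + 1 : ℕ) : ℝ) * (2 * M * √(1 / 2) ^ m) := by push_cast; ring

/-- The bias from stationarity is at most l √ρ^j (|x| + K) at a point x, and first moments are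
bounded uniformly in the generation. -/
lemma integral_abs_genAvg_iterate_sub_le (h : IsIid P θ ν) (hν : InputLaw ν ρ)
    (hτ : IsStationary ν ρ τ) : ∃ K, 0 ≤ K ∧ ∀ l M f, BddLip l M f → ∀ j m,
    ∫ ω, |genAvg m (fun k => (transition ν)^[j] f (base (fun j => θ j ω) k)) - ∫ t, f t ∂τ| ∂P
      ≤ l * √ρ ^ j * K := by
  obtain ⟨K₁, hK₁, hb⟩ := exists_integral_abs_base_le h hν
  obtain ⟨K₂, hK₂, hs⟩ := hτ.exists_bound
  refine ⟨K₁ + K₂, add_nonneg hK₁ hK₂, fun l M f hf j m => ?_⟩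
  have hl := hf.lip_nonneg
  have hint : ∀ k ∈ gen m, Integrable (fun ω => l * √ρ ^ j * (|base (fun j => θ j ω) k| + K₂)) P :=
    fun k hk => ((((memLp_base h hν k (one_le_of_mem_gen hk)).integrable (by norm_num)).abs).add
      (integrable_const K₂)).const_mul _
  have hle : ∀ ω, |genAvg m (fun k => (transition ν)^[j] f (base (fun j => θ j ω) k))
      - ∫ t, f t ∂τ| ≤ genAvg m fun k => l * √ρ ^ j * (|base (fun j => θ j ω) k| + K₂) := fun ω => by
    rw [← genAvg_const m (∫ t, f t ∂τ), ← genAvg_sub]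
    exact (abs_genAvg_le _ _).trans (genAvg_mono fun k _ => hs l M f hf j _)
  refine (integral_mono_of_nonneg (Eventually.of_forall fun _ => abs_nonneg _)
    ((integrable_finsetSum _ hint).const_mul _) (Eventually.of_forall hle)).trans ?_
  rw [integral_const_mul, integral_finsetSum _ hint]
  refine (genAvg_mono fun k hk => ?_).trans_eq (genAvg_const m _)
  rw [integral_const_mul]
  refine mul_le_mul_of_nonneg_left ?_ (by positivity)
  rw [integral_add ((memLp_base h hν k (one_le_of_mem_gen hk)).integrable (by norm_num)).abs
    (integrable_const K₂)]
  simpa using hb k (one_le_of_mem_gen hk)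

/-- With n = m + j cut in halves, the sampling error decays in m and the bias in j. The L¹ errors
are summable, which gives almost sure convergence. -/
lemma ae_tendsto_genAvg_base (h : IsIid P θ ν) (hν : InputLaw ν ρ) (hτ : IsStationary ν ρ τ)
    (hf : BddLip l M f) : ∀ᵐ ω ∂P, Tendsto
      (fun n => genAvg n fun k => f (base (fun j => θ j ω) k)) atTop (𝓝 (∫ t, f t ∂τ)) := by
  obtain ⟨K, hK0, hK⟩ := integral_abs_genAvg_iterate_sub_le h hν hτ
  have hl := hf.lip_nonneg
  have hM := hf.bdd_nonneg
  -- Half of n steps at rate √ρ = t² amounts to t^n, up to a factor t⁻¹ when n is odd.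
  set t := √(√ρ) with ht
  have ht0 : 0 < t := Real.sqrt_pos.2 (Real.sqrt_pos.2 hν.rho_pos)
  have ht1 : t < 1 := by
    rw [ht, Real.sqrt_lt' one_pos]; simpa using hν.sqrt_lt_one
  have htsq : t ^ 2 = √ρ := Real.sq_sqrt (Real.sqrt_nonneg _)
  have hq : √(1 / 2) ≤ t ^ 2 := by
    rw [htsq]; exact Real.sqrt_le_sqrt (by linarith [hν.le_rho])
  have htsq1 : t ^ 2 ≤ 1 := by rw [htsq]; exact hν.sqrt_lt_one.le
  have hsummable : Summable fun n : ℕ => ((n : ℝ) * (2 * M) + l * K) * (t⁻¹ * t ^ n) := by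
    have h1 := summable_pow_mul_geometric_of_norm_lt_one (R := ℝ) 1
      (r := t) (by rwa [Real.norm_of_nonneg ht0.le])
    have h2 := summable_geometric_of_lt_one ht0.le ht1
    refine ((h1.mul_left (2 * M * t⁻¹)).add (h2.mul_left (l * K * t⁻¹))).congr fun n => ?_
    ring
  have hmem : ∀ n, Integrable (fun ω => |genAvg n (fun k => f (base (fun j => θ j ω) k))
      - ∫ t, f t ∂τ|) P := fun n =>
    (((memLp_genAvg_base h hf n).integrable (by norm_num)).sub (integrable_const _)).abs
  have key := ae_tendsto_zero_of_integral hmem (fun n ω => abs_nonneg _) hsummable fun n => by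
    obtain ⟨m, hm⟩ : ∃ m, n = m + n / 2 := ⟨n - n / 2, by omega⟩
    set j := n / 2 with hj
    have i1 := memLp_genAvg_base h hf (m + j)
    have i2 := memLp_genAvg_base h (hf.iterate_transition hν j) m
    have hadd := integral_add (((i1.sub i2).integrable (by norm_num)).abs)
      (((i2.sub (memLp_const (∫ t, f t ∂τ))).integrable (by norm_num)).abs)
    have hle := integral_mono (((i1.sub (memLp_const (∫ t, f t ∂τ))).integrable (by norm_num)).abs)
      ((((i1.sub i2).integrable (by norm_num)).abs).add
        (((i2.sub (memLp_const (∫ t, f t ∂τ))).integrable (by norm_num)).abs))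
      fun ω => abs_sub_le _ _ _
    have e1 := integral_abs_genAvg_sub_iterate_le h hν hf j m
    have e2 := hK l M f hf j m
    have hjm : (t ^ 2) ^ m ≤ (t ^ 2) ^ j := pow_le_pow_of_le_one (by positivity) htsq1 (by omega)
    have hjn : (t ^ 2) ^ j ≤ t⁻¹ * t ^ n := by
      rw [le_inv_mul_iff₀ ht0, ← pow_mul, ← pow_succ']
      exact pow_le_pow_of_le_one ht0.le ht1.le (by omega)
    have hqm : √(1 / 2) ^ m ≤ t⁻¹ * t ^ n :=
      ((pow_le_pow_left₀ (Real.sqrt_nonneg _) hq m).trans hjm).trans hjn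
    have hjn' : (j : ℝ) ≤ n := by exact_mod_cast (by omega : j ≤ n)
    calc _ = ∫ ω, |genAvg (m + j) (fun k => f (base (fun j => θ j ω) k)) - ∫ t, f t ∂τ| ∂P := by
          rw [← hm]
      _ ≤ _ := hle
      _ = _ := hadd
      _ ≤ j * (2 * M * √(1 / 2) ^ m) + l * √ρ ^ j * K := add_le_add e1 e2
      _ ≤ n * (2 * M * (t⁻¹ * t ^ n)) + l * (t⁻¹ * t ^ n) * K := by
          rw [← htsq]; gcongr
      _ = (n * (2 * M) + l * K) * (t⁻¹ * t ^ n) := by ring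
  filter_upwards [key] with ω hω
  exact tendsto_iff_norm_sub_tendsto_zero.2 hω

/-- Law of large numbers, for the recursion started from an arbitrary point. -/
theorem ae_tendsto_genAvg (h : IsIid P θ ν) (hν : InputLaw ν ρ) (hτ : IsStationary ν ρ τ)
    (hf : BddLip l M f) : ∀ᵐ ω ∂P, ∀ x, Tendsto
      (fun n => genAvg n fun k => f (base (fun j => θ j ω) k + slope (fun j => θ j ω) k * x))
      atTop (𝓝 (∫ t, f t ∂τ)) := by
  -- The null set is fixed before x: x enters only through the factor |x| in front of the mean
  -- absolute slope.
  filter_upwards [ae_tendsto_genAvg_base h hν hτ hf, ae_tendsto_genAvg_abs_slope h hν]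
    with ω h1 h2 x
  have h3 : Tendsto (fun n => l * |x| * genAvg n fun k => |slope (fun j => θ j ω) k|) atTop
      (𝓝 0) := by simpa using h2.const_mul (l * |x|)
  have h4 := squeeze_zero_norm (f := fun n =>
    (genAvg n fun k => f (base (fun j => θ j ω) k + slope (fun j => θ j ω) k * x))
      - genAvg n fun k => f (base (fun j => θ j ω) k)) (fun n => ?_) h3
  · simpa using h4.add h1
  · rw [← genAvg_sub, Real.norm_eq_abs]
    refine ((abs_genAvg_le _ _).trans (genAvg_mono
      (g := fun k => l * |x| * |slope (fun j => θ j ω) k|) fun k _ => ?_)).trans_eq ?_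
    · refine (hf.lip _ _).trans_eq ?_
      rw [add_sub_cancel_left, abs_mul]; ring
    · simp only [genAvg, ← Finset.mul_sum]; ring

end Average

/-! ### Moments of the stationary law -/

/-- Means `m`, `e`, variances `v`, `w` and absence of correlation of the inputs. -/
structure InputMoments (ν : Measure Input) (m e v w : ℕ → ℝ) : Prop where
  mean_coef : ∀ s < 2, ∫ z, coefOf s z ∂ν = m s
  mean_noise : ∀ s < 2, ∫ z, noiseOf s z ∂ν = e s
  var_coef : ∀ s < 2, ∫ z, (coefOf s z - m s) ^ 2 ∂ν = v s
  var_noise : ∀ s < 2, ∫ z, (noiseOf s z - e s) ^ 2 ∂ν = w s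
  cov : ∀ s < 2, ∫ z, (coefOf s z - m s) * (noiseOf s z - e s) ∂ν = 0
  pos : ∀ s < 2, 0 < w s

section NonDegenerate

variable {ν : Measure Input} {ρ : ℝ} {τ : Measure ℝ} {m e v w : ℕ → ℝ}

/-- Otherwise the centred variable would vanish almost surely. As coefficient and noise are
uncorrelated, its second moment is t² v + w, and w > 0. -/
lemma InputMoments.not_ae_affine_eq (hm : InputMoments ν m e v w) (hν : InputLaw ν ρ) (t : ℝ) :
    ¬ ∀ᵐ z ∂ν, coefOf 0 z * t + noiseOf 0 z = t := by
  intro hae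
  have := hν.prob
  have hc := hν.integrable_coef 0
  have hn := hν.integrable_noise 0
  have hmean : m 0 * t + e 0 = t := by
    have h1 : ∫ z, (coefOf 0 z * t + noiseOf 0 z) ∂ν = t := by
      rw [integral_congr_ae hae]; simp
    rw [integral_add (hc.mul_const t) hn, integral_mul_const, hm.mean_coef 0 two_pos,
      hm.mean_noise 0 two_pos] at h1
    exact h1
  have hc2 : MemLp (fun z => coefOf 0 z - m 0) 2 ν := (hν.memLp_two_coef 0).sub (memLp_const _)
  have hn2 : MemLp (fun z => noiseOf 0 z - e 0) 2 ν := (hν.memLp_two_noise 0).sub (memLp_const _)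
  have h0 : ∫ z, (t ^ 2 * (coefOf 0 z - m 0) ^ 2
      + 2 * t * ((coefOf 0 z - m 0) * (noiseOf 0 z - e 0)) + (noiseOf 0 z - e 0) ^ 2) ∂ν = 0 := by
    rw [integral_congr_ae (g := fun _ => (0 : ℝ)), integral_zero]
    filter_upwards [hae] with z hz
    have : (coefOf 0 z - m 0) * t + (noiseOf 0 z - e 0) = 0 := by linarith
    linear_combination ((coefOf 0 z - m 0) * t + (noiseOf 0 z - e 0)) * this
  have i1 : Integrable (fun z => t ^ 2 * (coefOf 0 z - m 0) ^ 2) ν := hc2.integrable_sq.const_mul _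
  have i2 : Integrable (fun z => 2 * t * ((coefOf 0 z - m 0) * (noiseOf 0 z - e 0))) ν :=
    (hc2.integrable_mul hn2).const_mul _
  have e1 := integral_add (i1.add i2) hn2.integrable_sq
  simp only [Pi.add_apply] at e1
  rw [e1, integral_add i1 i2, integral_const_mul, integral_const_mul, hm.var_coef 0 two_pos, hm.cov 0 two_pos, hm.var_noise 0 two_pos] at h0
  have hv : 0 ≤ v 0 := by
    rw [← hm.var_coef 0 two_pos]; exact integral_nonneg fun _ => sq_nonneg _
  have := hm.pos 0 two_pos
  nlinarith [mul_nonneg (sq_nonneg t) hv]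

/-- A stationary point mass would be a point fixed by almost every input map. The truncated distance
to t₀ detects this within the bounded Lipschitz class. -/
lemma IsStationary.not_ae_eq (hτ : IsStationary ν ρ τ) (hm : InputMoments ν m e v w)
    (hν : InputLaw ν ρ) (t₀ : ℝ) : ¬ ∀ᵐ t ∂τ, t = t₀ := by
  intro hae
  have := hτ.prob
  have := hν.prob
  have hf : BddLip 1 1 fun x => min |x - t₀| 1 := by
    refine ⟨fun x y => ?_, fun x => ?_⟩
    · rw [one_mul]
      refine (abs_min_sub_min_le_max _ _ _ _).trans (max_le ?_ (by simp))
      refine (abs_abs_sub_abs_le_abs_sub _ _).trans_eq ?_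
      rw [sub_sub_sub_cancel_right]
    · rw [abs_of_nonneg (le_min (abs_nonneg _) zero_le_one)]
      exact min_le_right _ _
  have h1 := hτ.integral_transition hν hf
  have hconst : ∀ g : ℝ → ℝ, ∫ t, g t ∂τ = g t₀ := fun g => by
    rw [integral_congr_ae (hae.mono fun t ht => by rw [ht] : g =ᵐ[τ] fun _ => g t₀)]; simp
  rw [hconst, hconst] at h1
  simp only [transition, sub_self, abs_zero] at h1
  have hnn : ∀ s, 0 ≤ ∫ z, min |coefOf s z * t₀ + noiseOf s z - t₀| 1 ∂ν := fun s =>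
    integral_nonneg fun z => le_min (abs_nonneg _) zero_le_one
  have h2 : ∫ z, min |coefOf 0 z * t₀ + noiseOf 0 z - t₀| 1 ∂ν = 0 := by
    have h3 := hnn 0
    have h4 := hnn 1
    have h5 : min (0 : ℝ) 1 = 0 := min_eq_left zero_le_one
    rw [h5] at h1
    linarith
  rw [integral_eq_zero_iff_of_nonneg (fun z => le_min (abs_nonneg _) zero_le_one)
    (hf.integrable_comp (measurable_affine 0 t₀))] at h2
  refine hm.not_ae_affine_eq hν t₀ (h2.mono fun z hz => ?_)
  have hz' : min |coefOf 0 z * t₀ + noiseOf 0 z - t₀| 1 = 0 := hz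
  rcases min_choice |coefOf 0 z * t₀ + noiseOf 0 z - t₀| 1 with h | h
  · rw [h] at hz'
    linarith [abs_eq_zero.1 hz']
  · rw [h] at hz'
    norm_num at hz'

end NonDegenerate

/-! ### The weight functions -/

/-- The components of `(1 + t²)⁻¹ (t, 1)`. -/
def wt (i : Fin 2) (t : ℝ) : ℝ := (1 + t ^ 2)⁻¹ * ![t, 1] i

/-- A bounded `C¹` function with bounded derivative. -/
structure SmoothBdd (f : ℝ → ℝ) : Prop where
  contDiff : ContDiff ℝ 1 f
  bdd : ∀ x, |f x| ≤ 1
  deriv_bdd : ∀ x, |deriv f x| ≤ 1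

lemma SmoothBdd.bddLip {f : ℝ → ℝ} (h : SmoothBdd f) : BddLip 1 1 f where
  lip x y := by
    have := Convex.norm_image_sub_le_of_norm_deriv_le (s := Set.univ)
      (fun x _ => (h.contDiff.differentiable one_ne_zero).differentiableAt)
      (fun x _ => h.deriv_bdd x) convex_univ (Set.mem_univ y) (Set.mem_univ x)
    simpa using this
  bdd := h.bdd

lemma smoothBdd_of_hasDerivAt {f f' : ℝ → ℝ} (hf : ∀ x, HasDerivAt f (f' x) x)
    (hc : Continuous f') (h1 : ∀ x, |f x| ≤ 1) (h2 : ∀ x, |f' x| ≤ 1) : SmoothBdd f where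
  contDiff := by
    have : deriv f = f' := funext fun x => (hf x).deriv
    exact contDiff_one_iff_deriv.2 ⟨fun x => (hf x).differentiableAt, by rwa [this]⟩
  bdd := h1
  deriv_bdd x := by rw [(hf x).deriv]; exact h2 x

lemma abs_div_sq_le_one {x y : ℝ} (h : |y| ≤ (1 + x ^ 2) ^ 2) : |y / (1 + x ^ 2) ^ 2| ≤ 1 := by
  have : (0 : ℝ) < (1 + x ^ 2) ^ 2 := by positivity
  rw [abs_div, abs_of_pos this, div_le_one this]
  exact h

/-- The weight 1 / (1 + t²) compensates the growth of the regressor. Bounded values control the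
score without moments of the process; bounded derivatives control its dependence on the root. -/
lemma smoothBdd_wt (i : Fin 2) : SmoothBdd (wt i) := by
  have hd : ∀ x : ℝ, HasDerivAt (fun t : ℝ => 1 + t ^ 2) (2 * x) x := fun x => by
    simpa using (hasDerivAt_pow 2 x).const_add 1
  have hne : ∀ x : ℝ, 1 + x ^ 2 ≠ 0 := fun x => by positivity
  fin_cases i
  · refine smoothBdd_of_hasDerivAt (f' := fun x => (1 - x ^ 2) / (1 + x ^ 2) ^ 2) (fun x => ?_)
      (by fun_prop (disch := intro x; positivity)) (fun x => ?_) fun x => ?_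
    · have := ((hd x).inv (hne x)).mul (hasDerivAt_id x)
      refine this.congr_deriv ?_
      have := hne x
      simp
      field_simp
      ring
    · have h0 : (0 : ℝ) < 1 + x ^ 2 := by positivity
      simp only [wt, Fin.zero_eta, Matrix.cons_val_zero]
      rw [abs_mul, abs_of_pos (inv_pos.2 h0), inv_mul_le_iff₀ h0, mul_one]
      rw [abs_le]; constructor <;> nlinarith [sq_nonneg (x - 1), sq_nonneg (x + 1)]
    · refine abs_div_sq_le_one ?_
      rw [abs_le]; constructor <;> nlinarith [sq_nonneg x, sq_nonneg (x ^ 2)]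
  · refine smoothBdd_of_hasDerivAt (f' := fun x => -(2 * x) / (1 + x ^ 2) ^ 2) (fun x => ?_)
      (by fun_prop (disch := intro x; positivity)) (fun x => ?_) fun x => ?_
    · have := (hd x).inv (hne x)
      have hw : wt 1 = (fun t => 1 + t ^ 2)⁻¹ := by
        funext t
        simp [wt]
      change HasDerivAt (wt 1) _ x
      rw [hw]
      exact this
    · have h0 : (0 : ℝ) < 1 + x ^ 2 := by positivity
      simp only [wt, Fin.mk_one, Matrix.cons_val_one, Matrix.cons_val_fin_one, mul_one]
      rw [abs_of_pos (inv_pos.2 h0)]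
      exact inv_le_one_of_one_le₀ (by nlinarith [sq_nonneg x])
    · refine abs_div_sq_le_one ?_
      rw [abs_le]; constructor <;>
        nlinarith [sq_nonneg (x - 1), sq_nonneg (x + 1), sq_nonneg (x ^ 2), sq_nonneg x]

lemma mul_wt_zero : (fun t => t * wt 0 t) = fun t => 1 - wt 1 t := by
  funext t
  have : (1 + t ^ 2 : ℝ) ≠ 0 := by positivity
  simp [wt]
  field_simp
  ring

lemma mul_wt_one : (fun t => t * wt 1 t) = wt 0 := by
  funext t
  simp [wt]
  ring

lemma smoothBdd_mul_wt (i : Fin 2) : SmoothBdd fun t => t * wt i t := by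
  fin_cases i
  · have h := smoothBdd_wt 1
    have h1 : ∀ x, wt 1 x = (1 + x ^ 2)⁻¹ := fun x => by simp [wt]
    change SmoothBdd fun t => t * wt 0 t
    rw [mul_wt_zero]
    refine smoothBdd_of_hasDerivAt (f' := fun x => -deriv (wt 1) x)
      (fun x => ((h.contDiff.differentiable one_ne_zero).differentiableAt.hasDerivAt).const_sub 1)
      (h.contDiff.continuous_deriv le_rfl).neg (fun x => ?_) fun x => by
        rw [abs_neg]; exact h.deriv_bdd x
    have h2 := abs_le.1 (h.bdd x)
    have h3 : 0 ≤ wt 1 x := by rw [h1]; positivity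
    rw [abs_le]; constructor <;> linarith
  · change SmoothBdd fun t => t * wt 1 t
    rw [mul_wt_one]; exact smoothBdd_wt 0

/-! ### Cesàro means of products -/

lemma exists_sum_range_le_mul {v : ℕ → ℝ} {l : ℝ}
    (h : Tendsto (fun N : ℕ => (N : ℝ)⁻¹ * ∑ n ∈ Finset.range N, v n) atTop (𝓝 l)) :
    ∃ K, ∀ N : ℕ, ∑ n ∈ Finset.range N, v n ≤ K * N := by
  obtain ⟨K, hK⟩ := h.bddAbove_range
  refine ⟨K, fun N => ?_⟩
  rcases Nat.eq_zero_or_pos N with rfl | hN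
  · simp
  · have hN' : (0 : ℝ) < N := by exact_mod_cast hN
    have := hK ⟨N, rfl⟩
    rwa [inv_mul_le_iff₀ hN', mul_comm] at this

/-- Write o A = (o A / (1 + A²)) (1 + A²): the first factor tends to 0 and the second has bounded
averages. -/
lemma tendsto_average_mul_of_tendsto_zero {o A : ℕ → ℝ} {α : ℝ} (ho : Tendsto o atTop (𝓝 0))
    (hA : Tendsto (fun N : ℕ => (N : ℝ)⁻¹ * ∑ n ∈ Finset.range N, A n ^ 2) atTop (𝓝 α)) :
    Tendsto (fun N : ℕ => (N : ℝ)⁻¹ * ∑ n ∈ Finset.range N, o n * A n) atTop (𝓝 0) := by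
  obtain ⟨K, hK⟩ := exists_sum_range_le_mul hA
  have hg : Tendsto (fun n => o n * (A n / (1 + A n ^ 2))) atTop (𝓝 0) := by
    refine squeeze_zero_norm (fun n => ?_) (by simpa using ho.abs)
    have h0 : (0 : ℝ) < 1 + A n ^ 2 := by positivity
    rw [norm_mul, Real.norm_eq_abs, Real.norm_eq_abs]
    refine mul_le_of_le_one_right (abs_nonneg _) ?_
    rw [abs_div, abs_of_pos h0, div_le_one h0, abs_le]
    constructor <;> nlinarith [sq_nonneg (A n - 1), sq_nonneg (A n + 1)]
  refine (tendsto_average_of_tendsto_zero (v := fun n => 1 + A n ^ 2) hg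
    (fun n => by positivity) (K := 1 + K) fun N => ?_).congr fun N => ?_
  · rw [Finset.sum_add_distrib, add_mul]
    exact add_le_add (by simp) (hK N)
  · congr 1
    refine Finset.sum_congr rfl fun n _ => ?_
    have : 1 + A n ^ 2 ≠ 0 := by positivity
    field_simp

lemma tendsto_average_mul_of_sub_tendsto_zero {A B A' B' : ℕ → ℝ} {α β γ : ℝ}
    (hA' : Tendsto (fun n => A' n - A n) atTop (𝓝 0))
    (hB' : Tendsto (fun n => B' n - B n) atTop (𝓝 0))
    (hA : Tendsto (fun N : ℕ => (N : ℝ)⁻¹ * ∑ n ∈ Finset.range N, A n ^ 2) atTop (𝓝 α))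
    (hB : Tendsto (fun N : ℕ => (N : ℝ)⁻¹ * ∑ n ∈ Finset.range N, B n ^ 2) atTop (𝓝 β))
    (hAB : Tendsto (fun N : ℕ => (N : ℝ)⁻¹ * ∑ n ∈ Finset.range N, A n * B n) atTop (𝓝 γ)) :
    Tendsto (fun N : ℕ => (N : ℝ)⁻¹ * ∑ n ∈ Finset.range N, A' n * B' n) atTop (𝓝 γ) := by
  have h1 := tendsto_average_mul_of_tendsto_zero hA' hB
  have h2 := tendsto_average_mul_of_tendsto_zero hB' hA
  have h3 : Tendsto (fun N : ℕ => (N : ℝ)⁻¹ * ∑ n ∈ Finset.range N,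
      (A' n - A n) * (B' n - B n)) atTop (𝓝 0) := by
    have := (hA'.mul hB').cesaro
    simpa using this
  have := ((hAB.add h1).add h2).add h3
  simp only [add_zero] at this
  refine this.congr fun N => ?_
  rw [← mul_add, ← mul_add, ← mul_add, ← Finset.sum_add_distrib, ← Finset.sum_add_distrib,
    ← Finset.sum_add_distrib]
  congr 1
  exact Finset.sum_congr rfl fun n _ => by ring

lemma tendsto_treeAvg_of_genAvg {F : ℕ → ℝ} {l : ℝ}
    (h : Tendsto (fun n => genAvg n F) atTop (𝓝 l)) :
    Tendsto (fun n : ℕ => ((2 : ℝ) ^ n)⁻¹ * ∑ k ∈ Finset.Ico 1 (2 ^ n), F k) atTop (𝓝 l) := by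
  refine (tendsto_geometric_average h).congr fun n => ?_
  rw [sum_Ico_eq_sum_gen]
  congr 1
  refine Finset.sum_congr rfl fun j _ => ?_
  rw [genAvg, mul_inv_cancel_left₀ (by positivity)]

/-- The square of indices splits into its diagonal and two strict triangles. In each triangle the
later increment multiplies a sum over the past, which is a martingale transform. -/
lemma sum_mul_sum_Ico (f g : ℕ → ℝ) {n : ℕ} (hn : 1 ≤ n) :
    (∑ k ∈ Finset.Ico 1 n, f k) * ∑ k ∈ Finset.Ico 1 n, g k
      = ∑ k ∈ Finset.Ico 1 n, f k * g k
        + ∑ k ∈ Finset.Ico 1 n, (∑ j ∈ Finset.Ico 1 k, f j) * g k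
        + ∑ k ∈ Finset.Ico 1 n, (∑ j ∈ Finset.Ico 1 k, g j) * f k := by
  induction n, hn using Nat.le_induction with
  | base => simp
  | succ n hn ih =>
    simp only [Finset.sum_Ico_succ_top hn]
    linear_combination ih

/-! ### The score martingale -/

/-- The increment of the score at an individual with value `t` and inputs `z`. -/
def scoreIncr (m e : ℕ → ℝ) (s : ℕ) (i : Fin 2) (t : ℝ) (z : Input) : ℝ :=
  t * wt i t * (coefOf s z - m s) + wt i t * (noiseOf s z - e s)

/-- The score of the trajectory started at `x`, over the individuals `1, …, n - 1`. -/
def score (m e : ℕ → ℝ) (s : ℕ) (i : Fin 2) (z : ℕ → Input) (x : ℝ) (n : ℕ) : ℝ :=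
  ∑ k ∈ Finset.Ico 1 n, scoreIncr m e s i (base z k + slope z k * x) (z k)

/-- Fourth moments of the inputs make products of two centred inputs square integrable, as the
martingale averages on the diagonal require. -/
lemma memLp_mul_of_four {α : Type*} [MeasurableSpace α] {μ : Measure α} {f g : α → ℝ}
    (hf : MemLp f 4 μ) (hg : MemLp g 4 μ) : MemLp (fun x => f x * g x) 2 μ := by
  have : ENNReal.HolderTriple 4 4 2 := ⟨by
    rw [← ENNReal.toReal_eq_toReal_iff' (by simp) (by simp), ENNReal.toReal_add (by simp) (by simp)]
    norm_num⟩
  exact hg.mul hf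

section Score

variable {Ω : Type*} [MeasurableSpace Ω] {P : Measure Ω} [IsProbabilityMeasure P]
  {θ : ℕ → Ω → Input} {ν : Measure Input} {ρ l M : ℝ} {f : ℝ → ℝ} {τ : Measure ℝ}
  {m e v w : ℕ → ℝ} {s : ℕ}

lemma measurable_coef_sub (s : ℕ) (c : ℝ) : Measurable fun z => coefOf s z - c :=
  (measurable_coefOf s).sub_const c

lemma measurable_noise_sub (s : ℕ) (c : ℝ) : Measurable fun z => noiseOf s z - c :=
  (measurable_noiseOf s).sub_const c

lemma InputLaw.memLp_coef_sub (hν : InputLaw ν ρ) (s : ℕ) (c : ℝ) :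
    MemLp (fun z => coefOf s z - c) 4 ν :=
  have := hν.prob
  (hν.memLp_coef s).sub (memLp_const c)

lemma InputLaw.memLp_noise_sub (hν : InputLaw ν ρ) (s : ℕ) (c : ℝ) :
    MemLp (fun z => noiseOf s z - c) 4 ν :=
  have := hν.prob
  (hν.memLp_noise s).sub (memLp_const c)

lemma InputLaw.memLp_two_coef_sub (hν : InputLaw ν ρ) (s : ℕ) (c : ℝ) :
    MemLp (fun z => coefOf s z - c) 2 ν :=
  have := hν.prob
  (hν.memLp_two_coef s).sub (memLp_const c)

lemma InputLaw.memLp_two_noise_sub (hν : InputLaw ν ρ) (s : ℕ) (c : ℝ) :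
    MemLp (fun z => noiseOf s z - c) 2 ν :=
  have := hν.prob
  (hν.memLp_two_noise s).sub (memLp_const c)

lemma InputMoments.integral_coef_sub (hm : InputMoments ν m e v w) (hν : InputLaw ν ρ)
    (hs : s < 2) : ∫ z, (coefOf s z - m s) ∂ν = 0 := by
  have := hν.prob
  rw [integral_sub (hν.integrable_coef s) (integrable_const _), hm.mean_coef s hs]
  simp

lemma InputMoments.integral_noise_sub (hm : InputMoments ν m e v w) (hν : InputLaw ν ρ)
    (hs : s < 2) : ∫ z, (noiseOf s z - e s) ∂ν = 0 := by
  have := hν.prob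
  rw [integral_sub (hν.integrable_noise s) (integrable_const _), hm.mean_noise s hs]
  simp

lemma InputMoments.var_nonneg (hm : InputMoments ν m e v w) (hs : s < 2) : 0 ≤ v s := by
  rw [← hm.var_coef s hs]; exact integral_nonneg fun _ => sq_nonneg _

omit [IsProbabilityMeasure P] in
/-- The second moment of a martingale driven by both the centred coefficients and the centred
noise. -/
lemma integral_sq_sum_two_le (h : IsIid P θ ν) (hν : InputLaw ν ρ) (hm : InputMoments ν m e v w)
    (hs : s < 2) {a b : ℕ → Ω → ℝ} {I : Finset ℕ} (hI : ∀ k ∈ I, 1 ≤ k)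
    (ha : ∀ k ∈ I, MemLp (a k) 2 P) (ham : ∀ k ∈ I, Measurable[past θ k] (a k))
    (hb : ∀ k ∈ I, MemLp (b k) 2 P) (hbm : ∀ k ∈ I, Measurable[past θ k] (b k)) {c : ℕ → ℝ}
    (hac : ∀ k ∈ I, ∫ ω, a k ω ^ 2 ∂P ≤ c k) (hbc : ∀ k ∈ I, ∫ ω, b k ω ^ 2 ∂P ≤ c k) :
    MemLp (fun ω => ∑ k ∈ I, (a k ω * (coefOf s (θ k ω) - m s)
      + b k ω * (noiseOf s (θ k ω) - e s))) 2 P ∧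
    ∫ ω, (∑ k ∈ I, (a k ω * (coefOf s (θ k ω) - m s)
      + b k ω * (noiseOf s (θ k ω) - e s))) ^ 2 ∂P ≤ 2 * (v s + w s) * ∑ k ∈ I, c k := by
  have h1 := h.memLp_sum_mul hI ha ham (measurable_coef_sub s (m s))
    (hν.memLp_two_coef_sub s (m s))
  have h2 := h.memLp_sum_mul hI hb hbm (measurable_noise_sub s (e s))
    (hν.memLp_two_noise_sub s (e s))
  have e1 := h.integral_sq_sum_mul hI ha ham (measurable_coef_sub s (m s))
    (hν.memLp_two_coef_sub s (m s)) (hm.integral_coef_sub hν hs)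
  have e2 := h.integral_sq_sum_mul hI hb hbm (measurable_noise_sub s (e s))
    (hν.memLp_two_noise_sub s (e s)) (hm.integral_noise_sub hν hs)
  rw [hm.var_coef s hs] at e1
  rw [hm.var_noise s hs] at e2
  simp only [Finset.sum_add_distrib]
  refine ⟨h1.add h2, ?_⟩
  have hle := integral_mono (h1.add h2).integrable_sq
    ((h1.integrable_sq.const_mul 2).add (h2.integrable_sq.const_mul 2)) fun ω => by
      simp only [Pi.add_apply]
      exact (add_sq_le).trans_eq (mul_add _ _ _)
  refine hle.trans ?_
  have e3 := integral_add (h1.integrable_sq.const_mul 2) (h2.integrable_sq.const_mul 2)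
  simp only [integral_const_mul] at e3
  refine e3.trans_le ?_
  rw [e1, e2]
  have hv := hm.var_nonneg hs
  have hw := (hm.pos s hs).le
  have f1 := mul_le_mul_of_nonneg_left (Finset.sum_le_sum hac) hv
  have f2 := mul_le_mul_of_nonneg_left (Finset.sum_le_sum hbc) hw
  linarith

omit [MeasurableSpace Ω] in
lemma measurable_comp_base (θ : ℕ → Ω → Input) (hf : Measurable f) {k : ℕ} (hk : 1 ≤ k) :
    Measurable[past θ k] fun ω => f (base (fun j => θ j ω) k) :=
  hf.comp (measurable_base θ k hk)

omit [MeasurableSpace Ω] in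
lemma measurable_comp_traj (θ : ℕ → Ω → Input) (hf : Measurable f) {k : ℕ} (hk : 1 ≤ k) (x : ℝ) :
    Measurable[past θ k] fun ω => f (base (fun j => θ j ω) k + slope (fun j => θ j ω) k * x) :=
  hf.comp ((measurable_base θ k hk).add ((measurable_slope θ k hk).mul_const x))

omit [MeasurableSpace Ω] in
lemma measurable_score (θ : ℕ → Ω → Input) (m e : ℕ → ℝ) (s : ℕ) (i : Fin 2) (x : ℝ) (n : ℕ) :
    Measurable[past θ n] fun ω => score m e s i (fun j => θ j ω) x n := by
  refine Finset.measurable_fun_sum _ fun k hk => ?_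
  obtain ⟨hk1, hkn⟩ := Finset.mem_Ico.1 hk
  have h1 := (measurable_comp_traj θ (smoothBdd_mul_wt i).bddLip.measurable hk1 x).mono
    (past_mono θ hkn.le) le_rfl
  have h2 := (measurable_comp_traj θ (smoothBdd_wt i).bddLip.measurable hk1 x).mono
    (past_mono θ hkn.le) le_rfl
  have h3 := measurable_past θ hk1 hkn
  exact (h1.mul ((measurable_coef_sub s (m s)).comp h3)).add
    (h2.mul ((measurable_noise_sub s (e s)).comp h3))

lemma memLp_two_of_abs_le_one {k : ℕ} (h : IsIid P θ ν) {u : Ω → ℝ}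
    (hu : Measurable[past θ k] u) (hb : ∀ ω, |u ω| ≤ 1) : MemLp u 2 P ∧ ∫ ω, u ω ^ 2 ∂P ≤ 1 := by
  have h2 : MemLp u 2 P := MemLp.of_bound (hu.mono (h.past_le k) le_rfl).aestronglyMeasurable 1
    (Eventually.of_forall hb)
  refine ⟨h2, (integral_mono h2.integrable_sq (integrable_const 1) fun ω => ?_).trans_eq (by simp)⟩
  exact sq_le_one_iff_abs_le_one _ |>.2 (hb ω)

lemma score_memLp_and_sq_le (h : IsIid P θ ν) (hν : InputLaw ν ρ) (hm : InputMoments ν m e v w)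
    (hs : s < 2) (i : Fin 2) (x : ℝ) (n : ℕ) :
    MemLp (fun ω => score m e s i (fun j => θ j ω) x n) 2 P ∧
      ∫ ω, score m e s i (fun j => θ j ω) x n ^ 2 ∂P ≤ 2 * (v s + w s) * n := by
  have hg : ∀ k ∈ Finset.Ico 1 n, _ := fun k hk => memLp_two_of_abs_le_one h
    (measurable_comp_traj θ (smoothBdd_mul_wt i).bddLip.measurable (Finset.mem_Ico.1 hk).1 x)
    fun ω => (smoothBdd_mul_wt i).bdd _
  have hp : ∀ k ∈ Finset.Ico 1 n, _ := fun k hk => memLp_two_of_abs_le_one h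
    (measurable_comp_traj θ (smoothBdd_wt i).bddLip.measurable (Finset.mem_Ico.1 hk).1 x)
    fun ω => (smoothBdd_wt i).bdd _
  have key := integral_sq_sum_two_le h hν hm hs (I := Finset.Ico 1 n) (c := fun _ => 1)
    (fun k hk => (Finset.mem_Ico.1 hk).1) (fun k hk => (hg k hk).1)
    (fun k hk => measurable_comp_traj θ (smoothBdd_mul_wt i).bddLip.measurable
      (Finset.mem_Ico.1 hk).1 x)
    (fun k hk => (hp k hk).1)
    (fun k hk => measurable_comp_traj θ (smoothBdd_wt i).bddLip.measurable
      (Finset.mem_Ico.1 hk).1 x) (fun k hk => (hg k hk).2) (fun k hk => (hp k hk).2)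
  refine ⟨key.1, key.2.trans (mul_le_mul_of_nonneg_left ?_ ?_)⟩
  · simp only [Finset.sum_const, Nat.card_Ico, nsmul_eq_mul, mul_one]
    exact_mod_cast Nat.sub_le _ _
  · linarith [hm.var_nonneg hs, hm.pos s hs]

/-- The score before k is known from the past and has second moment of order k. Multiplied by a
bounded weight, it is a coefficient to which the Cesàro lemma applies, separately for the
coefficient part and the noise part. -/
lemma ae_tendsto_offDiag (h : IsIid P θ ν) (hν : InputLaw ν ρ) (hm : InputMoments ν m e v w)
    (hs : s < 2) (i i' : Fin 2) : ∀ᵐ ω ∂P, Tendsto (fun N : ℕ => (N : ℝ)⁻¹ *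
      ∑ n ∈ Finset.range N, ((2 : ℝ) ^ n)⁻¹ * ∑ k ∈ Finset.Ico 1 (2 ^ n),
        score m e s i (fun j => θ j ω) 0 k *
          scoreIncr m e s i' (base (fun j => θ j ω) k) (θ k ω)) atTop (𝓝 0) := by
  have hu : ∀ f : ℝ → ℝ, SmoothBdd f → ∀ k, 1 ≤ k →
      Measurable[past θ k] (fun ω => score m e s i (fun j => θ j ω) 0 k
        * f (base (fun j => θ j ω) k)) ∧
      MemLp (fun ω => score m e s i (fun j => θ j ω) 0 k * f (base (fun j => θ j ω) k)) 2 P ∧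
      ∫ ω, (score m e s i (fun j => θ j ω) 0 k * f (base (fun j => θ j ω) k)) ^ 2 ∂P
        ≤ 2 * (v s + w s) * k := by
    intro f hf k hk
    obtain ⟨h1, h2⟩ := score_memLp_and_sq_le h hν hm hs i 0 k
    have hmeas : Measurable[past θ k] (fun ω => score m e s i (fun j => θ j ω) 0 k
        * f (base (fun j => θ j ω) k)) :=
      (measurable_score θ m e s i 0 k).mul (measurable_comp_base θ hf.bddLip.measurable hk)
    have hle : ∀ ω, |score m e s i (fun j => θ j ω) 0 k * f (base (fun j => θ j ω) k)|
        ≤ |score m e s i (fun j => θ j ω) 0 k| := fun ω => by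
      rw [abs_mul]
      exact mul_le_of_le_one_right (abs_nonneg _) (hf.bdd _)
    have hL : MemLp (fun ω => score m e s i (fun j => θ j ω) 0 k
        * f (base (fun j => θ j ω) k)) 2 P :=
      h1.mono (hmeas.mono (h.past_le k) le_rfl).aestronglyMeasurable (Eventually.of_forall hle)
    exact ⟨hmeas, hL, (integral_mono hL.integrable_sq h1.integrable_sq
      fun ω => sq_le_sq.2 (hle ω)).trans h2⟩
  have hg := hu _ (smoothBdd_mul_wt i')
  have hp := hu _ (smoothBdd_wt i')
  filter_upwards [h.ae_tendsto_cesaro_mul (fun k hk => (hg k hk).1) (fun k hk => (hg k hk).2.1)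
      (fun k hk => (hg k hk).2.2) (measurable_coef_sub s (m s)) (hν.memLp_two_coef_sub s (m s))
      (hm.integral_coef_sub hν hs),
    h.ae_tendsto_cesaro_mul (fun k hk => (hp k hk).1) (fun k hk => (hp k hk).2.1)
      (fun k hk => (hp k hk).2.2) (measurable_noise_sub s (e s)) (hν.memLp_two_noise_sub s (e s))
      (hm.integral_noise_sub hν hs)] with ω h1 h2
  have := h1.add h2
  rw [add_zero] at this
  refine this.congr fun N => ?_
  rw [← mul_add, ← Finset.sum_add_distrib]
  congr 1
  refine Finset.sum_congr rfl fun n _ => ?_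
  rw [← mul_add, ← Finset.sum_add_distrib]
  congr 1
  exact Finset.sum_congr rfl fun k _ => by simp only [scoreIncr]; ring

/-- Each product of increments is its conditional mean plus bounded weights times centred functions
of the fresh input. The latter average out, and the conditional means follow the law of large
numbers; the mixed terms have mean zero. -/
lemma ae_tendsto_diag (h : IsIid P θ ν) (hν : InputLaw ν ρ) (hm : InputMoments ν m e v w)
    (hτ : IsStationary ν ρ τ) (hs : s < 2) (i i' : Fin 2) :
    ∀ᵐ ω ∂P, Tendsto (fun n : ℕ => ((2 : ℝ) ^ n)⁻¹ * ∑ k ∈ Finset.Ico 1 (2 ^ n),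
        scoreIncr m e s i (base (fun j => θ j ω) k) (θ k ω) *
          scoreIncr m e s i' (base (fun j => θ j ω) k) (θ k ω)) atTop
      (𝓝 (v s * ∫ t, (t * wt i t) * (t * wt i' t) ∂τ + w s * ∫ t, wt i t * wt i' t ∂τ)) := by
  have := hν.prob
  have hgg := (smoothBdd_mul_wt i).bddLip.mul (smoothBdd_mul_wt i').bddLip
  have hpp := (smoothBdd_wt i).bddLip.mul (smoothBdd_wt i').bddLip
  have hgp := (smoothBdd_mul_wt i).bddLip.mul (smoothBdd_wt i').bddLip
  have hpg := (smoothBdd_wt i).bddLip.mul (smoothBdd_mul_wt i').bddLip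
  have c1 := measurable_coef_sub s (m s)
  have c2 := measurable_noise_sub s (e s)
  have l1 := hν.memLp_coef_sub s (m s)
  have l2 := hν.memLp_noise_sub s (e s)
  have hψ1 : MemLp (fun z => (coefOf s z - m s) ^ 2 - v s) 2 ν := by
    simpa only [sq] using! (memLp_mul_of_four l1 l1).sub (memLp_const (v s))
  have hψ3 : MemLp (fun z => (noiseOf s z - e s) ^ 2 - w s) 2 ν := by
    simpa only [sq] using! (memLp_mul_of_four l2 l2).sub (memLp_const (w s))
  have hψ2 := memLp_mul_of_four l1 l2
  have z1 : ∫ z, ((coefOf s z - m s) ^ 2 - v s) ∂ν = 0 := by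
    rw [integral_sub (hν.memLp_two_coef_sub s (m s)).integrable_sq (integrable_const _),
      hm.var_coef s hs]; simp
  have z3 : ∫ z, ((noiseOf s z - e s) ^ 2 - w s) ∂ν = 0 := by
    rw [integral_sub (hν.memLp_two_noise_sub s (e s)).integrable_sq (integrable_const _),
      hm.var_noise s hs]; simp
  have avg : ∀ (f : ℝ → ℝ) (l' M' : ℝ), BddLip l' M' f → ∀ ψ : Input → ℝ, Measurable ψ →
      MemLp ψ 2 ν → ∫ z, ψ z ∂ν = 0 → ∀ᵐ ω ∂P, Tendsto (fun n : ℕ => ((2 : ℝ) ^ n)⁻¹ *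
        ∑ k ∈ Finset.Ico 1 (2 ^ n), f (base (fun j => θ j ω) k) * ψ (θ k ω)) atTop (𝓝 0) :=
    fun f l' M' hf ψ hψ hψ2 hψ0 => h.ae_tendsto_average_mul
      (fun k hk => measurable_comp_base θ hf.measurable hk) (fun k ω => hf.bdd _) hψ hψ2 hψ0
  filter_upwards [avg _ _ _ hgg _ ((c1.pow_const 2).sub_const (v s)) hψ1 z1,
    avg _ _ _ hgp _ (c1.mul c2) hψ2 (hm.cov s hs), avg _ _ _ hpg _ (c1.mul c2) hψ2 (hm.cov s hs),
    avg _ _ _ hpp _ ((c2.pow_const 2).sub_const (w s)) hψ3 z3,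
    ae_tendsto_genAvg_base h hν hτ hgg, ae_tendsto_genAvg_base h hν hτ hpp]
    with ω h1 h2 h3 h4 h5 h6
  have h5' := (tendsto_treeAvg_of_genAvg h5).const_mul (v s)
  have h6' := (tendsto_treeAvg_of_genAvg h6).const_mul (w s)
  have := ((((h1.add h2).add h3).add h4).add h5').add h6'
  simp only [zero_add] at this
  refine this.congr fun n => ?_
  rw [mul_left_comm (v s), mul_left_comm (w s), ← mul_add, ← mul_add, ← mul_add, ← mul_add,
    ← mul_add]
  congr 1
  rw [Finset.mul_sum, Finset.mul_sum, ← Finset.sum_add_distrib, ← Finset.sum_add_distrib,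
    ← Finset.sum_add_distrib, ← Finset.sum_add_distrib, ← Finset.sum_add_distrib]
  exact Finset.sum_congr rfl fun k _ => by simp only [scoreIncr, Pi.mul_apply]; ring

/-- The quadratic strong law for the score of the recursion started at `0`. -/
lemma ae_tendsto_score_zero (h : IsIid P θ ν) (hν : InputLaw ν ρ) (hm : InputMoments ν m e v w)
    (hτ : IsStationary ν ρ τ) (hs : s < 2) (i i' : Fin 2) :
    ∀ᵐ ω ∂P, Tendsto (fun N : ℕ => (N : ℝ)⁻¹ * ∑ n ∈ Finset.range N,
      (((√2) ^ n)⁻¹ * score m e s i (fun j => θ j ω) 0 (2 ^ n)) *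
        (((√2) ^ n)⁻¹ * score m e s i' (fun j => θ j ω) 0 (2 ^ n))) atTop
      (𝓝 (v s * ∫ t, (t * wt i t) * (t * wt i' t) ∂τ + w s * ∫ t, wt i t * wt i' t ∂τ)) := by
  filter_upwards [ae_tendsto_diag h hν hm hτ hs i i', ae_tendsto_offDiag h hν hm hs i i',
    ae_tendsto_offDiag h hν hm hs i' i] with ω h1 h2 h3
  have := (h1.cesaro.add h2).add h3
  simp only [add_zero] at this
  refine this.congr fun N => ?_
  rw [← mul_add, ← mul_add, ← Finset.sum_add_distrib, ← Finset.sum_add_distrib]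
  congr 1
  refine Finset.sum_congr rfl fun n _ => ?_
  have hsq : ((√2) ^ n)⁻¹ * ((√2) ^ n)⁻¹ = ((2 : ℝ) ^ n)⁻¹ := by
    rw [← mul_inv, ← mul_pow, Real.mul_self_sqrt (by norm_num)]
  rw [mul_mul_mul_comm, hsq, ← mul_add, ← mul_add]
  congr 1
  simp only [score, mul_zero, add_zero]
  exact (sum_mul_sum_Ico _ _ Nat.one_le_two_pow).symm

end Score

/-! ### Dependence of the score on the starting point -/

/-- The derivative of the score with respect to the starting point. -/
def scoreDeriv (m e : ℕ → ℝ) (s : ℕ) (i : Fin 2) (z : ℕ → Input) (x : ℝ) (n : ℕ) : ℝ :=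
  ∑ k ∈ Finset.Ico 1 n,
    (slope z k * deriv (fun t => t * wt i t) (base z k + slope z k * x) * (coefOf s (z k) - m s)
      + slope z k * deriv (wt i) (base z k + slope z k * x) * (noiseOf s (z k) - e s))

lemma SmoothBdd.hasDerivAt {f : ℝ → ℝ} (h : SmoothBdd f) (x : ℝ) : HasDerivAt f (deriv f x) x :=
  (h.contDiff.differentiable one_ne_zero).differentiableAt.hasDerivAt

lemma SmoothBdd.continuous_deriv {f : ℝ → ℝ} (h : SmoothBdd f) : Continuous (deriv f) :=
  h.contDiff.continuous_deriv le_rfl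

lemma hasDerivAt_score (m e : ℕ → ℝ) (s : ℕ) (i : Fin 2) (z : ℕ → Input) (n : ℕ) (x : ℝ) :
    HasDerivAt (fun x => score m e s i z x n) (scoreDeriv m e s i z x n) x := by
  refine HasDerivAt.fun_sum fun k _ => ?_
  have hlin : HasDerivAt (fun x => base z k + slope z k * x) (slope z k) x := by
    simpa using ((hasDerivAt_id x).const_mul (slope z k)).const_add (base z k)
  have h1 := (((smoothBdd_mul_wt i).hasDerivAt (base z k + slope z k * x)).comp x hlin).mul_const
    (coefOf s (z k) - m s)
  have h2 := (((smoothBdd_wt i).hasDerivAt (base z k + slope z k * x)).comp x hlin).mul_const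
    (noiseOf s (z k) - e s)
  exact (h1.add h2).congr_deriv (by ring)

lemma continuous_scoreDeriv (m e : ℕ → ℝ) (s : ℕ) (i : Fin 2) (z : ℕ → Input) (n : ℕ) :
    Continuous fun x => scoreDeriv m e s i z x n := by
  have h1 := (smoothBdd_mul_wt i).continuous_deriv
  have h2 := (smoothBdd_wt i).continuous_deriv
  unfold scoreDeriv
  fun_prop

/-- The fundamental theorem of calculus gives a bound uniform over |x| ≤ K, as needed to insert a
random root. Stated in [0, ∞], it is ready for Tonelli. -/
lemma abs_score_sub_le (m e : ℕ → ℝ) (s : ℕ) (i : Fin 2) (z : ℕ → Input) (n : ℕ) {x K : ℝ}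
    (hx : |x| ≤ K) : ENNReal.ofReal |score m e s i z x n - score m e s i z 0 n|
      ≤ ∫⁻ t in Set.Icc (-K) K, ENNReal.ofReal |scoreDeriv m e s i z t n| := by
  have hc := continuous_scoreDeriv m e s i z n
  rw [← intervalIntegral.integral_eq_sub_of_hasDerivAt
    (fun t _ => hasDerivAt_score m e s i z n t) (hc.intervalIntegrable 0 x)]
  have h1 := intervalIntegral.norm_integral_le_integral_norm_uIoc (a := 0) (b := x)
    (f := fun t => scoreDeriv m e s i z t n) (μ := volume)
  have hsub : Set.uIoc 0 x ⊆ Set.Icc (-K) K := fun t ht => by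
    have hx' := abs_le.1 hx
    rcases Set.mem_uIoc.1 ht with h | h
    · exact ⟨by linarith [h.1], h.2.trans hx'.2⟩
    · exact ⟨by linarith [h.1], by linarith [h.2]⟩
  have hint : IntegrableOn (fun t => ‖scoreDeriv m e s i z t n‖) (Set.Icc (-K) K) :=
    hc.norm.continuousOn.integrableOn_Icc
  change _ ≤ ∫⁻ t in Set.Icc (-K) K, ENNReal.ofReal ‖scoreDeriv m e s i z t n‖
  rw [← ofReal_integral_eq_lintegral_ofReal hint (Eventually.of_forall fun t => norm_nonneg _)]
  exact ENNReal.ofReal_le_ofReal (h1.trans (setIntegral_mono_set hint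
    (Eventually.of_forall fun t => norm_nonneg _) hsub.eventuallyLE))

lemma sum_Ico_slope_bound_le {ρ : ℝ} (hρ : 3 / 4 ≤ ρ) (n : ℕ) :
    ∑ j ∈ Finset.range n, (2 : ℝ) ^ j * ρ ^ j ≤ 2 * (2 ^ n * ρ ^ n) := by
  simp only [← mul_pow]
  rw [geom_sum_eq (by linarith), div_le_iff₀ (by linarith)]
  have : 0 ≤ (2 * ρ) ^ n := by positivity
  nlinarith

section Transfer

variable {Ω : Type*} [MeasurableSpace Ω] {P : Measure Ω} [IsProbabilityMeasure P]
  {θ : ℕ → Ω → Input} {ν : Measure Input} {ρ : ℝ} {τ : Measure ℝ}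
  {m e v w : ℕ → ℝ} {s : ℕ}

omit [IsProbabilityMeasure P] in
lemma measurable_scoreDeriv (h : IsIid P θ ν) (m e : ℕ → ℝ) (s : ℕ) (i : Fin 2) (n : ℕ) :
    Measurable fun p : ℝ × Ω => scoreDeriv m e s i (fun j => θ j p.2) p.1 n := by
  refine Finset.measurable_fun_sum _ fun k hk => ?_
  have hk1 := (Finset.mem_Ico.1 hk).1
  have hs : Measurable fun p : ℝ × Ω => slope (fun j => θ j p.2) k :=
    ((measurable_slope θ k hk1).mono (h.past_le k) le_rfl).comp measurable_snd
  have hb : Measurable fun p : ℝ × Ω => base (fun j => θ j p.2) k :=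
    ((measurable_base θ k hk1).mono (h.past_le k) le_rfl).comp measurable_snd
  have hθ : Measurable fun p : ℝ × Ω => θ k p.2 := (h.measurable k hk1).comp measurable_snd
  have ht : Measurable fun p : ℝ × Ω =>
      base (fun j => θ j p.2) k + slope (fun j => θ j p.2) k * p.1 := hb.add (hs.mul measurable_fst)
  exact ((hs.mul ((smoothBdd_mul_wt i).continuous_deriv.measurable.comp ht)).mul
    ((measurable_coef_sub s (m s)).comp hθ)).add
    ((hs.mul ((smoothBdd_wt i).continuous_deriv.measurable.comp ht)).mul
      ((measurable_noise_sub s (e s)).comp hθ))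

/-- Every increment of the derivative carries the factor `slope`. Generation j contributes at most a
multiple of 2^j ρ^j to the second moment, and these sum to order (2ρ)^n. -/
lemma integral_abs_scoreDeriv_le (h : IsIid P θ ν) (hν : InputLaw ν ρ)
    (hm : InputMoments ν m e v w) (hs : s < 2) (i : Fin 2) (x : ℝ) (n : ℕ) :
    ∫⁻ ω, ENNReal.ofReal |scoreDeriv m e s i (fun j => θ j ω) x (2 ^ n)| ∂P
      ≤ ENNReal.ofReal (√(4 * (v s + w s)) * (√2 ^ n * √ρ ^ n)) := by
  have hvw : 0 ≤ v s + w s := add_nonneg (hm.var_nonneg hs) (hm.pos s hs).le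
  have hmem : ∀ k ∈ Finset.Ico 1 (2 ^ n), 1 ≤ k := fun k hk => (Finset.mem_Ico.1 hk).1
  have hu : ∀ f : ℝ → ℝ, SmoothBdd f → ∀ k, 1 ≤ k →
      Measurable[past θ k] (fun ω => slope (fun j => θ j ω) k
        * deriv f (base (fun j => θ j ω) k + slope (fun j => θ j ω) k * x)) ∧
      MemLp (fun ω => slope (fun j => θ j ω) k
        * deriv f (base (fun j => θ j ω) k + slope (fun j => θ j ω) k * x)) 2 P ∧
      ∫ ω, (slope (fun j => θ j ω) k
        * deriv f (base (fun j => θ j ω) k + slope (fun j => θ j ω) k * x)) ^ 2 ∂P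
        ≤ ∫ ω, slope (fun j => θ j ω) k ^ 2 ∂P := by
    intro f hf k hk
    have h1 := memLp_slope h hν k hk
    have hmeas := (measurable_slope θ k hk).mul
      (measurable_comp_traj θ hf.continuous_deriv.measurable hk x)
    have hle : ∀ ω, |slope (fun j => θ j ω) k
        * deriv f (base (fun j => θ j ω) k + slope (fun j => θ j ω) k * x)|
        ≤ |slope (fun j => θ j ω) k| := fun ω => by
      rw [abs_mul]
      exact mul_le_of_le_one_right (abs_nonneg _) (hf.deriv_bdd _)
    have hL := h1.mono (hmeas.mono (h.past_le k) le_rfl).aestronglyMeasurable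
      (Eventually.of_forall hle)
    exact ⟨hmeas, hL, integral_mono hL.integrable_sq h1.integrable_sq
      fun ω => sq_le_sq.2 (hle ω)⟩
  have hg := hu _ (smoothBdd_mul_wt i)
  have hp := hu _ (smoothBdd_wt i)
  obtain ⟨hL, hsq⟩ := integral_sq_sum_two_le h hν hm hs hmem (fun k hk => (hg k (hmem k hk)).2.1)
    (fun k hk => (hg k (hmem k hk)).1) (fun k hk => (hp k (hmem k hk)).2.1)
    (fun k hk => (hp k (hmem k hk)).1) (fun k hk => (hg k (hmem k hk)).2.2)
    (fun k hk => (hp k (hmem k hk)).2.2)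
  have hsum : ∑ k ∈ Finset.Ico 1 (2 ^ n), ∫ ω, slope (fun j => θ j ω) k ^ 2 ∂P
      ≤ 2 * (2 ^ n * ρ ^ n) := by
    rw [sum_Ico_eq_sum_gen]
    refine (Finset.sum_le_sum fun j _ => ?_).trans (sum_Ico_slope_bound_le hν.le_rho n)
    refine (Finset.sum_le_card_nsmul _ _ _ (integral_sq_slope_le h hν j)).trans_eq ?_
    rw [card_gen, nsmul_eq_mul]; push_cast; rfl
  change MemLp (fun ω => scoreDeriv m e s i (fun j => θ j ω) x (2 ^ n)) 2 P at hL
  rw [← ofReal_integral_eq_lintegral_ofReal (hL.integrable (by norm_num)).abs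
    (Eventually.of_forall fun _ => abs_nonneg _)]
  refine ENNReal.ofReal_le_ofReal (integral_abs_le_of_integral_sq_le hL (by positivity) ?_)
  refine hsq.trans ?_
  have e1 : (√2 ^ n) ^ 2 = 2 ^ n := by rw [← pow_mul, mul_comm, pow_mul, Real.sq_sqrt (by norm_num)]
  have e2 : (√ρ ^ n) ^ 2 = ρ ^ n := by rw [← pow_mul, mul_comm, pow_mul, Real.sq_sqrt hν.rho_pos.le]
  rw [mul_pow, mul_pow, e1, e2, Real.sq_sqrt (by positivity)]
  calc 2 * (v s + w s) * ∑ k ∈ Finset.Ico 1 (2 ^ n), ∫ ω, slope (fun j => θ j ω) k ^ 2 ∂P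
      ≤ 2 * (v s + w s) * (2 * (2 ^ n * ρ ^ n)) := by gcongr
    _ = 4 * (v s + w s) * (2 ^ n * ρ ^ n) := by ring

/-- The normalised score is asymptotically independent of the starting point. -/
lemma ae_tendsto_score_sub (h : IsIid P θ ν) (hν : InputLaw ν ρ)
    (hm : InputMoments ν m e v w) (hs : s < 2) (i : Fin 2) : ∀ᵐ ω ∂P, ∀ x, Tendsto
      (fun n : ℕ => (√2 ^ n)⁻¹ * score m e s i (fun j => θ j ω) x (2 ^ n)
        - (√2 ^ n)⁻¹ * score m e s i (fun j => θ j ω) 0 (2 ^ n)) atTop (𝓝 0) := by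
  set c := √(4 * (v s + w s)) with hc
  have hmeas := fun n : ℕ => (measurable_scoreDeriv h m e s i (2 ^ n)).abs.ennreal_ofReal
  -- After Tonelli and normalisation the mean is of order √ρ^n, hence summable. Countably many radii
  -- K cover all starting points.
  have key : ∀ K : ℕ, ∀ᵐ ω ∂P, Tendsto (fun n : ℕ => ENNReal.ofReal ((√2 ^ n)⁻¹) *
      ∫⁻ t in Set.Icc (-(K : ℝ)) K, ENNReal.ofReal |scoreDeriv m e s i (fun j => θ j ω) t (2 ^ n)|)
      atTop (𝓝 0) := by
    intro K
    refine ae_tendsto_zero_of_lintegral (fun n => ?_) (c := fun n => c * (2 * K) * √ρ ^ n)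
      ((summable_geometric_of_lt_one (Real.sqrt_nonneg _) hν.sqrt_lt_one).mul_left _) fun n => ?_
    · exact (Measurable.lintegral_prod_left' (hmeas n)).aemeasurable.const_mul _
    · rw [lintegral_const_mul _ (Measurable.lintegral_prod_left' (hmeas n)),
        lintegral_lintegral_swap (f := fun ω t =>
          ENNReal.ofReal |scoreDeriv m e s i (fun j => θ j ω) t (2 ^ n)|) ((hmeas n).comp measurable_swap).aemeasurable]
      calc ENNReal.ofReal ((√2 ^ n)⁻¹) * ∫⁻ t in Set.Icc (-(K : ℝ)) K,
            ∫⁻ ω, ENNReal.ofReal |scoreDeriv m e s i (fun j => θ j ω) t (2 ^ n)| ∂P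
          ≤ ENNReal.ofReal ((√2 ^ n)⁻¹) * ∫⁻ _ in Set.Icc (-(K : ℝ)) K,
            ENNReal.ofReal (c * (√2 ^ n * √ρ ^ n)) := by
              gcongr with t
              exact integral_abs_scoreDeriv_le h hν hm hs i t n
        _ = ENNReal.ofReal (c * (2 * K) * √ρ ^ n) := by
              rw [setLIntegral_const, Real.volume_Icc, ← ENNReal.ofReal_mul (by positivity),
                ← ENNReal.ofReal_mul (by positivity)]
              congr 1
              have : √2 ^ n ≠ 0 := by positivity
              field_simp
              ring
  filter_upwards [ae_all_iff.2 key] with ω hω x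
  obtain ⟨K, hK⟩ := exists_nat_ge |x|
  have h1 : Tendsto (fun n : ℕ => ENNReal.ofReal |(√2 ^ n)⁻¹ *
      score m e s i (fun j => θ j ω) x (2 ^ n)
        - (√2 ^ n)⁻¹ * score m e s i (fun j => θ j ω) 0 (2 ^ n)|) atTop (𝓝 0) := by
    refine tendsto_of_tendsto_of_tendsto_of_le_of_le tendsto_const_nhds (hω K)
      (fun _ => zero_le) fun n => ?_
    rw [← mul_sub, abs_mul, abs_of_pos (by positivity : (0 : ℝ) < (√2 ^ n)⁻¹),
      ENNReal.ofReal_mul (by positivity)]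
    exact mul_le_mul_right (abs_score_sub_le m e s i _ _ hK) _
  have h2 := (ENNReal.tendsto_toReal ENNReal.zero_ne_top).comp h1
  simp only [Function.comp_def, ENNReal.toReal_ofReal (abs_nonneg _), ENNReal.toReal_zero] at h2
  exact (tendsto_zero_iff_abs_tendsto_zero _).2 h2

/-- The quadratic strong law for the score, for an arbitrary starting point. -/
theorem ae_tendsto_score (h : IsIid P θ ν) (hν : InputLaw ν ρ) (hm : InputMoments ν m e v w)
    (hτ : IsStationary ν ρ τ) (hs : s < 2) : ∀ᵐ ω ∂P, ∀ x i i',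
    Tendsto (fun N : ℕ => (N : ℝ)⁻¹ * ∑ n ∈ Finset.range N,
      ((√2 ^ n)⁻¹ * score m e s i (fun j => θ j ω) x (2 ^ n)) *
        ((√2 ^ n)⁻¹ * score m e s i' (fun j => θ j ω) x (2 ^ n))) atTop
      (𝓝 (v s * ∫ t, (t * wt i t) * (t * wt i' t) ∂τ + w s * ∫ t, wt i t * wt i' t ∂τ)) := by
  filter_upwards [ae_all_iff.2 fun i => ae_tendsto_score_sub h hν hm hs i,
    ae_all_iff.2 fun i => ae_all_iff.2 fun i' => ae_tendsto_score_zero h hν hm hτ hs i i']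
    with ω h1 h2 x i i'
  exact tendsto_average_mul_of_sub_tendsto_zero (h1 i x) (h1 i' x)
    (by simpa only [sq] using h2 i i) (by simpa only [sq] using h2 i' i') (h2 i i')

end Transfer

/-! ### Asymptotic linear algebra of the estimator -/

/-- Since |A B| ≤ 1 + A² + B², whose averages are bounded, replacing g by its limit costs nothing.
-/
lemma tendsto_average_mul_mul {g A B : ℕ → ℝ} {c α β γ : ℝ} (hg : Tendsto g atTop (𝓝 c))
    (hA : Tendsto (fun N : ℕ => (N : ℝ)⁻¹ * ∑ n ∈ Finset.range N, A n ^ 2) atTop (𝓝 α))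
    (hB : Tendsto (fun N : ℕ => (N : ℝ)⁻¹ * ∑ n ∈ Finset.range N, B n ^ 2) atTop (𝓝 β))
    (hAB : Tendsto (fun N : ℕ => (N : ℝ)⁻¹ * ∑ n ∈ Finset.range N, A n * B n) atTop (𝓝 γ)) :
    Tendsto (fun N : ℕ => (N : ℝ)⁻¹ * ∑ n ∈ Finset.range N, g n * (A n * B n)) atTop
      (𝓝 (c * γ)) := by
  obtain ⟨K, hK⟩ := exists_sum_range_le_mul hA
  obtain ⟨K', hK'⟩ := exists_sum_range_le_mul hB
  have hg' : Tendsto (fun n => (g n - c) * (A n * B n / (1 + (A n ^ 2 + B n ^ 2)))) atTop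
      (𝓝 0) := by
    have h0 : Tendsto (fun n => |g n - c|) atTop (𝓝 0) := by simpa using (hg.sub_const c).abs
    refine squeeze_zero_norm (fun n => ?_) h0
    have h0 : (0 : ℝ) < 1 + (A n ^ 2 + B n ^ 2) := by positivity
    rw [norm_mul, Real.norm_eq_abs, Real.norm_eq_abs]
    refine mul_le_of_le_one_right (abs_nonneg _) ?_
    rw [abs_div, abs_of_pos h0, div_le_one h0, abs_le]
    constructor <;> nlinarith [sq_nonneg (A n - B n), sq_nonneg (A n + B n)]
  have h1 := tendsto_average_of_tendsto_zero (v := fun n => 1 + (A n ^ 2 + B n ^ 2)) hg'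
    (fun n => by positivity) (K := 1 + (K + K')) fun N => by
      rw [Finset.sum_add_distrib, Finset.sum_add_distrib, add_mul, add_mul]
      exact add_le_add (by simp) (add_le_add (hK N) (hK' N))
  have h2 := h1.add (hAB.const_mul c)
  rw [zero_add] at h2
  refine h2.congr fun N => ?_
  rw [mul_left_comm c, ← mul_add, Finset.mul_sum, ← Finset.sum_add_distrib]
  congr 1
  refine Finset.sum_congr rfl fun n _ => ?_
  have : 1 + (A n ^ 2 + B n ^ 2) ≠ 0 := by positivity
  field_simp
  ring

lemma tendsto_average_Icc {r : ℕ → ℝ} {l : ℝ}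
    (h : Tendsto (fun N : ℕ => (N : ℝ)⁻¹ * ∑ n ∈ Finset.range N, r n) atTop (𝓝 l)) :
    Tendsto (fun N : ℕ => (N : ℝ)⁻¹ * ∑ n ∈ Finset.Icc 1 N, r n) atTop (𝓝 l) := by
  have h1 := h.comp (tendsto_add_atTop_nat 1)
  have h2 : Tendsto (fun N : ℕ => (N : ℝ)⁻¹) atTop (𝓝 0) :=
    tendsto_natCast_atTop_atTop.inv_tendsto_atTop
  have h3 := (h1.mul (h2.const_add 1)).sub (h2.mul_const (r 0))
  simp only [add_zero, mul_one, zero_mul, sub_zero] at h3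
  refine h3.congr' ?_
  filter_upwards [eventually_ge_atTop 1] with N hN
  have hN' : (N : ℝ) ≠ 0 := by positivity
  have hN1 : (N : ℝ) + 1 ≠ 0 := by positivity
  have hsum : ∑ n ∈ Finset.range (N + 1), r n = r 0 + ∑ n ∈ Finset.Icc 1 N, r n := by
    rw [Finset.range_eq_Ico, Finset.sum_eq_sum_Ico_succ_bot (by omega)]
    rfl
  simp only [Function.comp_apply, hsum]
  push_cast
  field_simp
  ring

lemma exists_pos_mul_le_quadratic {c : Matrix (Fin 2) (Fin 2) ℝ} (hc : c.PosDef) :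
    ∃ δ > 0, ∀ y : Fin 2 → ℝ, δ * (y 0 ^ 2 + y 1 ^ 2) ≤ y ⬝ᵥ (c *ᵥ y) := by
  have hsymm : c 1 0 = c 0 1 := by simpa using hc.isHermitian.apply 0 1
  have hdet := hc.det_pos
  rw [Matrix.det_fin_two, hsymm] at hdet
  have h0 := hc.diag_pos (i := 0)
  have h1 := hc.diag_pos (i := 1)
  -- δ = det c / tr c. By Cayley–Hamilton tr(c) c - det(c) 1 = c², so the gap, multiplied by the
  -- trace, is |c y|².
  refine ⟨(c 0 0 * c 1 1 - c 0 1 * c 0 1) / (c 0 0 + c 1 1), by positivity, fun y => ?_⟩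
  rw [div_mul_eq_mul_div, div_le_iff₀ (by positivity)]
  simp only [dotProduct, Matrix.mulVec, Fin.sum_univ_two, hsymm]
  nlinarith [sq_nonneg (c 0 0 * y 0 + c 0 1 * y 1), sq_nonneg (c 0 1 * y 0 + c 1 1 * y 1)]

lemma tendsto_inv_matrix {R : ℕ → Matrix (Fin 2) (Fin 2) ℝ} {c : Matrix (Fin 2) (Fin 2) ℝ}
    (hR : Tendsto R atTop (𝓝 c)) (hc : c.det ≠ 0) :
    Tendsto (fun n => (R n)⁻¹) atTop (𝓝 c⁻¹) := by
  have hdet : Tendsto (fun n => (R n).det) atTop (𝓝 c.det) :=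
    (continuous_id.matrix_det.tendsto c).comp hR
  have hadj : Tendsto (fun n => (R n).adjugate) atTop (𝓝 c.adjugate) :=
    (continuous_id.matrix_adjugate.tendsto c).comp hR
  simp only [Matrix.inv_def, Ring.inverse_eq_inv']
  exact (hdet.inv₀ hc).smul hadj

/-- The quadratic form of the estimation error, for the two responses separately. -/
def errorForm (c E : Matrix (Fin 2) (Fin 2) ℝ) : ℝ := (Eᵀ * c * E).trace

lemma errorForm_eq (c E : Matrix (Fin 2) (Fin 2) ℝ) :
    errorForm c E = ∑ s, E.col s ⬝ᵥ (c *ᵥ E.col s) := by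
  simp only [errorForm, Matrix.trace, Matrix.diag, Matrix.mul_assoc]
  refine Finset.sum_congr rfl fun s _ => ?_
  simp [Matrix.mul_apply, dotProduct, Matrix.mulVec, Matrix.col]

lemma sum_mul_mul_eq_errorForm (c E : Matrix (Fin 2) (Fin 2) ℝ) :
    errorForm c E = ∑ s, ∑ i, ∑ i', c i i' * (E i s * E i' s) := by
  rw [errorForm_eq]
  simp only [dotProduct, Matrix.mulVec, Fin.sum_univ_two, Matrix.col, Matrix.transpose_apply]
  ring

section Deterministic

variable {R W E : ℕ → Matrix (Fin 2) (Fin 2) ℝ} {c : Matrix (Fin 2) (Fin 2) ℝ}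
  {q : Fin 2 → Fin 2 → Fin 2 → ℝ}

/-- The error form is a quadratic form in W with matrix close to c⁻¹ c c⁻¹ = c⁻¹, so only the
averaged products of the entries of W matter. -/
lemma tendsto_average_errorForm (hc : c.PosDef) (hR : Tendsto R atTop (𝓝 c))
    (hW : ∀ s i i', Tendsto (fun N : ℕ => (N : ℝ)⁻¹ *
      ∑ n ∈ Finset.range N, W n i s * W n i' s) atTop (𝓝 (q s i i')))
    (hE : ∀ᶠ n : ℕ in atTop, E n = (√2 ^ n)⁻¹ • ((R n)⁻¹ * W n)) :
    Tendsto (fun N : ℕ => (N : ℝ)⁻¹ * ∑ n ∈ Finset.Icc 1 N, ((2 : ℝ) ^ n - 1) * errorForm c (E n))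
      atTop (𝓝 (∑ s, ∑ i, ∑ i', c⁻¹ i i' * q s i i')) := by
  -- The scalar 1 - 2^{-n} is the ratio of the tree size 2^n - 1 to the normalisation 2^n.
  set G : ℕ → Matrix (Fin 2) (Fin 2) ℝ := fun n =>
    (1 - ((2 : ℝ) ^ n)⁻¹) • ((R n)⁻¹ᵀ * c * (R n)⁻¹) with hG
  have hRinv := tendsto_inv_matrix hR hc.det_pos.ne'
  have hGlim : Tendsto G atTop (𝓝 c⁻¹) := by
    have h2 : Tendsto (fun n : ℕ => 1 - ((2 : ℝ) ^ n)⁻¹) atTop (𝓝 1) := by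
      simpa using (tendsto_pow_atTop_atTop_of_one_lt
        (one_lt_two : (1 : ℝ) < 2)).inv_tendsto_atTop.const_sub 1
    have h3 : Tendsto (fun n => (R n)⁻¹ᵀ) atTop (𝓝 c⁻¹ᵀ) :=
      (continuous_id.matrix_transpose.tendsto c⁻¹).comp hRinv
    have h4 := h2.smul ((h3.mul_const c).mul hRinv)
    have hct : cᵀ = c := by simpa using hc.isHermitian.eq
    rw [one_smul, Matrix.transpose_nonsing_inv, hct,
      Matrix.nonsing_inv_mul _ (isUnit_iff_ne_zero.2 hc.det_pos.ne'), one_mul] at h4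
    exact h4
  have hGW : Tendsto (fun N : ℕ => (N : ℝ)⁻¹ * ∑ n ∈ Finset.range N, errorForm (G n) (W n))
      atTop (𝓝 (∑ s, ∑ i, ∑ i', c⁻¹ i i' * q s i i')) := by
    have h1 : ∀ s i i', Tendsto (fun N : ℕ => (N : ℝ)⁻¹ * ∑ n ∈ Finset.range N,
        G n i i' * (W n i s * W n i' s)) atTop (𝓝 (c⁻¹ i i' * q s i i')) := fun s i i' =>
      tendsto_average_mul_mul ((continuous_id.matrix_elem i i').tendsto c⁻¹ |>.comp hGlim)
        (by simpa only [sq] using hW s i i) (by simpa only [sq] using hW s i' i') (hW s i i')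
    refine (tendsto_finsetSum _ fun s _ => tendsto_finsetSum _ fun i _ =>
      tendsto_finsetSum _ fun i' _ => h1 s i i').congr fun N => ?_
    simp only [sum_mul_mul_eq_errorForm, ← Finset.mul_sum]
    congr 1
    simp only [Fin.sum_univ_two, Finset.sum_add_distrib]
  have hdiff : Tendsto (fun n => ((2 : ℝ) ^ n - 1) * errorForm c (E n) - errorForm (G n) (W n))
      atTop (𝓝 0) := by
    refine tendsto_const_nhds.congr' ?_
    filter_upwards [hE] with n hn
    have hsq : ((√2 ^ n)⁻¹) * ((√2 ^ n)⁻¹) = ((2 : ℝ) ^ n)⁻¹ := by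
      rw [← mul_inv, ← mul_pow, Real.mul_self_sqrt (by norm_num)]
    have h2 : (2 : ℝ) ^ n ≠ 0 := by positivity
    rw [hn, errorForm, errorForm, hG, Matrix.transpose_smul, Matrix.transpose_mul]
    simp only [Matrix.smul_mul, Matrix.mul_smul, Matrix.trace_smul, smul_eq_mul, Matrix.mul_assoc]
    rw [← mul_assoc (√2 ^ n)⁻¹, hsq, ← mul_assoc, eq_comm, sub_eq_zero]
    congr 1
    field_simp
  refine tendsto_average_Icc ?_
  have := hGW.add hdiff.cesaro
  rw [add_zero] at this
  refine this.congr fun N => ?_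
  rw [← mul_add, ← Finset.sum_add_distrib]
  congr 1
  exact Finset.sum_congr rfl fun n _ => by ring

/-- All terms are nonnegative and the sum up to n is at most a constant times n, so the last term
alone obeys this bound; positive definiteness converts it into one on the entries. -/
lemma exists_sq_le_of_tendsto_average (hc : c.PosDef) {l : ℝ}
    (h : Tendsto (fun N : ℕ => (N : ℝ)⁻¹ *
      ∑ n ∈ Finset.Icc 1 N, ((2 : ℝ) ^ n - 1) * errorForm c (E n)) atTop (𝓝 l)) :
    ∃ K : ℝ, ∀ n : ℕ, 1 ≤ n → ∑ s, ∑ i, E n i s ^ 2 ≤ K * ((n : ℝ) / (2 ^ n - 1)) := by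
  obtain ⟨δ, hδ, hle⟩ := exists_pos_mul_le_quadratic hc
  obtain ⟨K, hK⟩ := h.bddAbove_range
  have hform : ∀ n, δ * ∑ s, ∑ i, E n i s ^ 2 ≤ errorForm c (E n) := fun n => by
    rw [errorForm_eq, Finset.mul_sum]
    refine Finset.sum_le_sum fun s _ => ?_
    simpa [Fin.sum_univ_two, Matrix.col] using hle ((E n).col s)
  have hnn : ∀ n, 0 ≤ ∑ s, ∑ i, E n i s ^ 2 := fun n =>
    Finset.sum_nonneg fun _ _ => Finset.sum_nonneg fun _ _ => sq_nonneg _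
  have hpow : ∀ n : ℕ, (0 : ℝ) ≤ 2 ^ n - 1 := fun n =>
    sub_nonneg.2 (one_le_pow₀ one_le_two)
  refine ⟨K / δ, fun n hn => ?_⟩
  have hn' : (0 : ℝ) < n := by exact_mod_cast hn
  have h2 : (0 : ℝ) < 2 ^ n - 1 := sub_pos.2 (one_lt_pow₀ one_lt_two (by omega))
  have h3 := hK ⟨n, rfl⟩
  simp only at h3
  rw [inv_mul_le_iff₀ hn'] at h3
  have h4 : ((2 : ℝ) ^ n - 1) * errorForm c (E n)
      ≤ ∑ n ∈ Finset.Icc 1 n, ((2 : ℝ) ^ n - 1) * errorForm c (E n) :=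
    Finset.single_le_sum (f := fun n : ℕ => ((2 : ℝ) ^ n - 1) * errorForm c (E n))
      (fun k _ => mul_nonneg (hpow k) ((mul_nonneg hδ.le (hnn k)).trans (hform k)))
      (Finset.mem_Icc.2 ⟨hn, le_rfl⟩)
  have h5 := mul_le_mul_of_nonneg_left (hform n) h2.le
  rw [div_mul_div_comm, le_div_iff₀ (by positivity)]
  linarith

end Deterministic

/-! ### The estimator along a trajectory -/

section Trajectory

lemma S_apply (x : ℕ → ℝ) {n : ℕ} (hn : 1 ≤ n) (i j : Fin 2) :
    S x (n - 1) i j = ∑ k ∈ Finset.Ico 1 (2 ^ n), wt i (x k) * ![x k, 1] j := by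
  rw [S, tree_eq_Ico, Nat.sub_add_cancel hn, Matrix.sum_apply]
  refine Finset.sum_congr rfl fun k _ => ?_
  simp only [Matrix.smul_apply, vecMulVec_apply, smul_eq_mul, wt, weight, regressor]
  ring

/-- The matrix `(m₀, m₁; e₀, e₁)`. -/
def paramMat (m e : ℕ → ℝ) : Matrix (Fin 2) (Fin 2) ℝ := !![m 0, m 1; e 0, e 1]

/-- The matrix of the scores of the trajectory started at `x₁`. -/
def scoreMat (m e : ℕ → ℝ) (z : ℕ → Input) (x₁ : ℝ) (n : ℕ) : Matrix (Fin 2) (Fin 2) ℝ :=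
  Matrix.of fun i s => score m e s i z x₁ (2 ^ n)

variable {z : ℕ → Input} {x : ℕ → ℝ} {m e : ℕ → ℝ}

lemma sum_vecMulVec_response
    (hx : ∀ k s, 1 ≤ k → s < 2 → x (2 * k + s) = coefOf s (z k) * x k + noiseOf s (z k))
    {n : ℕ} (hn : 1 ≤ n) :
    ∑ k ∈ tree (n - 1), (weight x k)⁻¹ • vecMulVec (regressor x k) (response x k)
      = S x (n - 1) * paramMat m e + scoreMat m e z (x 1) n := by
  ext i s
  rw [Matrix.add_apply, Matrix.mul_apply, Fin.sum_univ_two, S_apply x hn, S_apply x hn,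
    Matrix.sum_apply, tree_eq_Ico, Nat.sub_add_cancel hn, Finset.sum_mul, Finset.sum_mul]
  simp only [scoreMat, Matrix.of_apply, score]
  rw [← Finset.sum_add_distrib, ← Finset.sum_add_distrib]
  refine Finset.sum_congr rfl fun k hk => ?_
  have hk1 := (Finset.mem_Ico.1 hk).1
  rw [← eq_base_add_slope_mul z hx k hk1]
  have hresp : response x k s = coefOf s (z k) * x k + noiseOf s (z k) := by
    rw [← hx k s hk1 s.isLt]
    fin_cases s <;> simp [response]
  simp only [Matrix.smul_apply, vecMulVec_apply, smul_eq_mul, hresp]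
  have hp : paramMat m e 0 s = m s ∧ paramMat m e 1 s = e s := by
    fin_cases s <;> simp [paramMat]
  rw [hp.1, hp.2]
  simp only [scoreIncr, wt, weight, regressor, Matrix.cons_val_zero, Matrix.cons_val_one]
  ring

/-- The normal equations cancel the parameter and leave the inverse of S times the score. The
scaling puts both factors in the form whose limits are known. -/
lemma thetaHatMat_sub_eq
    (hx : ∀ k s, 1 ≤ k → s < 2 → x (2 * k + s) = coefOf s (z k) * x k + noiseOf s (z k))
    {n : ℕ} (hn : 1 ≤ n) (hdet : (S x (n - 1)).det ≠ 0) :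
    thetaHatMat x n - paramMat m e = (√2 ^ n)⁻¹ •
      ((((2 : ℝ) ^ n)⁻¹ • S x (n - 1))⁻¹ * ((√2 ^ n)⁻¹ • scoreMat m e z (x 1) n)) := by
  have hsq : ((√2 ^ n)⁻¹) * ((√2 ^ n)⁻¹) = ((2 : ℝ) ^ n)⁻¹ := by
    rw [← mul_inv, ← mul_pow, Real.mul_self_sqrt (by norm_num)]
  have hu : IsUnit (S x (n - 1)).det := isUnit_iff_ne_zero.2 hdet
  have h2 : (2 : ℝ) ^ n ≠ 0 := by positivity
  have hinv : (((2 : ℝ) ^ n)⁻¹ • S x (n - 1))⁻¹ = (2 : ℝ) ^ n • (S x (n - 1))⁻¹ := by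
    refine Matrix.inv_eq_left_inv ?_
    rw [Matrix.smul_mul, Matrix.mul_smul, smul_smul, mul_inv_cancel₀ h2, one_smul,
      Matrix.nonsing_inv_mul _ hu]
  rw [thetaHatMat, SReg, if_neg hdet, sum_vecMulVec_response (m := m) (e := e) hx hn, mul_add,
    ← mul_assoc, Matrix.nonsing_inv_mul _ hu, one_mul, add_sub_cancel_left, hinv, Matrix.mul_smul,
    smul_smul, hsq, Matrix.smul_mul, smul_smul, inv_mul_cancel₀ h2, one_smul]

end Trajectory

/-! ### The limiting matrices -/

section Limit

variable {ν : Measure Input} {ρ : ℝ} {τ : Measure ℝ} {m e v w : ℕ → ℝ}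

lemma C_apply (τ : Measure ℝ) (i j : Fin 2) : C τ i j = ∫ t, wt i t * ![t, 1] j ∂τ := by
  simp only [C, Matrix.of_apply]
  congr 1
  funext t
  fin_cases i <;> fin_cases j <;> simp [wt]; ring

lemma smoothBdd_wt_mul (i j : Fin 2) : SmoothBdd fun t => wt i t * ![t, 1] j := by
  fin_cases j
  · simpa [mul_comm] using smoothBdd_mul_wt i
  · simpa using smoothBdd_wt i

/-- The quadratic form at y is the mean of (y₀ T + y₁)² / (1 + T²). If it vanished for some y ≠ 0,
then T would be constant, which is excluded. -/
lemma posDef_C (hτ : IsStationary ν ρ τ) (hm : InputMoments ν m e v w) (hν : InputLaw ν ρ) :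
    (C τ).PosDef := by
  have := hτ.prob
  have hint : ∀ i j, Integrable (fun t => wt i t * ![t, 1] j) τ := fun i j =>
    (smoothBdd_wt_mul i j).bddLip.integrable_comp measurable_id
  refine Matrix.PosDef.of_dotProduct_mulVec_pos ?_ fun y hy => ?_
  · ext i j
    simp only [Matrix.conjTranspose_apply, star_trivial, C_apply]
    congr 1
    funext t
    simp only [wt]
    ring
  · have hform : star y ⬝ᵥ (C τ *ᵥ y) = ∫ t, (1 + t ^ 2)⁻¹ * (y 0 * t + y 1) ^ 2 ∂τ := by
      have h1 : ∀ t : ℝ, (1 + t ^ 2)⁻¹ * (y 0 * t + y 1) ^ 2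
          = ∑ i, ∑ j, y i * y j * (wt i t * ![t, 1] j) := fun t => by
        simp [Fin.sum_univ_two, wt]; ring
      simp only [h1]
      rw [integral_finsetSum _ fun i _ => integrable_finsetSum _ fun j _ =>
        (hint i j).const_mul _]
      simp only [dotProduct, Matrix.mulVec, star_trivial, Finset.mul_sum]
      refine Finset.sum_congr rfl fun i _ => ?_
      rw [integral_finsetSum _ fun j _ => (hint i j).const_mul _]
      refine Finset.sum_congr rfl fun j _ => ?_
      rw [integral_const_mul, C_apply]
      ring
    rw [hform]
    have hnn : ∀ t : ℝ, 0 ≤ (1 + t ^ 2)⁻¹ * (y 0 * t + y 1) ^ 2 := fun t => by positivity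
    have hi : Integrable (fun t : ℝ => (1 + t ^ 2)⁻¹ * (y 0 * t + y 1) ^ 2) τ := by
      have h1 : ∀ t : ℝ, (1 + t ^ 2)⁻¹ * (y 0 * t + y 1) ^ 2
          = ∑ i, ∑ j, y i * y j * (wt i t * ![t, 1] j) := fun t => by
        simp [Fin.sum_univ_two, wt]; ring
      simp only [h1]
      exact integrable_finsetSum _ fun i _ => integrable_finsetSum _ fun j _ =>
        (hint i j).const_mul _
    refine lt_of_le_of_ne (integral_nonneg hnn) fun h0 => ?_
    have hae := (integral_eq_zero_iff_of_nonneg hnn hi).1 h0.symm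
    have hlin : ∀ᵐ t ∂τ, y 0 * t + y 1 = 0 := hae.mono fun t ht => by
      have h1 : (1 + t ^ 2)⁻¹ * (y 0 * t + y 1) ^ 2 = 0 := ht
      have h2 : (1 + t ^ 2)⁻¹ ≠ 0 := by positivity
      exact pow_eq_zero_iff two_ne_zero |>.1 ((mul_eq_zero.1 h1).resolve_left h2)
    by_cases hy0 : y 0 = 0
    · obtain ⟨t, ht⟩ := hlin.exists
      rw [hy0, zero_mul, zero_add] at ht
      exact hy (by ext i; fin_cases i <;> simp [hy0, ht])
    · refine hτ.not_ae_eq hm hν (-y 1 / y 0) (hlin.mono fun t ht => ?_)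
      rw [eq_div_iff hy0]
      linarith

lemma L_apply_same [IsProbabilityMeasure τ] (σa σb σc σd ρab ρcd : ℝ) (s i i' : Fin 2) :
    L σa σb σc σd ρab ρcd τ (s, i) (s, i')
      = ![σa ^ 2, σb ^ 2] s * ∫ t, (t * wt i t) * (t * wt i' t) ∂τ
        + ![σc ^ 2, σd ^ 2] s * ∫ t, wt i t * wt i' t ∂τ := by
  have h1 : Integrable (fun t => (t * wt i t) * (t * wt i' t)) τ :=
    ((smoothBdd_mul_wt i).bddLip.mul (smoothBdd_mul_wt i').bddLip).integrable_comp measurable_id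
  have h2 : Integrable (fun t => wt i t * wt i' t) τ :=
    ((smoothBdd_wt i).bddLip.mul (smoothBdd_wt i').bddLip).integrable_comp measurable_id
  rw [← integral_const_mul, ← integral_const_mul, ← integral_add (h1.const_mul _) (h2.const_mul _)]
  simp only [L, Matrix.of_apply]
  congr 1
  funext t
  simp only [Matrix.smul_apply, Matrix.kroneckerMap_apply, smul_eq_mul, ← inv_pow]
  fin_cases s <;> fin_cases i <;> fin_cases i' <;>
    simp [wt, noiseCov, -inv_pow] <;> generalize (1 + t ^ 2)⁻¹ = r <;> ring

/-- By cyclicity of the trace only Λ⁻¹ = I₂ ⊗ C⁻¹ appears. It is block diagonal, so the blocks of A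
coupling the two responses drop out. -/
lemma trace_invSqrt_mul_mul (hC : (C τ).PosDef) (A : Matrix (Fin 2 × Fin 2) (Fin 2 × Fin 2) ℝ) :
    (invSqrt (Lam τ) * A * invSqrt (Lam τ)).trace
      = ∑ s, ∑ i, ∑ i', (C τ)⁻¹ i i' * A (s, i') (s, i) := by
  have hΛ : 0 ≤ Lam τ := by
    rw [Matrix.nonneg_iff_posSemidef]
    exact (Matrix.PosDef.one.kronecker hC).posSemidef
  have hinv : invSqrt (Lam τ) * invSqrt (Lam τ) = 1 ⊗ₖ (C τ)⁻¹ := by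
    rw [invSqrt, ← Matrix.mul_inv_rev, CFC.sqrt_mul_sqrt_self _ hΛ, Lam, Matrix.inv_kronecker,
      inv_one]
  rw [Matrix.trace_mul_comm, ← mul_assoc, hinv]
  simp only [Matrix.trace, Matrix.diag, Matrix.mul_apply, Fintype.sum_prod_type,
    Matrix.kroneckerMap_apply, Matrix.one_apply]
  refine Finset.sum_congr rfl fun s _ => Finset.sum_congr rfl fun i _ => ?_
  rw [Finset.sum_eq_single_of_mem s (Finset.mem_univ s)]
  · simp
  · intro s' _ hs'
    simp [hs'.symm]

lemma dotProduct_Lam_mulVec (τ : Measure ℝ) (E : Matrix (Fin 2) (Fin 2) ℝ) :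
    E.vec ⬝ᵥ (Lam τ *ᵥ E.vec) = errorForm (C τ) E := by
  rw [sum_mul_mul_eq_errorForm]
  simp only [Lam, dotProduct, Matrix.mulVec, Fintype.sum_prod_type, Matrix.kroneckerMap_apply,
    Matrix.one_apply, Matrix.vec, Fin.sum_univ_two]
  simp
  ring

end Limit

/-! ### The inputs of the process -/

lemma integral_eq_of_condExp_ae_eq {Ω : Type*} {m₀ mΩ : MeasurableSpace Ω} {P : Measure Ω}
    [IsProbabilityMeasure P] (hm : m₀ ≤ mΩ) {u : Ω → ℝ} {r : ℝ} (h : P[u | m₀] =ᵐ[P] fun _ => r) :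
    ∫ ω, u ω ∂P = r := by
  rw [← integral_condExp hm, integral_congr_ae h]
  simp

/-- The law of total variance, in which a constant conditional mean contributes nothing. -/
lemma integral_sub_sq_eq_of_condVar_ae_eq {Ω : Type*} {m₀ mΩ : MeasurableSpace Ω} {P : Measure Ω}
    [IsProbabilityMeasure P] (hm : m₀ ≤ mΩ) {u : Ω → ℝ} {r v : ℝ} (hu : MemLp u 2 P)
    (h : P[u | m₀] =ᵐ[P] fun _ => r) (hv : Var[u; P | m₀] =ᵐ[P] fun _ => v) :
    ∫ ω, (u ω - r) ^ 2 ∂P = v := by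
  have h1 := integral_condVar_add_variance_condExp hm hu
  rw [variance_congr h, integral_congr_ae hv, variance_eq_integral hu.1.aemeasurable,
    integral_eq_of_condExp_ae_eq hm h] at h1
  simpa [variance_eq_integral] using h1.symm

section Inputs

variable {Ω : Type*} [mΩ : MeasurableSpace Ω] {P : Measure Ω}

/-- It suffices to test rectangles, a generating π-system. A finite intersection factors first
between the two families, then within each, and the factors are regrouped index by index. -/
lemma iIndepFun_prodMk {E F : Type*} [MeasurableSpace E] [MeasurableSpace F] {f : ℕ → Ω → E}
    {g : ℕ → Ω → F} (hfm : ∀ n, Measurable (f n)) (hgm : ∀ n, Measurable (g n))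
    (hf : iIndepFun f P) (hg : iIndepFun g P)
    (hfg : IndepFun (fun ω n => f n ω) (fun ω n => g n ω) P) :
    iIndepFun (fun n ω => (f n ω, g n ω)) P := by
  let R : Set (Set (E × F)) := Set.image2 (· ×ˢ ·) {s | MeasurableSet s} {t | MeasurableSet t}
  refine iIndepSets.iIndep (fun n => ((hfm n).prodMk (hgm n)).comap_le)
    (fun n => {s | ∃ t ∈ R, (fun ω => (f n ω, g n ω)) ⁻¹' t = s})
    (fun n => isPiSystem_prod.comap _) (fun n => ?_) ?_
  · rw [← generateFrom_prod, MeasurableSpace.comap_generateFrom]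
    rfl
  rw [iIndepSets_iff]
  intro I D hD
  have hD' : ∀ i, ∃ u v, i ∈ I → MeasurableSet u ∧ MeasurableSet v ∧
      D i = f i ⁻¹' u ∩ g i ⁻¹' v := fun i => by
    by_cases hi : i ∈ I
    · obtain ⟨_, ⟨u, hu, v, hv, rfl⟩, h⟩ := hD i hi
      exact ⟨u, v, fun _ => ⟨hu, hv, h ▸ rfl⟩⟩
    · exact ⟨∅, ∅, fun h => absurd h hi⟩
  choose u v huv using hD'
  have hinter : ⋂ i ∈ I, D i = (⋂ i ∈ I, f i ⁻¹' u i) ∩ ⋂ i ∈ I, g i ⁻¹' v i := by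
    ext ω
    simp only [Set.mem_iInter, Set.mem_inter_iff]
    exact ⟨fun h => ⟨fun i hi => ((huv i hi).2.2 ▸ h i hi).1,
      fun i hi => ((huv i hi).2.2 ▸ h i hi).2⟩,
      fun h i hi => (huv i hi).2.2 ▸ ⟨h.1 i hi, h.2 i hi⟩⟩
  have hU : MeasurableSet (⋂ i ∈ I, (fun x : ℕ → E => x i) ⁻¹' u i) :=
    Finset.measurableSet_biInter _ fun i hi => measurable_pi_apply i (huv i hi).1
  have hV : MeasurableSet (⋂ i ∈ I, (fun x : ℕ → F => x i) ⁻¹' v i) :=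
    Finset.measurableSet_biInter _ fun i hi => measurable_pi_apply i (huv i hi).2.1
  have h := hfg.measure_inter_preimage_eq_mul _ _ hU hV
  simp only [Set.preimage_iInter, Set.preimage_preimage] at h
  rw [hinter, h, hf.measure_inter_preimage_eq_mul I fun i hi => (huv i hi).1,
    hg.measure_inter_preimage_eq_mul I fun i hi => (huv i hi).2.1, ← Finset.prod_mul_distrib]
  refine Finset.prod_congr rfl fun i hi => ?_
  rw [(huv i hi).2.2]
  exact ((hfg.comp (measurable_pi_apply i) (measurable_pi_apply i)).measure_inter_preimage_eq_mul
    _ _ (huv i hi).1 (huv i hi).2.1).symm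

/-- The inputs attached to the individual `k`. -/
def inputs (A B ε : ℕ → Ω → ℝ) (k : ℕ) (ω : Ω) : Input :=
  ((A k ω, B k ω), (ε (2 * k) ω, ε (2 * k + 1) ω))

variable {X A B ε : ℕ → Ω → ℝ} {a b c d σa σb σc σd : ℝ}

namespace IsProcess

lemma measurable_inputs (hX : IsProcess P X A B ε a b c d) {k : ℕ} (hk : 1 ≤ k) :
    Measurable (inputs A B ε k) :=
  ((hX.measurable_coef k hk).1.prodMk (hX.measurable_coef k hk).2).prodMk
    ((hX.measurable_noise k hk).1.prodMk (hX.measurable_noise k hk).2)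

lemma indepFun_coef_noise (hX : IsProcess P X A B ε a b c d) {k : ℕ} (hk : 1 ≤ k) :
    IndepFun (fun ω => (A k ω, B k ω)) (fun ω => (ε (2 * k) ω, ε (2 * k + 1) ω)) P := by
  obtain ⟨i, rfl⟩ := Nat.exists_eq_add_of_le' hk
  exact hX.coef_indep_noise.comp (measurable_pi_apply i) (measurable_pi_apply i)

lemma isIid_inputs [IsProbabilityMeasure P] (hX : IsProcess P X A B ε a b c d) :
    IsIid P (inputs A B ε) (P.map (inputs A B ε 1)) where
  measurable _ hk := hX.measurable_inputs hk
  indep := iIndepFun_prodMk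
    (fun n => (hX.measurable_coef _ n.succ_pos).1.prodMk (hX.measurable_coef _ n.succ_pos).2)
    (fun n => (hX.measurable_noise _ n.succ_pos).1.prodMk (hX.measurable_noise _ n.succ_pos).2)
    hX.coef_indep hX.noise_indep hX.coef_indep_noise
  map_eq k hk := by
    have h : ∀ j, 1 ≤ j → P.map (inputs A B ε j)
        = (P.map fun ω => (A j ω, B j ω)).prod
          (P.map fun ω => (ε (2 * j) ω, ε (2 * j + 1) ω)) := fun j hj =>
      (indepFun_iff_map_prod_eq_prod_map_map
        ((hX.measurable_coef j hj).1.prodMk (hX.measurable_coef j hj).2).aemeasurable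
        ((hX.measurable_noise j hj).1.prodMk (hX.measurable_noise j hj).2).aemeasurable).1
        (hX.indepFun_coef_noise hj)
    rw [h k hk, h 1 le_rfl, (hX.coef_ident k hk).map_eq, (hX.noise_ident k hk).map_eq]

lemma child_eq (hX : IsProcess P X A B ε a b c d) (ω : Ω) (k s : ℕ) (hk : 1 ≤ k) (hs : s < 2) :
    X (2 * k + s) ω
      = coefOf s (inputs A B ε k ω) * X k ω + noiseOf s (inputs A B ε k ω) := by
  interval_cases s
  · exact hX.even_eq k hk ω
  · exact hX.odd_eq k hk ω

lemma eq_base_add_slope (hX : IsProcess P X A B ε a b c d) (ω : Ω) {k : ℕ} (hk : 1 ≤ k) :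
    X k ω = base (fun j => inputs A B ε j ω) k + slope (fun j => inputs A B ε j ω) k * X 1 ω :=
  eq_base_add_slope_mul (fun j => inputs A B ε j ω) (x := fun k => X k ω) (hX.child_eq ω) k hk

lemma measurable_process (hX : IsProcess P X A B ε a b c d) {k : ℕ} (hk : 1 ≤ k) :
    Measurable (X k) := by
  induction k using Nat.strong_induction_on with
  | _ k ih =>
    rcases hk.eq_or_lt with rfl | hk
    · exact hX.measurable_init
    · have hdiv : k = 2 * (k / 2) + k % 2 := by omega
      have h1 : 1 ≤ k / 2 := by omega
      have h := hX.measurable_inputs h1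
      rw [hdiv, show X (2 * (k / 2) + k % 2) = _ from
        funext fun ω => hX.child_eq ω (k / 2) (k % 2) h1 (by omega)]
      exact (((measurable_coefOf _).comp h).mul (ih (k / 2) (by omega) h1)).add
        ((measurable_noiseOf _).comp h)

lemma natFiltration_zero_le (hX : IsProcess P X A B ε a b c d) :
    natFiltration X 0 ≤ mΩ :=
  iSup₂_le fun k hk => by
    rw [tree_eq_Ico, Finset.mem_Ico] at hk
    exact (hX.measurable_process hk.1).comap_le

lemma inputLaw [IsProbabilityMeasure P] (hX : IsProcess P X A B ε a b c d) (h1 : H1 P A B)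
    (hA : MemLp (A 1) 4 P) (hB : MemLp (B 1) 4 P) (hc : MemLp (ε 2) 4 P) (hd : MemLp (ε 3) 4 P) :
    InputLaw (P.map (inputs A B ε 1))
      (max (3 / 4) (max (∫ ω, A 1 ω ^ 2 ∂P) (∫ ω, B 1 ω ^ 2 ∂P))) where
  prob := Measure.isProbabilityMeasure_map (hX.measurable_inputs le_rfl).aemeasurable
  memLp_coef s := by
    rw [memLp_map_measure_iff (measurable_coefOf s).aestronglyMeasurable
      (hX.measurable_inputs le_rfl).aemeasurable]
    by_cases hs : s = 0
    · simp only [Function.comp_def, coefOf, if_pos hs]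
      exact hA
    · simp only [Function.comp_def, coefOf, if_neg hs]
      exact hB
  memLp_noise s := by
    rw [memLp_map_measure_iff (measurable_noiseOf s).aestronglyMeasurable
      (hX.measurable_inputs le_rfl).aemeasurable]
    by_cases hs : s = 0
    · simp only [Function.comp_def, noiseOf, if_pos hs]
      exact hc
    · simp only [Function.comp_def, noiseOf, if_neg hs]
      exact hd
  le_rho := le_max_left _ _
  rho_lt := max_lt (by norm_num) (max_lt (h1.sq_A 1 le_rfl) (h1.sq_B 1 le_rfl))
  sq_le s := by
    rw [← hX.isIid_inputs.integral_comp le_rfl ((measurable_coefOf s).pow_const 2)]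
    by_cases hs : s = 0
    · simp only [coefOf, if_pos hs]
      exact (le_max_left _ _).trans (le_max_right _ _)
    · simp only [coefOf, if_neg hs]
      exact (le_max_right _ _).trans (le_max_right _ _)

end IsProcess

/-- As the inputs are identically distributed, the conditional moments at the root determine those
of the common law. Coefficient and noise are uncorrelated because the two sequences are independent.
-/
lemma IsProcess.inputMoments [IsProbabilityMeasure P] (hX : IsProcess P X A B ε a b c d)
    (h2 : H2 P X A B ε σa σb σc σd) :
    InputMoments (P.map (inputs A B ε 1)) (fun s => if s = 0 then a else b)
      (fun s => if s = 0 then c else d) (fun s => if s = 0 then σa ^ 2 else σb ^ 2)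
      (fun s => if s = 0 then σc ^ 2 else σd ^ 2) := by
  have hm := hX.natFiltration_zero_le
  have hg : 1 ∈ gen 0 := by simp [gen]
  have hi := hX.isIid_inputs
  have hA := integral_eq_of_condExp_ae_eq hm (hX.mean_A 0 1 hg)
  have hB := integral_eq_of_condExp_ae_eq hm (hX.mean_B 0 1 hg)
  refine ⟨fun s hs => ?_, fun s hs => ?_, fun s hs => ?_, fun s hs => ?_, fun s hs => ?_,
    fun s hs => ?_⟩
  · rw [← hi.integral_comp le_rfl (measurable_coefOf s)]
    interval_cases s
    · exact hA
    · exact hB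
  · rw [← hi.integral_comp le_rfl (measurable_noiseOf s)]
    interval_cases s
    · exact integral_eq_of_condExp_ae_eq hm (hX.mean_even 0 1 hg)
    · exact integral_eq_of_condExp_ae_eq hm (hX.mean_odd 0 1 hg)
  · rw [← hi.integral_comp le_rfl (((measurable_coefOf s).sub_const _).pow_const 2)]
    interval_cases s
    · exact integral_sub_sq_eq_of_condVar_ae_eq hm (h2.memLp_coef 1 le_rfl).1
        (hX.mean_A 0 1 hg) (h2.var_A 0 1 hg)
    · exact integral_sub_sq_eq_of_condVar_ae_eq hm (h2.memLp_coef 1 le_rfl).2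
        (hX.mean_B 0 1 hg) (h2.var_B 0 1 hg)
  · rw [← hi.integral_comp le_rfl (((measurable_noiseOf s).sub_const _).pow_const 2)]
    interval_cases s
    · exact integral_sub_sq_eq_of_condVar_ae_eq hm (h2.memLp_noise 1 le_rfl).1
        (hX.mean_even 0 1 hg) (h2.var_even 0 1 hg)
    · exact integral_sub_sq_eq_of_condVar_ae_eq hm (h2.memLp_noise 1 le_rfl).2
        (hX.mean_odd 0 1 hg) (h2.var_odd 0 1 hg)
  · have hmc : Measurable (fun p : ℝ × ℝ => (if s = 0 then p.1 else p.2)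
        - if s = 0 then a else b) := by split_ifs <;> fun_prop
    have hmn : Measurable (fun p : ℝ × ℝ => (if s = 0 then p.1 else p.2)
        - if s = 0 then c else d) := by split_ifs <;> fun_prop
    rw [← hi.integral_comp le_rfl (((measurable_coefOf s).sub_const _).fun_mul
      ((measurable_noiseOf s).sub_const _))]
    have hind := (hX.indepFun_coef_noise le_rfl).comp hmc hmn
    have := hind.integral_fun_mul_eq_mul_integral
      (hmc.comp ((hX.measurable_coef 1 le_rfl).1.prodMk
        (hX.measurable_coef 1 le_rfl).2)).aestronglyMeasurable
      (hmn.comp ((hX.measurable_noise 1 le_rfl).1.prodMk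
        (hX.measurable_noise 1 le_rfl).2)).aestronglyMeasurable
    refine this.trans (mul_eq_zero_of_left ?_ _)
    interval_cases s
    · simp only [Function.comp_def, if_true]
      rw [integral_sub (hX.integrable_coef 1 le_rfl).1 (integrable_const _), hA]
      simp
    · simp only [Function.comp_def, one_ne_zero, if_false]
      rw [integral_sub (hX.integrable_coef 1 le_rfl).2 (integrable_const _), hB]
      simp
  · interval_cases s
    · exact h2.pos_c
    · exact h2.pos_d

end Inputs

/-! ### Limit theorems for the process -/

section Main

variable {Ω : Type*} [mΩ : MeasurableSpace Ω] {P : Measure Ω} [IsProbabilityMeasure P]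
  {X A B ε : ℕ → Ω → ℝ} {a b c d σa σb σc σd ρ : ℝ} {τ : Measure ℝ}

namespace IsProcess

lemma ae_tendsto_genAvg (hX : IsProcess P X A B ε a b c d)
    (hν : InputLaw (P.map (inputs A B ε 1)) ρ)
    (hτ : IsStationary (P.map (inputs A B ε 1)) ρ τ) {l M : ℝ} {f : ℝ → ℝ} (hf : BddLip l M f) :
    ∀ᵐ ω ∂P, Tendsto (fun n => genAvg n fun k => f (X k ω)) atTop (𝓝 (∫ t, f t ∂τ)) := by
  filter_upwards [RCBAR.ae_tendsto_genAvg hX.isIid_inputs hν hτ hf] with ω h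
  -- The law of large numbers holds for all starting points at once, so the random root may be
  -- inserted.
  refine (h (X 1 ω)).congr fun n => ?_
  unfold genAvg
  congr 1
  exact Finset.sum_congr rfl fun k hk =>
    (congrArg f (hX.eq_base_add_slope ω (one_le_of_mem_gen hk))).symm

lemma tendstoInDistribution_branchProcess (hX : IsProcess P X A B ε a b c d)
    (hν : InputLaw (P.map (inputs A B ε 1)) ρ)
    (hτ : IsStationary (P.map (inputs A B ε 1)) ρ τ) [IsProbabilityMeasure τ] :
    TendstoInDistribution (branchProcess X) atTop id (fun _ => P.prod coins) τ where
  forall_aemeasurable n :=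
    (measurable_branchProcess (fun _ hk => hX.measurable_process hk) n).aemeasurable
  aemeasurable_limit := aemeasurable_id
  tendsto := by
    have hXm : ∀ k, 1 ≤ k → Measurable (X k) := fun _ hk => hX.measurable_process hk
    -- Bounded Lipschitz functions suffice. For these the branch expectation is the expected
    -- generation average, and dominated convergence uses its almost sure limit.
    refine tendsto_iff_forall_lipschitz_integral_tendsto.2 ?_
    rintro f ⟨D, hD⟩ ⟨l, hl⟩
    have hf : BddLip l (|f 0| + D) f := by
      refine ⟨fun x y => by simpa [Real.dist_eq] using hl.dist_le_mul x y, fun x => ?_⟩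
      have h1 := hD x 0
      rw [Real.dist_eq] at h1
      have h2 := abs_add_le (f 0) (f x - f 0)
      rw [add_sub_cancel] at h2
      linarith
    have hfm : Measurable f := hl.continuous.measurable
    have hlim : Tendsto (fun n => ∫ ω, genAvg n (fun k => f (X k ω)) ∂P) atTop
        (𝓝 (∫ _, ∫ t, f t ∂τ ∂P)) := by
      refine tendsto_integral_of_dominated_convergence (fun _ => |f 0| + D) (fun n => ?_)
        (integrable_const _) (fun n => Eventually.of_forall fun ω => ?_)
        (hX.ae_tendsto_genAvg hν hτ hf)
      · exact (Measurable.const_mul (Finset.measurable_fun_sum _ fun k hk =>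
          hfm.comp (hXm k (one_le_of_mem_gen hk))) _).aestronglyMeasurable
      · exact abs_genAvg_le_of_bdd hf n _
    simp only [integral_const, probReal_univ, one_smul] at hlim
    simp only [ProbabilityMeasure.coe_mk, Measure.map_id]
    refine hlim.congr fun n => ?_
    rw [integral_map (measurable_branchProcess hXm n).aemeasurable hfm.aestronglyMeasurable,
      integral_branchProcess hXm n hfm hf.bdd]

lemma ae_tendsto_S (hX : IsProcess P X A B ε a b c d)
    (hν : InputLaw (P.map (inputs A B ε 1)) ρ)
    (hτ : IsStationary (P.map (inputs A B ε 1)) ρ τ) :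
    ∀ᵐ ω ∂P, Tendsto (fun n : ℕ => ((2 : ℝ) ^ n)⁻¹ • S (fun k => X k ω) (n - 1)) atTop
      (𝓝 (C τ)) := by
  have h : ∀ i j, ∀ᵐ ω ∂P, Tendsto
      (fun n : ℕ => (((2 : ℝ) ^ n)⁻¹ • S (fun k => X k ω) (n - 1)) i j) atTop (𝓝 (C τ i j)) := by
    intro i j
    filter_upwards [hX.ae_tendsto_genAvg hν hτ (smoothBdd_wt_mul i j).bddLip] with ω hω
    rw [C_apply]
    refine (tendsto_treeAvg_of_genAvg hω).congr' ?_
    filter_upwards [eventually_ge_atTop 1] with n hn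
    rw [Matrix.smul_apply, S_apply _ hn, smul_eq_mul]
  filter_upwards [ae_all_iff.2 fun i => ae_all_iff.2 (h i)] with ω hω
  exact tendsto_pi_nhds.2 fun i => tendsto_pi_nhds.2 (hω i)

lemma ae_tendsto_errorForm (hX : IsProcess P X A B ε a b c d) (h2 : H2 P X A B ε σa σb σc σd)
    (hν : InputLaw (P.map (inputs A B ε 1)) ρ)
    (hτ : IsStationary (P.map (inputs A B ε 1)) ρ τ) :
    ∀ᵐ ω ∂P, Tendsto (fun N : ℕ => (N : ℝ)⁻¹ * ∑ n ∈ Finset.Icc 1 N,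
        ((2 : ℝ) ^ n - 1) * errorForm (C τ) (thetaHatMat (fun k => X k ω) n - !![a, b; c, d]))
      atTop (𝓝 (∑ s, ∑ i, ∑ i', (C τ)⁻¹ i i' *
        (![σa ^ 2, σb ^ 2] s * ∫ t, (t * wt i t) * (t * wt i' t) ∂τ
          + ![σc ^ 2, σd ^ 2] s * ∫ t, wt i t * wt i' t ∂τ))) := by
  have hm := hX.inputMoments h2
  have hC := posDef_C hτ hm hν
  filter_upwards [hX.ae_tendsto_S hν hτ,
    ae_tendsto_score hX.isIid_inputs hν hm hτ (s := 0) (by norm_num),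
    ae_tendsto_score hX.isIid_inputs hν hm hτ (s := 1) (by norm_num)] with ω hS h0 h1
  refine tendsto_average_errorForm
    (W := fun n => (√2 ^ n)⁻¹ • scoreMat (fun s => if s = 0 then a else b)
      (fun s => if s = 0 then c else d) (fun j => inputs A B ε j ω) (X 1 ω) n) hC hS
    (fun s i i' => ?_) ?_
  · fin_cases s
    · exact h0 (X 1 ω) i i'
    · exact h1 (X 1 ω) i i'
  -- The limit C is invertible, so S is eventually invertible and its regularisation inactive.
  · have hdet := ((continuous_id.matrix_det.tendsto (C τ)).comp hS).eventually_ne hC.det_pos.ne'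
    filter_upwards [hdet, eventually_ge_atTop 1] with n hn h1n
    refine thetaHatMat_sub_eq (x := fun k => X k ω) (m := fun s => if s = 0 then a else b)
      (e := fun s => if s = 0 then c else d) (hX.child_eq ω) h1n fun h => hn ?_
    simp [h]

end IsProcess

lemma thetaHat_sub_theta (x : ℕ → ℝ) (n : ℕ) :
    thetaHat x n - theta a b c d = (thetaHatMat x n - !![a, b; c, d]).vec := rfl

lemma norm_vec_sq (E : Matrix (Fin 2) (Fin 2) ℝ) :
    ‖WithLp.toLp 2 E.vec‖ ^ 2 = ∑ s, ∑ i, E i s ^ 2 := by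
  rw [EuclideanSpace.norm_sq_eq, Fintype.sum_prod_type]
  simp [Matrix.vec]

lemma tendsto_div_two_pow_sub_one :
    Tendsto (fun n : ℕ => (n : ℝ) / (2 ^ n - 1)) atTop (𝓝 0) := by
  have h := (tendsto_pow_const_div_const_pow_of_one_lt 1 (one_lt_two (α := ℝ))).const_mul 2
  rw [mul_zero] at h
  refine squeeze_zero' (Eventually.of_forall fun n =>
    div_nonneg n.cast_nonneg (sub_nonneg.2 (one_le_pow₀ one_le_two))) ?_ h
  filter_upwards [eventually_ge_atTop 1] with n hn
  have h1 : (2 : ℝ) ≤ 2 ^ n := by simpa using pow_le_pow_right₀ (one_le_two (α := ℝ)) hn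
  rw [pow_one, ← mul_div_assoc, div_le_div_iff₀ (by linarith) (by linarith)]
  nlinarith [(n.cast_nonneg : (0 : ℝ) ≤ n)]

end Main

end RCBAR

end

/-! ### Consistency, rate, limit law and quadratic strong law -/

theorem mainTheorem1 {Ω : Type*} [MeasurableSpace Ω] (P : Measure Ω) [IsProbabilityMeasure P]
    (X A B ε : ℕ → Ω → ℝ) (a b c d σa σb σc σd ρab ρcd : ℝ)
    (hX : RCBAR.IsProcess P X A B ε a b c d)
    (h1 : RCBAR.H1 P A B)
    (h2 : RCBAR.H2 P X A B ε σa σb σc σd)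
    (h3 : RCBAR.H3 P X A B ε a b c d σa σb σc σd ρab ρcd)
    (h4 : RCBAR.H4 P X A B ε a b c d σa σb σc σd ρab ρcd)
    (h5 : RCBAR.H5 P X A B ε a b c d) :
    (∀ᵐ ω ∂P, Tendsto (fun n => RCBAR.thetaHat (fun k => X k ω) n) atTop
      (𝓝 (RCBAR.theta a b c d))) ∧
    (∀ᵐ ω ∂P,
      (fun n : ℕ => ‖WithLp.toLp 2
        (RCBAR.thetaHat (fun k => X k ω) n - RCBAR.theta a b c d)‖ ^ 2)
        =O[atTop] fun n : ℕ => (n : ℝ) / ((RCBAR.tree (n - 1)).card : ℝ)) ∧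
    ∃ (τ : Measure ℝ) (_ : IsProbabilityMeasure τ),
      TendstoInDistribution (RCBAR.branchProcess X) atTop id
        (fun _ => P.prod RCBAR.coins) τ ∧
      (RCBAR.C τ).PosDef ∧
      ∀ᵐ ω ∂P, Tendsto (fun n : ℕ => (n : ℝ)⁻¹ * ∑ k ∈ Finset.Icc 1 n,
          ((RCBAR.tree (k - 1)).card : ℝ) *
            ((RCBAR.thetaHat (fun j => X j ω) k - RCBAR.theta a b c d) ⬝ᵥ
              (RCBAR.Lam τ *ᵥ (RCBAR.thetaHat (fun j => X j ω) k - RCBAR.theta a b c d))))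
        atTop
        (𝓝 (RCBAR.invSqrt (RCBAR.Lam τ) * RCBAR.L σa σb σc σd ρab ρcd τ *
          RCBAR.invSqrt (RCBAR.Lam τ)).trace) := by
  obtain ⟨μa, μb, μc, μd, νab, νcd, h4⟩ := h4
  have hν := hX.inputLaw h1 (h4.memLp_coef 1 le_rfl).1 (h4.memLp_coef 1 le_rfl).2
    (h4.memLp_noise 1 le_rfl).1 (h4.memLp_noise 1 le_rfl).2
  obtain ⟨τ, hτ⟩ := RCBAR.exists_isStationary hX.isIid_inputs hν
  have := hτ.prob
  have hC := RCBAR.posDef_C hτ (hX.inputMoments h2) hν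
  have hlim := hX.ae_tendsto_errorForm h2 hν hτ
  -- Consistency and the rate are both read off from the quadratic strong law through this bound.
  have hbound : ∀ᵐ ω ∂P, ∃ K : ℝ, ∀ n : ℕ, 1 ≤ n →
      ‖WithLp.toLp 2 (RCBAR.thetaHat (fun k => X k ω) n - RCBAR.theta a b c d)‖ ^ 2
        ≤ K * ((n : ℝ) / (2 ^ n - 1)) := by
    filter_upwards [hlim] with ω hω
    obtain ⟨K, hK⟩ := RCBAR.exists_sq_le_of_tendsto_average hC hω
    refine ⟨K, fun n hn => ?_⟩
    rw [RCBAR.thetaHat_sub_theta, RCBAR.norm_vec_sq]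
    exact hK n hn
  refine ⟨?_, ?_, τ, this, hX.tendstoInDistribution_branchProcess hν hτ, hC, ?_⟩
  · filter_upwards [hbound] with ω ⟨K, hK⟩
    have h0 : Tendsto (fun n => ‖WithLp.toLp 2
        (RCBAR.thetaHat (fun k => X k ω) n - RCBAR.theta a b c d)‖ ^ 2) atTop (𝓝 0) := by
      refine squeeze_zero' (Eventually.of_forall fun n => sq_nonneg _)
        ((eventually_ge_atTop 1).mono hK) ?_
      simpa using RCBAR.tendsto_div_two_pow_sub_one.const_mul K
    refine tendsto_pi_nhds.2 fun p => tendsto_iff_dist_tendsto_zero.2 ?_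
    have h1 := h0.sqrt
    simp only [Real.sqrt_sq (norm_nonneg _), Real.sqrt_zero] at h1
    refine squeeze_zero (fun n => dist_nonneg) (fun n => ?_) h1
    rw [Real.dist_eq]
    exact PiLp.norm_apply_le (WithLp.toLp 2
      (RCBAR.thetaHat (fun k => X k ω) n - RCBAR.theta a b c d)) p
  · filter_upwards [hbound] with ω ⟨K, hK⟩
    refine Asymptotics.IsBigO.of_bound K ?_
    filter_upwards [eventually_ge_atTop 1] with n hn
    rw [RCBAR.card_tree_pred hn, Real.norm_of_nonneg (sq_nonneg _), Real.norm_of_nonneg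
      (div_nonneg n.cast_nonneg (sub_nonneg.2 (one_le_pow₀ one_le_two)))]
    exact hK n hn
  · filter_upwards [hlim] with ω hω
    rw [RCBAR.trace_invSqrt_mul_mul hC]
    refine (hω.congr fun N => ?_).trans_eq ?_
    · congr 1
      refine Finset.sum_congr rfl fun n hn => ?_
      rw [RCBAR.card_tree_pred (Finset.mem_Icc.1 hn).1, RCBAR.thetaHat_sub_theta,
        RCBAR.dotProduct_Lam_mulVec]
    -- The trace reads L with i and i' exchanged; commuting the factors in the integrands identifies
    -- the two limits.
    · simp only [RCBAR.L_apply_same, mul_comm]
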